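/- **Conventions.** Graphs are finite and simple; $G[S]$ is the subgraph induced by $S\subseteq V(G)$ and $G\setminus S=G[V(G)\setminus S]$. $N(D)$ is the set of vertices outside $D$ with a neighbour in $D$, $N[D]=D\cup N(D)$, and a set is *$d$-bounded* if it lies in the ball $N^d[v]$ of radius $d$ around some vertex $v$. A *path* is an induced path, and it is *even* if its number of edges is even. For $w:V(G)\to[0,\infty)$ put $w(D)=\sum_{v\in D}w(v)$. A *uniform weight function* is $w=\frac1{|Y|}\mathbf 1_Y$ for a set $Y\subseteq V(G)$ (and $w=0$ if $Y=\emptyset$). $Y\subseteq V(G)$ is a *$(w,c)$-balanced separator* if $w(D)\le c$ for every component $D$ of $G\setminus Y$. A vertex $v$ *breaks* a set $X$ of vertices in a graph $H$ if no component $D$ of $H\setminus N[v]$ satisfies $X\subseteq N[D]$. $G$ is *paw-friendly* if it is perfect and, for every induced subgraph $H$ and all vertices $c,a,b_1,b_2$ of $H$ that induce a graph with edge set $\{ab_1,ab_2,b_1b_2,ac\}$, in $H$ either $a$ breaks $\{c,b_1,b_2\}$, or $b_1$ breaks $\{c,b_2\}$, or $b_2$ breaks $\{c,b_1\}$. $X\subseteq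 V(G)$ is an *even set* in $G$ if for all distinct $x,y\in X$ every path of $G$ from $x$ to $y$ is even. Pairwise disjoint sets $(X_1,\dots,X_k)$ form a *$k$-iterated even set* if $X_i$ is an even set in $G\setminus\bigcup_{j<i}X_j$ for each $i$. Such a tuple is a *$(w,k,c,d)$-even set separator* if also $|N(D)|\le d$ and $w(D)\le c$ for every component $D$ of $G\setminus\bigcup_iX_i$. The graphs in a class are *$(k,c,d,m)$-tame* if there are one algorithm (a program for a random access machine that reads $G$ as an adjacency matrix together with the set $Y$) and a constant $B$ such that, for every $G$ in the class and every uniform weight function $w$ on $V(G)$, the algorithm finds a $(w,k,c,d)$-even set separator of $G$ in at most $B\,|V(G)|^m$ steps. **Theorem.** Let $c\in[\frac12,1)$, let $\delta$ be a positive integer and $K=1+\delta+\dots+\delta^{\delta+3}$. (a) The paw-friendly graphs of maximum degree $\delta$ are $(K,c,K,3)$-tame. (b) Let $G$ be a paw-friendly graph of maximum degree $\delta$ and $w:V(G)\to[0,1]$ with $w(V(G))=1$, and suppose that $G$ has no $(\delta+3)$-bounded $(w,c)$-balanced separator. For a vertex $v$ let $B_v$ be a largest weight component of $G\setminus N[v]$,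 let $C_v$ consist of $v$ and its neighbours that have a neighbour in $B_v$, and let $A_v=V(G)\setminus(B_v\cup C_v)$. Call $u,v$ *star twins* if $B_u=B_v$, $C_u\setminus\{u\}=C_v\setminus\{v\}$ and $A_u\setminus\{v\}=A_v\setminus\{u\}$. Fix an ordering $\mathcal O$ of $V(G)$, and let $x\le_A y$ mean that $x=y$, or $x,y$ are star twins with $\mathcal O(x)<\mathcal O(y)$, or $x,y$ are not star twins and $y\in A_x$. Let $X$ be the set of $\le_A$-minimal vertices and $\beta=\bigcap_{x\in X}(B_x\cup C_x)$. Then $G[\beta]$ is bipartite, and there is an injective numbering $\ell$ of $V(G)$ with $\ell(u)<\ell(v)$ whenever $u\le_A v$ and $u\ne v$. For every bipartition $(X_1,X_2)$ of $G[\beta]$ and every such $\ell$, let $\mathcal R=\beta\cup\bigcup_{x\in X_2}C_x$ (the *core bag*), let $L_i'$ be the set of vertices that, for some $x\in X_1$, are the $i$-th vertex of $A_x\cap\mathcal R$ in the order given by $\ell$, and let $L_i=L_i'\setminus(L_{i+1}\cup\dots\cup L_{\delta^2})$ for $1\le i\le\delta^2$. Then $\mathcal R=X_1\cup X_2\cup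 L_1\cup\dots\cup L_{\delta^2}$, and $(X_1,X_2,L_1,\dots,L_{\delta^2})$ is a $(w,\delta^2+2,c,K)$-even set separator of $G$. -/

import Mathlib

/-! ## Graphs: neighbourhoods, components, perfect graphs, paw-friendly graphs

For a set `S` of vertices of `G`, the induced subgraph `G[S]` is handled through the set `S`. -/

namespace TameGraphs

/-- `N(D)`: the vertices outside `D` with a neighbour in `D`. -/
def nbhd {V : Type*} (G : SimpleGraph V) (D : Set V) : Set V :=
  {v | v ∉ D ∧ ∃ u ∈ D, G.Adj v u}

/-- `N[v]`: the vertex `v` together with its neighbours. -/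
def closedNbhd {V : Type*} (G : SimpleGraph V) (v : V) : Set V :=
  {u | u = v ∨ G.Adj v u}

/-- `D` is (the vertex set of) a connected component of the induced subgraph `G[S]`. -/
def IsComponent {V : Type*} (G : SimpleGraph V) (S D : Set V) : Prop :=
  ∃ K : (G.induce S).ConnectedComponent, D = Subtype.val '' K.supp

/-- `G` is perfect: chromatic number and clique number agree on every induced subgraph. -/
def IsPerfect {V : Type*} (G : SimpleGraph V) : Prop :=
  ∀ S : Set V, (G.induce S).chromaticNumber = ((G.induce S).cliqueNum : ℕ∞)

/-- In the graph `H = G[S]`, the vertex `v` breaks the set `X`: no connected component `D` of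
`H ∖ N[v]` has `X ⊆ N[D]`. (It is used for `v ∈ S` and `X ⊆ S`, and then it does not
matter whether `N[v]` and `N[D]` are taken in `H` or in `G`.) -/
def Breaks {V : Type*} (G : SimpleGraph V) (S : Set V) (v : V) (X : Set V) : Prop :=
  ∀ D : Set V, IsComponent G (S \ closedNbhd G v) D → ¬ X ⊆ D ∪ nbhd G D

/-- `G` is paw-friendly: it is perfect, and in every induced subgraph `H = G[S]`, for every
paw with vertex set `{c, a, b₁, b₂}` and edge set `{ab₁, ab₂, b₁b₂, ac}`, either `a` breaks
`{c, b₁, b₂}`, or `b₁` breaks `{c, b₂}`, or `b₂` breaks `{c, b₁}`, in `H`. -/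
def PawFriendly {V : Type*} (G : SimpleGraph V) : Prop :=
  IsPerfect G ∧
  ∀ S : Set V, ∀ c ∈ S, ∀ a ∈ S, ∀ b₁ ∈ S, ∀ b₂ ∈ S,
    G.Adj a b₁ → G.Adj a b₂ → G.Adj b₁ b₂ → G.Adj a c → ¬ G.Adj c b₁ → ¬ G.Adj c b₂ →
    Breaks G S a {c, b₁, b₂} ∨ Breaks G S b₁ {c, b₂} ∨ Breaks G S b₂ {c, b₁}

open Classical in
/-- The maximum degree of `G` is `δ`. -/
def HasMaxDegree {V : Type*} [Fintype V] (G : SimpleGraph V) (δ : ℕ) : Prop :=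
  G.maxDegree = δ

/-! ## Even sets, balanced separators, even set separators -/

/-- In the graph `G[S]`, every induced path from `x` to `y` has an even number of edges.
(An induced path with `k` edges is an induced copy of the path graph on `k + 1` vertices.) -/
def EvenPair {V : Type*} (G : SimpleGraph V) (S : Set V) (x y : V) : Prop :=
  ∀ (k : ℕ) (p : SimpleGraph.pathGraph (k + 1) ↪g G),
    (∀ i, p i ∈ S) → p 0 = x → p (Fin.last k) = y → Even k

/-- `X` is an even set in the graph `G[S]`. -/
def EvenSet {V : Type*} (G : SimpleGraph V) (S X : Set V) : Prop :=
  X ⊆ S ∧ ∀ x ∈ X, ∀ y ∈ X, x ≠ y → EvenPair G S x y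

/-- `(X₁, …, X_k)` is a `k`-iterated even set in `G`: the sets are pairwise disjoint, and
`X_i` is an even set in `G ∖ ⋃_{j < i} X_j` for every `i`. -/
def IteratedEvenSet {V : Type*} (G : SimpleGraph V) {k : ℕ} (X : Fin k → Set V) : Prop :=
  (∀ i j, i ≠ j → Disjoint (X i) (X j)) ∧
  ∀ i, EvenSet G (⋃ j, ⋃ _ : j < i, X j)ᶜ (X i)

/-- The weight `w(D)` of a set of vertices. -/
noncomputable def weight {V : Type*} [Fintype V] (w : V → ℝ) (D : Set V) : ℝ :=
  ∑ v, D.indicator w v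

/-- `X` is a `(w, k, c, d)`-even set separator of `G`. -/
def EvenSetSeparator {V : Type*} [Fintype V] (G : SimpleGraph V) (w : V → ℝ) (k : ℕ) (c : ℝ)
    (d : ℕ) (X : Fin k → Set V) : Prop :=
  IteratedEvenSet G X ∧
  ∀ D, IsComponent G (⋃ i, X i)ᶜ D → (nbhd G D).ncard ≤ d ∧ weight w D ≤ c

/-- `Y` is a `(w, c)`-balanced separator of `G`. -/
def BalancedSeparator {V : Type*} [Fintype V] (G : SimpleGraph V) (w : V → ℝ) (c : ℝ)
    (Y : Set V) : Prop :=
  ∀ D, IsComponent G Yᶜ D → weight w D ≤ c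

/-- `Y` is `d`-bounded: it lies in a ball `N^d[v]`. -/
def Bounded {V : Type*} (G : SimpleGraph V) (d : ℕ) (Y : Set V) : Prop :=
  ∃ v, ∀ u ∈ Y, G.edist v u ≤ d

/-- The uniform weight function of the set `X`. -/
noncomputable def uniformWeight {n : ℕ} (X : Finset (Fin n)) (v : Fin n) : ℝ :=
  if v ∈ X then 1 / (X.card : ℝ) else 0

/-! ## A random access machine

Structured programs over a memory of natural numbers. The memory is organised as
two-dimensional arrays with constant names; `m a i j` is the entry `a[i][j]`. Every elementary
operation (constant, memory access, increment, decrement, comparison, connective, assignment,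
branching) costs one step. As the only growing arithmetic operation is the increment,
a computation with `t` steps only meets numbers that exceed those in its input and its program
by at most `t`, so that all words have a logarithmic number of bits if `t` is polynomial. -/

/-- The contents of the memory. -/
abbrev Memory := ℕ → ℕ → ℕ → ℕ

/-- Numerical terms; `get a i j` reads the entry `a[i][j]`. -/
inductive Term where
  | lit (c : ℕ)
  | get (a : ℕ) (i j : Term)
  | succ (e : Term)
  | pred (e : Term)

/-- The value of a term. -/
def Term.val (m : Memory) : Term → ℕ
  | .lit c => c
  | .get a i j => m a (i.val m) (j.val m)
  | .succ e => e.val m + 1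
  | .pred e => e.val m - 1

/-- The number of steps for evaluating a term. -/
def Term.cost : Term → ℕ
  | .lit _ => 1
  | .get _ i j => i.cost + j.cost + 1
  | .succ e => e.cost + 1
  | .pred e => e.cost + 1

/-- Tests. -/
inductive Test where
  | lt (e f : Term)
  | eq (e f : Term)
  | not (b : Test)
  | and (b b' : Test)

/-- The truth value of a test. -/
def Test.holds (m : Memory) : Test → Prop
  | .lt e f => e.val m < f.val m
  | .eq e f => e.val m = f.val m
  | .not b => ¬ b.holds m
  | .and b b' => b.holds m ∧ b'.holds m

/-- The number of steps for evaluating a test. -/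
def Test.cost : Test → ℕ
  | .lt e f => e.cost + f.cost + 1
  | .eq e f => e.cost + f.cost + 1
  | .not b => b.cost + 1
  | .and b b' => b.cost + b'.cost + 1

/-- Programs; `set a i j e` is the assignment `a[i][j] := e`, and `loop b p` is
"while `b` do `p`". -/
inductive Program where
  | skip
  | set (a : ℕ) (i j e : Term)
  | seq (p q : Program)
  | ite (b : Test) (p q : Program)
  | loop (b : Test) (p : Program)

/-- The memory after the assignment `a[i][j] := x`. -/
def Memory.update (m : Memory) (a i j x : ℕ) : Memory :=
  fun a' i' j' => if a' = a ∧ i' = i ∧ j' = j then x else m a' i' j'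

/-- `Runs p m m' t`: started with memory `m`, the program `p` halts after exactly `t` steps
with memory `m'`. -/
inductive Runs : Program → Memory → Memory → ℕ → Prop where
  | skip (m : Memory) : Runs .skip m m 1
  | set (m : Memory) (a : ℕ) (i j e : Term) :
      Runs (.set a i j e) m (m.update a (i.val m) (j.val m) (e.val m))
        (i.cost + j.cost + e.cost + 1)
  | seq {p q : Program} {m₀ m₁ m₂ : Memory} {s t : ℕ} :
      Runs p m₀ m₁ s → Runs q m₁ m₂ t → Runs (.seq p q) m₀ m₂ (s + t)
  | ite_true {b : Test} {p q : Program} {m m' : Memory} {t : ℕ} :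
      b.holds m → Runs p m m' t → Runs (.ite b p q) m m' (b.cost + t + 1)
  | ite_false {b : Test} {p q : Program} {m m' : Memory} {t : ℕ} :
      ¬ b.holds m → Runs q m m' t → Runs (.ite b p q) m m' (b.cost + t + 1)
  | loop_done {b : Test} {p : Program} {m : Memory} :
      ¬ b.holds m → Runs (.loop b p) m m (b.cost + 1)
  | loop_step {b : Test} {p : Program} {m₀ m₁ m₂ : Memory} {s t : ℕ} :
      b.holds m₀ → Runs p m₀ m₁ s → Runs (.loop b p) m₁ m₂ t →
      Runs (.loop b p) m₀ m₂ (b.cost + s + t + 1)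

open Classical in
/-- The memory that holds the input: a graph on the vertices `0, …, n - 1` and a set `X` of
vertices (which stands for its uniform weight function). The number `n` is in `0[0][0]`, the
adjacency matrix is array `1`, the indicator function of `X` is column `0` of array `2`, and all
other entries are `0`. -/
noncomputable def inputMemory {n : ℕ} (G : SimpleGraph (Fin n)) (X : Finset (Fin n)) : Memory :=
  fun a i j =>
    if a = 0 ∧ i = 0 ∧ j = 0 then n
    else if a = 1 ∧ ∃ (hi : i < n) (hj : j < n), G.Adj ⟨i, hi⟩ ⟨j, hj⟩ then 1
    else if a = 2 ∧ j = 0 ∧ ∃ hi : i < n, (⟨i, hi⟩ : Fin n) ∈ X then 1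
    else 0

/-- The `k` sets that a final memory describes, in column `0` of array `3`: the vertex `v` is in
the `i`-th set, `i = 1, …, k`, if `3[v][0] = i` (and in none of them if `3[v][0]` is not
in `{1, …, k}`). -/
def outputSets (n k : ℕ) (m : Memory) (i : Fin k) : Set (Fin n) :=
  {v | m 3 v 0 = i + 1}

/-- The graphs in the class `𝒞` are `(k, c, d, m)`-tame: one program finds, for every graph `G` in
the class and every uniform weight function `w` on `V(G)`, a `(w, k, c, d)`-even set separator
of `G`, in time `O(|V(G)|^m)`. -/
def Tame (𝒞 : ∀ n : ℕ, SimpleGraph (Fin n) → Prop) (k : ℕ) (c : ℝ) (d m : ℕ) : Prop :=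
  ∃ (P : Program) (B : ℕ), ∀ (n : ℕ) (G : SimpleGraph (Fin n)), 𝒞 n G →
    ∀ X : Finset (Fin n), ∃ (out : Memory) (t : ℕ),
      Runs P (inputMemory G X) out t ∧ t ≤ B * n ^ m ∧
      EvenSetSeparator G (uniformWeight X) k c d (outputSets n k out)

/-! ## Canonical star separations, the star-free bag and the core bag -/

section CoreBag

variable {V : Type*} [Fintype V] (G : SimpleGraph V) (w : V → ℝ)

/-- `B` is a largest weight connected component of `G ∖ N[v]`. -/
def IsLargestComponent (v : V) (B : Set V) : Prop :=
  IsComponent G (closedNbhd G v)ᶜ B ∧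
  ∀ D, IsComponent G (closedNbhd G v)ᶜ D → weight w D ≤ weight w B

open Classical in
/-- `B_v`: a largest weight connected component of `G ∖ N[v]` (empty if there is none). -/
noncomputable def starB (v : V) : Set V :=
  if h : ∃ B, IsLargestComponent G w v B then h.choose else ∅

/-- `C_v`: the vertex `v` and its neighbours that have a neighbour in `B_v`. -/
def starC (v : V) : Set V :=
  {u | u = v ∨ (G.Adj v u ∧ ∃ b ∈ starB G w v, G.Adj u b)}

/-- `A_v`: all other vertices. -/
def starA (v : V) : Set V := (starB G w v ∪ starC G w v)ᶜ

/-- `u` and `v` are star twins. -/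
def StarTwins (u v : V) : Prop :=
  starB G w u = starB G w v ∧ starC G w u \ {u} = starC G w v \ {v} ∧
  starA G w u \ {v} = starA G w v \ {u}

/-- The relation `x ≤_A y`, for an ordering `ord` of the vertices. -/
def StarLE (ord : V → ℕ) (x y : V) : Prop :=
  x = y ∨ (StarTwins G w x y ∧ ord x < ord y) ∨ (¬ StarTwins G w x y ∧ y ∈ starA G w x)

/-- The star covering: the minimal vertices with respect to `≤_A`. -/
def starCovering (ord : V → ℕ) : Set V :=
  {x | ∀ y, StarLE G w ord y x → y = x}

/-- The star-free bag `β`. -/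
def starFreeBag (ord : V → ℕ) : Set V :=
  ⋂ x ∈ starCovering G w ord, (starB G w x ∪ starC G w x)

/-- `(X₁, X₂)` is a bipartition of (the subgraph of `G` induced by) `S`. -/
def IsBipartition {V : Type*} (G : SimpleGraph V) (S X₁ X₂ : Set V) : Prop :=
  X₁ ∪ X₂ = S ∧ Disjoint X₁ X₂ ∧
  (∀ x ∈ X₁, ∀ y ∈ X₁, ¬ G.Adj x y) ∧ (∀ x ∈ X₂, ∀ y ∈ X₂, ¬ G.Adj x y)

/-- `ℓ` numbers the vertices by a linear extension of `≤_A`. -/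
def IsLinearExtension (ord ℓ : V → ℕ) : Prop :=
  Function.Injective ℓ ∧ ∀ u v, u ≠ v → StarLE G w ord u v → ℓ u < ℓ v

/-- The core bag `R = β ∪ ⋃_{x ∈ X₂} C_x`. -/
def coreBag (ord : V → ℕ) (X₂ : Set V) : Set V :=
  starFreeBag G w ord ∪ ⋃ x ∈ X₂, starC G w x

/-- `D_x = A_x ∩ R`. -/
def coreA (ord : V → ℕ) (X₂ : Set V) (x : V) : Set V :=
  starA G w x ∩ coreBag G w ord X₂

/-- `L'_i`: the vertices that, for some `x ∈ X₁`, are the `i`-th vertex (`i = 1, 2, …`) of `D_x`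
in the order given by `ℓ`. -/
def preLayer (ord ℓ : V → ℕ) (X₁ X₂ : Set V) (i : ℕ) : Set V :=
  {v | ∃ x ∈ X₁, v ∈ coreA G w ord X₂ x ∧ {u ∈ coreA G w ord X₂ x | ℓ u ≤ ℓ v}.ncard = i}

/-- `L_i = L'_i ∖ (L_{i+1} ∪ … ∪ L_q)`, for `i = 1, …, q`; here `L_{i+1} ∪ … ∪ L_q` is written as
`L'_{i+1} ∪ … ∪ L'_q`, which is the same set. -/
def layer (ord ℓ : V → ℕ) (X₁ X₂ : Set V) (q i : ℕ) : Set V :=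
  preLayer G w ord ℓ X₁ X₂ i \ ⋃ j ∈ Set.Ioc i q, preLayer G w ord ℓ X₁ X₂ j

/-- The tuple `(X₁, X₂, L₁, …, L_q)`. -/
def coreTuple (ord ℓ : V → ℕ) (X₁ X₂ : Set V) (q : ℕ) : Fin (q + 2) → Set V :=
  fun i => if i.val = 0 then X₁ else if i.val = 1 then X₂
    else layer G w ord ℓ X₁ X₂ q (i.val - 1)

end CoreBag

end TameGraphs

/-! ### Idea of the proof

*The star covering.* Suppose that no ball of radius three is a balanced separator
(`NoLocalSeparator`). Then `G ∖ N[v]` has a unique component `B_v` of weight over one half, star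
twins are vertices with the same `B_v`, and `x ≤_A y` holds only if `B_x ⊆ B_y`. So the sizes of the
sets `B_v` give a linear extension (`isLinearExtension_of_lex`), every vertex that is not
`≤_A`-minimal is cut off by a minimal one, and `β` is the star covering itself
(`starFreeBag_eq`). In a paw of the star covering, the connected sets `B_v` contradict each of the
three ways to be broken (`starCovering_paw_free`), and a component of a paw-free graph with a
triangle lies in a small ball, which leads to a contradiction as well
(`starCovering_triangle_free`). A triangle-free perfect graph is bipartite.

*Even paths.* Two induced paths with the same ends and anticomplete interiors have the same parity
by perfection. So a stretch of an induced path through `A_z` with ends in `C_z` can be compared with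
paths through `B_z` and through `z`, and may be replaced by `z` without a change of parity, once it
is known that the path has no edge in `C_z`, which is again due to paw-friendliness. Rerouting
through all stars of the star covering moves the path into the bipartite graph `G[β]`, and this
settles the classes `X₁` and `X₂` (`even_of_bipartition`). A path between two vertices of a layer
that avoids `X₁` and the lower layers has to leave the sets `A_x` that contain its ends; its first
and its last stretch, up to vertices of `X₂`, are odd, and the rest is even (`even_of_layer`). The
choice of `ℓ` excludes that another vertex of the path cuts off one of the ends. Every
vertex of `D_x` has a common neighbour with `x`, so there are at most `δ²` of them, and each
component outside the core bag lies in one set `A_x`, which bounds its weight and its neighbourhood.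

*The algorithm.* Each array is filled once, and its entries are either numbers of vertices that pass
a test on earlier arrays, or labels of components. This takes cubic time, and in the end the
defining equations of all arrays hold together (`exec_phases`). If a ball of radius three is
balanced, its vertices form the output, one by one. If not, the output is read off from the arrays
that describe the core bag. Two vertices in one component of a bipartite graph are in the same
class if and only if they are in the same component of its square (`isBipartition_of_labels`), and
the index of the layer of a vertex is its maximal position in a set `D_x`. -/

namespace TameGraphs

/-! ### Connected sets, components and two-colourings -/

section Basics

variable {V : Type*} {G : SimpleGraph V}

/-- A set of vertices that induces a connected (or empty) subgraph, in the form in which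
connectivity is used: a subset that is closed under adjacency within `D` is empty or `D`. -/
def ConnectedSet (G : SimpleGraph V) (D : Set V) : Prop :=
  ∀ E : Set V, (∃ x ∈ D, x ∈ E) → (∀ x ∈ D, x ∈ E → ∀ y ∈ D, G.Adj x y → y ∈ E) → D ⊆ E

theorem IsComponent.subset {S D : Set V} (h : IsComponent G S D) : D ⊆ S := by
  obtain ⟨K, rfl⟩ := h
  rintro _ ⟨x, _, rfl⟩
  exact x.2

theorem IsComponent.nonempty {S D : Set V} (h : IsComponent G S D) : D.Nonempty := by
  obtain ⟨K, rfl⟩ := h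
  obtain ⟨x, hx⟩ := K.exists_rep
  exact ⟨x, x, hx, rfl⟩

theorem IsComponent.mem_of_adj {S D : Set V} (h : IsComponent G S D) {x y : V} (hx : x ∈ D)
    (hy : y ∈ S) (hxy : G.Adj x y) : y ∈ D := by
  obtain ⟨K, rfl⟩ := h
  obtain ⟨x, hx, rfl⟩ := hx
  refine ⟨⟨y, hy⟩, ?_, rfl⟩
  exact K.mem_supp_of_adj_mem_supp hx (by simpa using hxy)

theorem IsComponent.connectedSet {S D : Set V} (h : IsComponent G S D) : ConnectedSet G D := by
  obtain ⟨K, rfl⟩ := h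
  rintro E ⟨_, ⟨x, hx, rfl⟩, hxE⟩ hcl _ ⟨y, hy, rfl⟩
  have hxy : (G.induce S).Reachable x y := by
    rw [SimpleGraph.ConnectedComponent.mem_supp_iff] at hx hy
    exact SimpleGraph.ConnectedComponent.exact (hx.trans hy.symm)
  obtain ⟨p⟩ := hxy
  clear hy
  induction p with
  | nil => exact hxE
  | @cons a b c hab p ih =>
    have hb : b ∈ K.supp := K.mem_supp_of_adj_mem_supp hx hab
    exact ih hb (hcl _ ⟨a, hx, rfl⟩ hxE _ ⟨b, hb, rfl⟩ (by simpa using hab))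

theorem exists_isComponent {S : Set V} {v : V} (hv : v ∈ S) :
    ∃ D, IsComponent G S D ∧ v ∈ D :=
  ⟨_, ⟨(G.induce S).connectedComponentMk ⟨v, hv⟩, rfl⟩, ⟨v, hv⟩, rfl, rfl⟩

theorem IsComponent.subset_of_connectedSet {S D E : Set V} (h : IsComponent G S D)
    (hE : ConnectedSet G E) (hES : E ⊆ S) (hDE : ∃ x ∈ E, x ∈ D) : E ⊆ D :=
  hE D hDE fun _ _ hx _ hy hxy => h.mem_of_adj hx (hES hy) hxy

theorem mem_closedNbhd_self (v : V) : v ∈ closedNbhd G v := Or.inl rfl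

theorem not_mem_closedNbhd {u v : V} : u ∉ closedNbhd G v ↔ u ≠ v ∧ ¬ G.Adj v u := by
  simp [closedNbhd]

/-- In a perfect graph every triangle-free induced subgraph is bipartite. -/
theorem IsPerfect.exists_twoColouring [Finite V] (hG : IsPerfect G) {S : Set V}
    (hS : ∀ x ∈ S, ∀ y ∈ S, ∀ z ∈ S, G.Adj x y → G.Adj y z → G.Adj x z → False) :
    ∃ col : V → Bool, ∀ x ∈ S, ∀ y ∈ S, G.Adj x y → col x ≠ col y := by
  classical
  have hcf : (G.induce S).CliqueFree 3 := by
    intro s hs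
    rw [SimpleGraph.is3Clique_iff] at hs
    obtain ⟨a, b, c, hab, hac, hbc, -⟩ := hs
    exact hS a a.2 b b.2 c c.2 (by simpa using hab) (by simpa using hbc) (by simpa using hac)
  have hle : (G.induce S).cliqueNum ≤ 2 := by
    by_contra hlt
    obtain ⟨s, hs⟩ := (G.induce S).exists_isNClique_cliqueNum
    exact (hcf.mono (by omega)) s hs
  have hchi : (G.induce S).chromaticNumber ≤ (2 : ℕ) := by
    rw [hG S]
    exact_mod_cast hle
  have hcol : (G.induce S).Colorable 2 := SimpleGraph.chromaticNumber_le_iff_colorable.1 hchi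
  let C : (G.induce S).Coloring Bool := hcol.toColoring (by simp)
  refine ⟨fun v => if hv : v ∈ S then C ⟨v, hv⟩ else false, fun x hx y hy hxy => ?_⟩
  simp only [hx, hy, dif_pos]
  exact C.valid (by simpa using hxy)

theorem edist_le_one_of_adj {a u : V} (h : G.Adj a u) : G.edist a u ≤ 1 := by
  simpa using SimpleGraph.edist_le (SimpleGraph.Walk.cons h SimpleGraph.Walk.nil)

theorem edist_succ_le {a u v : V} {k : ℕ} (h : G.edist a u ≤ k) (huv : G.Adj u v) :
    G.edist a v ≤ (k + 1 : ℕ) := by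
  refine (SimpleGraph.edist_triangle (v := u)).trans ?_
  push_cast
  exact add_le_add h (edist_le_one_of_adj huv)

end Basics

/-! ### Induced paths -/

section Paths

variable {V : Type*} {G : SimpleGraph V}

/-- The vertices `p 0, …, p n` form an induced path with `n` edges, in this order. The values
`p i` with `i > n` are irrelevant. -/
structure IndPath (G : SimpleGraph V) (n : ℕ) (p : ℕ → V) : Prop where
  adj : ∀ i < n, G.Adj (p i) (p (i + 1))
  not_adj : ∀ i j, i + 1 < j → j ≤ n → ¬ G.Adj (p i) (p j)
  ne : ∀ i j, i < j → j ≤ n → p i ≠ p j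

namespace IndPath

variable {n : ℕ} {p : ℕ → V}

theorem reverse (h : IndPath G n p) : IndPath G n (fun i => p (n - i)) where
  adj i hi := by
    have := (h.adj (n - (i + 1)) (by omega)).symm
    rwa [show n - (i + 1) + 1 = n - i by omega] at this
  not_adj i j hij hj hadj := h.not_adj (n - j) (n - i) (by omega) (by omega) hadj.symm
  ne i j hij hj := (h.ne (n - j) (n - i) (by omega) (by omega)).symm

theorem segment (h : IndPath G n p) (s m : ℕ) (hsm : s + m ≤ n) :
    IndPath G m (fun i => p (s + i)) where
  adj i hi := h.adj (s + i) (by omega)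
  not_adj i j hij hj := h.not_adj (s + i) (s + j) (by omega) (by omega)
  ne i j hij hj := h.ne (s + i) (s + j) (by omega) (by omega)

theorem adj_iff (h : IndPath G n p) {i j : ℕ} (hi : i ≤ n) (hj : j ≤ n) :
    G.Adj (p i) (p j) ↔ i + 1 = j ∨ j + 1 = i := by
  constructor
  · intro hadj
    rcases lt_trichotomy i j with hij | rfl | hij
    · by_contra hc
      exact h.not_adj i j (by omega) hj hadj
    · exact (G.loopless.irrefl _ hadj).elim
    · by_contra hc
      exact h.not_adj j i (by omega) hi hadj.symm
  · rintro (rfl | rfl)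
    · exact h.adj i (by omega)
    · exact (h.adj j (by omega)).symm

/-- Along a path, the colours of a proper two-colouring alternate. -/
theorem colour_eq (h : IndPath G n p) {S : Set V} {col : V → Bool}
    (hcol : ∀ x ∈ S, ∀ y ∈ S, G.Adj x y → col x ≠ col y) (hS : ∀ i ≤ n, p i ∈ S) :
    col (p n) = col (p 0) ↔ Even n := by
  have key : ∀ i ≤ n, (col (p i) = col (p 0) ↔ Even i) := by
    intro i
    induction i with
    | zero => simp
    | succ i ih =>
      intro hi
      have h1 := ih (by omega)
      have h2 := hcol _ (hS i (by omega)) _ (hS (i + 1) hi) (h.adj i (by omega))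
      rw [Nat.even_add_one, ← h1]
      revert h2
      cases col (p i) <;> cases col (p (i + 1)) <;> cases col (p 0) <;> simp
  exact key n le_rfl

/-- The vertices of an induced path are triangle-free. -/
theorem no_triangle (h : IndPath G n p) {i j k : ℕ} (hi : i ≤ n) (hj : j ≤ n) (hk : k ≤ n)
    (hij : G.Adj (p i) (p j)) (hjk : G.Adj (p j) (p k)) (hik : G.Adj (p i) (p k)) : False := by
  rw [h.adj_iff ‹_› ‹_›] at hij hjk hik
  omega

/-- A path that meets a set closed under adjacency along the path stays in it. -/
theorem mem_of_closed {B : Set V} {s t : ℕ} (hs : p s ∈ B)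
    (hcl : ∀ i, s ≤ i → i < t → p i ∈ B → p (i + 1) ∈ B) : ∀ i, s ≤ i → i ≤ t → p i ∈ B := by
  intro i hsi
  induction i, hsi using Nat.le_induction with
  | base => exact fun _ => hs
  | succ i hi ih => exact fun hit => hcl i hi (by omega) (ih (by omega))

theorem mem_of_closed_down {B : Set V} {s t : ℕ} (ht : p t ∈ B)
    (hcl : ∀ i, s ≤ i → i < t → p (i + 1) ∈ B → p i ∈ B) : ∀ i, s ≤ i → i ≤ t → p i ∈ B := by
  intro i hsi hit
  induction hd : t - i generalizing i with
  | zero => rwa [show i = t by omega]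
  | succ d ih => exact hcl i hsi (by omega) (ih (i + 1) (by omega) (by omega) (by omega))

end IndPath

/-- Two vertices that are joined through a connected set are joined by an induced path through
that set: a shortest one. -/
theorem exists_indPath_through {B : Set V} (hB : ConnectedSet G B) {x y : V}
    (hx : ∃ b ∈ B, G.Adj x b) (hy : ∃ b ∈ B, G.Adj y b) (hxy : ¬ G.Adj x y) (hne : x ≠ y) :
    ∃ n p, IndPath G n p ∧ 2 ≤ n ∧ p 0 = x ∧ p n = y ∧ ∀ i, 0 < i → i < n → p i ∈ B := by
  classical
  let IsWalk : ℕ → (ℕ → V) → V → Prop := fun n p v => (∀ i < n, G.Adj (p i) (p (i + 1))) ∧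
    p 0 = x ∧ p n = v ∧ ∀ i, 0 < i → i < n → p i ∈ B
  have extend : ∀ n p v u, IsWalk n p v → v ∈ B → G.Adj v u →
      IsWalk (n + 1) (fun i => if i ≤ n then p i else u) u := by
    rintro n p v u ⟨h1, h2, h3, h4⟩ hv hu
    refine ⟨fun i hi => ?_, by simpa using h2, by simp, fun i h0 hi => ?_⟩
    · by_cases hin : i < n
      · simpa [hin.le, Nat.succ_le_of_lt hin] using h1 i hin
      · obtain rfl : i = n := by omega
        simpa [h3] using hu
    · simp only [show i ≤ n by omega, if_true]
      by_cases hin : i < n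
      · exact h4 i h0 hin
      · rwa [show i = n by omega, h3]
  have hwalk : ∃ n p, IsWalk n p y := by
    obtain ⟨b, hb, hxb⟩ := hx
    obtain ⟨b', hb', hyb'⟩ := hy
    have hall : B ⊆ {v | ∃ n p, IsWalk n p v} := by
      refine hB _ ⟨b, hb, 1, fun i => if i = 0 then x else b, ?_, by simp, by simp, ?_⟩ ?_
      · intro i hi
        obtain rfl : i = 0 := by omega
        simpa using hxb
      · intro i h0 h1
        omega
      · rintro v hv ⟨n, p, hp⟩ u hu hvu
        exact ⟨_, _, extend n p v u hp hv hvu⟩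
    obtain ⟨n, p, hp⟩ := hall hb'
    exact ⟨_, _, extend n p b' y hp hb' hyb'.symm⟩
  obtain ⟨p, h1, h2, h3, h4⟩ := Nat.find_spec hwalk
  set n := Nat.find hwalk with hn
  have hmin : ∀ m q, IsWalk m q y → n ≤ m := fun m q hq => Nat.find_min' hwalk ⟨q, hq⟩
  have h2n : 2 ≤ n := by
    by_contra hlt
    interval_cases hn' : n
    · exact hne (h2.symm.trans h3)
    · exact hxy (by simpa [h2, h3] using h1 0 (by omega))
  -- Cutting out the part strictly between `i` and `j` shortens the walk.
  have shortcut : ∀ i j, i + 1 < j → j ≤ n → ¬ G.Adj (p i) (p j) := by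
    intro i j hij hj hadj
    have := hmin (n - (j - i - 1)) (fun t => if t ≤ i then p t else p (t + (j - i - 1)))
      ⟨?_, by simpa using h2, ?_, ?_⟩
    · omega
    · intro t ht
      rcases lt_trichotomy t i with hti | rfl | hti
      · simpa [hti.le, Nat.succ_le_of_lt hti] using h1 t (by omega)
      · simpa [show t + 1 + (j - t - 1) = j by omega] using hadj
      · simpa [show ¬ t ≤ i by omega, show ¬ t + 1 ≤ i by omega,
          show t + 1 + (j - i - 1) = t + (j - i - 1) + 1 by omega] using
          h1 (t + (j - i - 1)) (by omega)
    · simp only [show ¬ n - (j - i - 1) ≤ i by omega, if_false]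
      rwa [show n - (j - i - 1) + (j - i - 1) = n by omega]
    · intro t h0 ht
      beta_reduce
      split_ifs with hti
      · exact h4 t h0 (by omega)
      · exact h4 _ (by omega) (by omega)
  refine ⟨n, p, ⟨h1, shortcut, ?_⟩, h2n, h2, h3, h4⟩
  intro i j hij hj heq
  rcases lt_or_eq_of_le hj with hjn | hjn
  · refine shortcut i (j + 1) (by omega) (by omega) ?_
    rw [heq]
    exact h1 j hjn
  · by_cases h0 : i = 0
    · subst h0
      exact hne (h2.symm.trans (heq.trans (hjn ▸ h3)))
    · refine shortcut (i - 1) j (by omega) hj ?_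
      rw [← heq]
      simpa [show i - 1 + 1 = i by omega] using h1 (i - 1) (by omega)

/-- An induced path in the sense of `EvenPair`, as an `IndPath`. -/
theorem indPath_of_embedding {k : ℕ} (p : SimpleGraph.pathGraph (k + 1) ↪g G) :
    IndPath G k (fun i => p (Fin.ofNat (k + 1) i)) := by
  have hval : ∀ i ≤ k, ((Fin.ofNat (k + 1) i : Fin (k + 1)) : ℕ) = i := fun i hi => by
    simp [Fin.ofNat, Nat.mod_eq_of_lt (Nat.lt_succ_of_le hi)]
  refine ⟨fun i hi => ?_, fun i j hij hj => ?_, fun i j hij hj heq => ?_⟩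
  · rw [p.map_adj_iff, SimpleGraph.pathGraph_adj, hval _ hi.le, hval _ hi]
    exact Or.inl rfl
  · rw [p.map_adj_iff, SimpleGraph.pathGraph_adj, hval i (by omega), hval j hj]
    omega
  · have := congrArg Fin.val (p.injective heq)
    rw [hval i (by omega), hval j hj] at this
    omega

/-- To show that all induced paths between two vertices are even, it suffices to consider paths
given as sequences. -/
theorem evenPair_of_indPath {S : Set V} {x y : V}
    (h : ∀ n p, IndPath G n p → (∀ i ≤ n, p i ∈ S) → p 0 = x → p n = y → Even n) :
    EvenPair G S x y := by
  intro k p hS hx hy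
  refine h k _ (indPath_of_embedding p) (fun i _ => hS _) ?_ ?_
  · simpa using hx
  · rw [← hy]
    congr 1
    ext
    simp [Fin.ofNat]

end Paths

/-! ### Canonical star separations -/

section Stars

variable {V : Type*} [Fintype V] {G : SimpleGraph V} {w : V → ℝ}

/-- `w` is a probability weight for which no `3`-bounded set is a `(w, 1/2)`-balanced separator
of `G`. This is all that the argument uses of the assumption on balanced separators. -/
structure NoLocalSeparator (G : SimpleGraph V) (w : V → ℝ) : Prop where
  nonneg : ∀ v, 0 ≤ w v
  total : ∑ v, w v = 1
  exists_heavy : ∀ (a : V) (Y : Set V), (∀ u ∈ Y, G.edist a u ≤ 3) →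
    ∃ D, IsComponent G Yᶜ D ∧ 1 / 2 < weight w D

theorem weight_mono (hw : ∀ v, 0 ≤ w v) {D E : Set V} (h : D ⊆ E) : weight w D ≤ weight w E :=
  Finset.sum_le_sum fun v _ => Set.indicator_le_indicator_of_subset h hw v

theorem weight_add_le (hw : ∀ v, 0 ≤ w v) {D E : Set V} (h : Disjoint D E) :
    weight w D + weight w E ≤ ∑ v, w v := by
  unfold weight
  rw [← Finset.sum_add_distrib]
  refine Finset.sum_le_sum fun v _ => ?_
  have : v ∈ D → v ∉ E := fun hv => Set.disjoint_left.1 h hv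
  have := hw v
  by_cases hD : v ∈ D <;> by_cases hE : v ∈ E <;> simp_all

namespace NoLocalSeparator

variable (hs : NoLocalSeparator G w)
include hs

theorem exists_mem_inter {D E : Set V} (hD : 1 / 2 < weight w D) (hE : 1 / 2 < weight w E) :
    ∃ b ∈ D, b ∈ E := by
  by_contra! h
  have h1 := weight_add_le hs.nonneg (Set.disjoint_left.2 h)
  rw [hs.total] at h1
  linarith

theorem isLargestComponent_starB (v : V) : IsLargestComponent G w v (starB G w v) := by
  have hex : ∃ B, IsLargestComponent G w v B := by
    obtain ⟨D, hD, -⟩ := hs.exists_heavy v (closedNbhd G v) (by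
      rintro u (rfl | hu)
      · simp
      · exact (edist_le_one_of_adj hu).trans (by norm_num))
    obtain ⟨B, hB, hmax⟩ := Set.exists_max_image {D | IsComponent G (closedNbhd G v)ᶜ D}
      (weight w) (Set.toFinite _) ⟨D, hD⟩
    exact ⟨B, hB, hmax⟩
  unfold starB
  rw [dif_pos hex]
  exact hex.choose_spec

theorem isComponent_starB (v : V) : IsComponent G (closedNbhd G v)ᶜ (starB G w v) :=
  (hs.isLargestComponent_starB v).1

theorem half_lt_weight_starB (v : V) : 1 / 2 < weight w (starB G w v) := by
  obtain ⟨D, hD, hw⟩ := hs.exists_heavy v (closedNbhd G v) (by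
    rintro u (rfl | hu)
    · simp
    · exact (edist_le_one_of_adj hu).trans (by norm_num))
  exact hw.trans_le ((hs.isLargestComponent_starB v).2 D hD)

/-- Heavy connected sets that avoid `N[v]` lie in `B_v`. -/
theorem subset_starB {D : Set V} {v : V} (hD : ConnectedSet G D) (hw : 1 / 2 < weight w D)
    (hdisj : ∀ u ∈ D, u ∉ closedNbhd G v) : D ⊆ starB G w v := by
  obtain ⟨b, hb, hb'⟩ := hs.exists_mem_inter hw (hs.half_lt_weight_starB v)
  exact (hs.isComponent_starB v).subset_of_connectedSet hD hdisj ⟨b, hb, hb'⟩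

/-- The heavy component `B_v` is the only component of `G ∖ N[v]` of weight over one half. -/
theorem eq_starB {D : Set V} {v : V} (hD : IsComponent G (closedNbhd G v)ᶜ D)
    (hw : 1 / 2 < weight w D) : D = starB G w v := by
  have h := hs.subset_starB hD.connectedSet hw fun u hu => hD.subset hu
  refine h.antisymm ?_
  obtain ⟨b, hb⟩ := hD.nonempty
  exact hD.subset_of_connectedSet (hs.isComponent_starB v).connectedSet
    (hs.isComponent_starB v).subset ⟨b, h hb, hb⟩

theorem not_mem_starB_self (v : V) : v ∉ starB G w v := fun h =>
  (hs.isComponent_starB v).subset h (mem_closedNbhd_self v)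

theorem not_adj_of_mem_starB {v b : V} (h : b ∈ starB G w v) : ¬ G.Adj v b := fun hadj =>
  (hs.isComponent_starB v).subset h (Or.inr hadj)

theorem mem_starB_of_adj {v b u : V} (hb : b ∈ starB G w v) (hbu : G.Adj b u) (hne : u ≠ v)
    (hu : ¬ G.Adj v u) : u ∈ starB G w v :=
  (hs.isComponent_starB v).mem_of_adj hb (not_mem_closedNbhd.2 ⟨hne, hu⟩) hbu

theorem adj_of_mem_nbhd {v u : V} (hu : u ∈ nbhd G (starB G w v)) : G.Adj v u := by
  obtain ⟨huB, b, hb, hub⟩ := hu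
  by_contra hvu
  refine huB (hs.mem_starB_of_adj hb hub.symm ?_ hvu)
  rintro rfl
  exact hs.not_adj_of_mem_starB hb hub

/-- A vertex of `N[B_v]` that is neither `v` nor a neighbour of `v` is in `B_v`. -/
theorem mem_starB_of_mem {v u : V} (hu : u ∈ starB G w v ∪ nbhd G (starB G w v))
    (hvu : ¬ G.Adj v u) : u ∈ starB G w v :=
  hu.resolve_right fun h => hvu (hs.adj_of_mem_nbhd h)

theorem mem_nbhd_iff {v u : V} :
    u ∈ nbhd G (starB G w v) ↔ G.Adj v u ∧ ∃ b ∈ starB G w v, G.Adj u b :=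
  ⟨fun h => ⟨hs.adj_of_mem_nbhd h, h.2⟩, fun h => ⟨fun hB => hs.not_adj_of_mem_starB hB h.1, h.2⟩⟩

theorem mem_starC_iff {v u : V} : u ∈ starC G w v ↔ u = v ∨ u ∈ nbhd G (starB G w v) := by
  rw [hs.mem_nbhd_iff]
  rfl

theorem mem_starA_iff {v u : V} :
    u ∈ starA G w v ↔ u ≠ v ∧ u ∉ starB G w v ∧ u ∉ nbhd G (starB G w v) := by
  unfold starA
  rw [Set.mem_compl_iff, Set.mem_union, hs.mem_starC_iff]
  tauto

theorem not_mem_starA_self (v : V) : v ∉ starA G w v := fun h => (hs.mem_starA_iff.1 h).1 rfl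

theorem mem_or_mem_starA {v u : V} (hne : u ≠ v) :
    u ∈ starB G w v ∪ nbhd G (starB G w v) ∨ u ∈ starA G w v := by
  rw [hs.mem_starA_iff, Set.mem_union]
  tauto

theorem not_mem_starA_of_mem {v u : V} (h : u ∈ starB G w v ∪ nbhd G (starB G w v)) :
    u ∉ starA G w v := by
  rw [hs.mem_starA_iff]
  rcases h with h | h <;> tauto

theorem not_adj_starA_starB {v a b : V} (ha : a ∈ starA G w v) (hb : b ∈ starB G w v) :
    ¬ G.Adj a b := fun hab =>
  (hs.mem_starA_iff.1 ha).2.2 ⟨(hs.mem_starA_iff.1 ha).2.1, b, hb, hab⟩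

/-- A neighbour of a vertex of `A_v` is in `A_v`, or is in `C_v`. -/
theorem mem_of_adj_starA {v a u : V} (ha : a ∈ starA G w v) (hau : G.Adj a u) :
    u ∈ starA G w v ∨ u = v ∨ u ∈ nbhd G (starB G w v) := by
  by_cases huv : u = v
  · exact Or.inr (Or.inl huv)
  · rcases hs.mem_or_mem_starA huv with (h | h) | h
    · exact (hs.not_adj_starA_starB ha h hau).elim
    · exact Or.inr (Or.inr h)
    · exact Or.inl h

theorem starB_subset_of_mem_starA {x y : V} (hy : y ∈ starA G w x) :
    starB G w x ⊆ starB G w y := by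
  refine hs.subset_starB (hs.isComponent_starB x).connectedSet (hs.half_lt_weight_starB x) ?_
  intro u hu
  rw [not_mem_closedNbhd]
  refine ⟨?_, hs.not_adj_starA_starB hy hu⟩
  rintro rfl
  exact (hs.mem_starA_iff.1 hy).2.1 hu

theorem closed_starB_subset_of_mem_starA {x y u : V} (hy : y ∈ starA G w x)
    (hu : u ∈ starB G w x ∪ nbhd G (starB G w x)) : u ∈ starB G w y ∪ nbhd G (starB G w y) := by
  have hsub := hs.starB_subset_of_mem_starA hy
  rcases hu with hu | ⟨-, b, hb, hub⟩
  · exact Or.inl (hsub hu)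
  · by_cases huy : u ∈ starB G w y
    · exact Or.inl huy
    · exact Or.inr ⟨huy, b, hsub hb, hub⟩

theorem starA_subset_of_mem_starA {x y u : V} (hy : y ∈ starA G w x) (hu : u ∈ starA G w y) :
    u = x ∨ u ∈ starA G w x := by
  by_cases hux : u = x
  · exact Or.inl hux
  · exact Or.inr ((hs.mem_or_mem_starA hux).resolve_left fun h =>
      hs.not_mem_starA_of_mem (hs.closed_starB_subset_of_mem_starA hy h) hu)

theorem mem_starA_of_starB_eq {x y : V} (h : starB G w x = starB G w y) (hne : y ≠ x) :
    y ∈ starA G w x := by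
  rw [hs.mem_starA_iff, h]
  exact ⟨hne, hs.not_mem_starB_self y, fun h' => G.loopless.irrefl _ (hs.adj_of_mem_nbhd h')⟩

theorem starTwins_iff {x y : V} : StarTwins G w x y ↔ starB G w x = starB G w y := by
  refine ⟨fun h => h.1, fun h => ⟨h, ?_, ?_⟩⟩
  · have hC : ∀ v, starC G w v \ {v} = nbhd G (starB G w v) := by
      intro v
      ext u
      rw [Set.mem_sdiff, hs.mem_starC_iff, Set.mem_singleton_iff]
      constructor
      · tauto
      · intro hu
        exact ⟨Or.inr hu, (hs.adj_of_mem_nbhd hu).ne'⟩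
    rw [hC, hC, h]
  · ext u
    rw [Set.mem_sdiff, Set.mem_sdiff, hs.mem_starA_iff, hs.mem_starA_iff, h,
      Set.mem_singleton_iff, Set.mem_singleton_iff]
    tauto

variable {ord : V → ℕ}

theorem starLE_iff {x y : V} : StarLE G w ord x y ↔ x = y ∨
    (starB G w x = starB G w y ∧ ord x < ord y) ∨
    (starB G w x ≠ starB G w y ∧ y ∈ starA G w x) := by
  unfold StarLE
  rw [hs.starTwins_iff]

theorem mem_starA_of_starLE {x y : V} (h : StarLE G w ord x y) (hne : x ≠ y) :
    y ∈ starA G w x := by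
  rcases hs.starLE_iff.1 h with h | h | h
  · exact (hne h).elim
  · exact hs.mem_starA_of_starB_eq h.1 hne.symm
  · exact h.2

/-- Numbering the vertices by `(|B_v|, ord v)`, lexicographically, is a linear extension. -/
theorem isLinearExtension_of_lex (hord : Function.Injective ord) {M : ℕ} (hM : ∀ v, ord v < M) :
    IsLinearExtension G w ord (fun v => (starB G w v).ncard * M + ord v) := by
  constructor
  · intro x y hxy
    apply hord
    have := congrArg (· % M) hxy
    simpa [Nat.mul_add_mod', Nat.mod_eq_of_lt (hM _), Nat.add_mod] using this
  · intro x y hne hxy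
    rcases hs.starLE_iff.1 hxy with h | h | h
    · exact (hne h).elim
    · simp only [h.1]
      omega
    · have hss : starB G w x ⊂ starB G w y :=
        (hs.starB_subset_of_mem_starA h.2).ssubset_of_ne h.1
      have hlt := Set.ncard_lt_ncard hss (Set.toFinite _)
      have : ((starB G w x).ncard + 1) * M ≤ (starB G w y).ncard * M :=
        Nat.mul_le_mul_right M hlt
      have := hM x
      dsimp only
      linarith

theorem exists_isLinearExtension (hord : Function.Injective ord) :
    ∃ ℓ, IsLinearExtension G w ord ℓ := by
  refine ⟨_, hs.isLinearExtension_of_lex hord (M := Finset.univ.sup ord + 1) fun v => ?_⟩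
  exact Nat.lt_succ_of_le (Finset.le_sup (Finset.mem_univ v))

theorem exists_mem_starCovering (hord : Function.Injective ord) {v : V}
    (hv : v ∉ starCovering G w ord) : ∃ m ∈ starCovering G w ord, v ∈ starA G w m := by
  obtain ⟨ℓ, -, hℓ⟩ := hs.exists_isLinearExtension hord
  induction hn : ℓ v using Nat.strong_induction_on generalizing v with
  | _ n ih =>
    have hv' := hv
    simp only [starCovering, Set.mem_ofPred_eq, not_forall] at hv'
    obtain ⟨y, hyv, hne⟩ := hv'
    have hA := hs.mem_starA_of_starLE hyv hne
    by_cases hy : y ∈ starCovering G w ord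
    · exact ⟨y, hy, hA⟩
    · obtain ⟨m, hm, hym⟩ := ih (ℓ y) (hn ▸ hℓ y v hne hyv) hy rfl
      refine ⟨m, hm, (hs.starA_subset_of_mem_starA hym hA).resolve_left ?_⟩
      rintro rfl
      exact hv hm

/-- A vertex of the star covering lies in `A_f` only for its star twins `f`. -/
theorem starB_eq_of_mem_starCovering {x f : V} (hx : x ∈ starCovering G w ord)
    (hxf : x ∈ starA G w f) : starB G w x = starB G w f := by
  by_contra hne
  have := hx f (hs.starLE_iff.2 (Or.inr (Or.inr ⟨Ne.symm hne, hxf⟩)))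
  subst this
  exact hne rfl

theorem not_mem_starA_of_mem_starCovering (hord : Function.Injective ord) {x y : V}
    (hx : x ∈ starCovering G w ord) (hy : y ∈ starCovering G w ord) : y ∉ starA G w x := by
  intro h
  have hB := hs.starB_eq_of_mem_starCovering hy h
  have hne := (hs.mem_starA_iff.1 h).1
  rcases lt_or_gt_of_ne (hord.ne hne) with hlt | hlt
  · exact hne (hx y (hs.starLE_iff.2 (Or.inr (Or.inl ⟨hB, hlt⟩))))
  · exact hne (hy x (hs.starLE_iff.2 (Or.inr (Or.inl ⟨hB.symm, hlt⟩)))).symm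

theorem mem_of_mem_starCovering (hord : Function.Injective ord) {x y : V}
    (hx : x ∈ starCovering G w ord) (hy : y ∈ starCovering G w ord) (hne : y ≠ x) :
    y ∈ starB G w x ∪ nbhd G (starB G w x) :=
  (hs.mem_or_mem_starA hne).resolve_right (hs.not_mem_starA_of_mem_starCovering hord hx hy)

theorem starB_ne_of_mem_starCovering (hord : Function.Injective ord) {x y : V}
    (hx : x ∈ starCovering G w ord) (hy : y ∈ starCovering G w ord) (hne : y ≠ x) :
    starB G w x ≠ starB G w y := fun h =>
  hs.not_mem_starA_of_mem_starCovering hord hx hy (hs.mem_starA_of_starB_eq h hne)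

/-- The star-free bag is the star covering itself: every other vertex is cut off by some star. -/
theorem starFreeBag_eq (hord : Function.Injective ord) :
    starFreeBag G w ord = starCovering G w ord := by
  ext v
  simp only [starFreeBag, Set.mem_iInter]
  constructor
  · intro h
    by_contra hv
    obtain ⟨m, hm, hvm⟩ := hs.exists_mem_starCovering hord hv
    exact hvm (h m hm)
  · intro hv x hx
    by_contra h
    exact hs.not_mem_starA_of_mem_starCovering hord hx hv h

/-- A vertex of the star covering adjacent to a vertex of `A_x` is `x` or a neighbour of `x`. -/
theorem adj_of_adj_starA (hord : Function.Injective ord) {x y a : V}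
    (hx : x ∈ starCovering G w ord) (hy : y ∈ starCovering G w ord) (ha : a ∈ starA G w x)
    (hay : G.Adj a y) : y = x ∨ y ∈ nbhd G (starB G w x) :=
  (hs.mem_of_adj_starA ha hay).resolve_left (hs.not_mem_starA_of_mem_starCovering hord hx hy)

/-- The stars of nonadjacent vertices of the star covering do not cross. -/
theorem not_mem_nbhd_of_mem_starA (hord : Function.Injective ord) {x y u : V}
    (hx : x ∈ starCovering G w ord) (hy : y ∈ starCovering G w ord) (hxy : ¬ G.Adj x y)
    (hu : u ∈ starA G w x) : u ∉ nbhd G (starB G w y) := by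
  intro huy
  rcases hs.adj_of_adj_starA hord hx hy hu (hs.adj_of_mem_nbhd huy).symm with rfl | h
  · exact (hs.mem_starA_iff.1 hu).2.2 huy
  · exact hxy (hs.adj_of_mem_nbhd h)

end NoLocalSeparator

end Stars

/-! ### The star covering induces a bipartite graph -/

section Covering

variable {V : Type*} [Fintype V] {G : SimpleGraph V} {w : V → ℝ} {ord : V → ℕ}

namespace NoLocalSeparator

/-- The form in which paw-friendliness is used: a paw with centre `z` and pendant vertex `c`
none of whose three breaking conditions holds in `G` itself. -/
theorem paw_false (hs : NoLocalSeparator G w) (hG : PawFriendly G) {z b₁ b₂ c : V}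
    (hb : G.Adj b₁ b₂) (hc₁ : ¬ G.Adj b₁ c) (hc₂ : ¬ G.Adj b₂ c)
    (hz₁ : b₁ ∈ nbhd G (starB G w z)) (hz₂ : b₂ ∈ nbhd G (starB G w z))
    (hzc : c ∈ nbhd G (starB G w z))
    (h₁ : ∃ D, IsComponent G (closedNbhd G b₁)ᶜ D ∧ c ∈ D ∪ nbhd G D ∧ b₂ ∈ D ∪ nbhd G D)
    (h₂c : c ∈ starB G w b₂ ∪ nbhd G (starB G w b₂))
    (h₂b : b₁ ∈ starB G w b₂ ∪ nbhd G (starB G w b₂)) : False := by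
  have key := hG.2 Set.univ c trivial z trivial b₁ trivial b₂ trivial (hs.adj_of_mem_nbhd hz₁)
    (hs.adj_of_mem_nbhd hz₂) hb (hs.adj_of_mem_nbhd hzc) (fun h => hc₁ h.symm)
    (fun h => hc₂ h.symm)
  simp only [Breaks, ← Set.compl_eq_univ_sdiff] at key
  rcases key with h | h | h
  · refine h _ (hs.isComponent_starB z) ?_
    rintro u (rfl | rfl | rfl) <;> exact Or.inr ‹_›
  · obtain ⟨D, hD, hcD, hbD⟩ := h₁
    refine h D hD ?_
    rintro u (rfl | rfl) <;> assumption
  · refine h _ (hs.isComponent_starB b₂) ?_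
    rintro u (rfl | rfl) <;> assumption

variable (hs : NoLocalSeparator G w) (hG : PawFriendly G) (hord : Function.Injective ord)
include hs hG hord

theorem starCovering_paw_free {a b₁ b₂ c : V} (ha : a ∈ starCovering G w ord)
    (hb₁ : b₁ ∈ starCovering G w ord) (hb₂ : b₂ ∈ starCovering G w ord)
    (hc : c ∈ starCovering G w ord) (hab₁ : G.Adj a b₁) (hab₂ : G.Adj a b₂)
    (hb : G.Adj b₁ b₂) (hac : G.Adj a c) (hc₁ : ¬ G.Adj b₁ c) (hc₂ : ¬ G.Adj b₂ c) : False := by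
  have hcb₁ : c ≠ b₁ := by
    rintro rfl
    exact hc₂ hb.symm
  have hcb₂ : c ≠ b₂ := by
    rintro rfl
    exact hc₁ hb
  have hmem : ∀ u ∈ starCovering G w ord, G.Adj a u → u ∈ nbhd G (starB G w a) :=
    fun u hu hau => (hs.mem_of_mem_starCovering hord ha hu hau.ne').resolve_left
      fun h => hs.not_adj_of_mem_starB h hau
  exact hs.paw_false hG hb hc₁ hc₂ (hmem _ hb₁ hab₁) (hmem _ hb₂ hab₂) (hmem _ hc hac)
    ⟨_, hs.isComponent_starB b₁, hs.mem_of_mem_starCovering hord hb₁ hc hcb₁,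
      hs.mem_of_mem_starCovering hord hb₁ hb₂ hb.ne'⟩
    (hs.mem_of_mem_starCovering hord hb₂ hc hcb₂) (hs.mem_of_mem_starCovering hord hb₂ hb₁ hb.ne)

/-- The star covering is triangle-free: being paw-free, its component `X'` around a triangle lies
in a ball of radius two, so that `N[X']` does not separate. The heavy component `D` outside
`N[X']` has a neighbour outside the star covering, which is cut off from `D` by a star of `X'`. -/
theorem starCovering_triangle_free {a b₁ b₂ : V} (ha : a ∈ starCovering G w ord)
    (hb₁ : b₁ ∈ starCovering G w ord) (hb₂ : b₂ ∈ starCovering G w ord)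
    (hab₁ : G.Adj a b₁) (hb : G.Adj b₁ b₂) (hab₂ : G.Adj a b₂) : False := by
  have paw := @hs.starCovering_paw_free V _ G w ord hG hord
  obtain ⟨X', hX', haX'⟩ := exists_isComponent (G := G) ha
  have hsub := hX'.subset
  -- Every vertex of `X'` has at least two neighbours in the triangle.
  have hE : X' ⊆ {y | (G.Adj a y ∧ G.Adj b₁ y) ∨ (G.Adj a y ∧ G.Adj b₂ y) ∨
      (G.Adj b₁ y ∧ G.Adj b₂ y)} := by
    have two : ∀ y ∈ starCovering G w ord, (G.Adj a y ∨ G.Adj b₁ y ∨ G.Adj b₂ y) →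
        (G.Adj a y ∧ G.Adj b₁ y) ∨ (G.Adj a y ∧ G.Adj b₂ y) ∨ (G.Adj b₁ y ∧ G.Adj b₂ y) := by
      intro y hy h
      have h1 := paw ha hb₁ hb₂ hy hab₁ hab₂ hb
      have h2 := paw hb₁ ha hb₂ hy hab₁.symm hb hab₂
      have h3 := paw hb₂ ha hb₁ hy hab₂.symm hb.symm hab₁
      tauto
    refine hX'.connectedSet _ ⟨a, haX', Or.inr (Or.inr ⟨hab₁.symm, hab₂.symm⟩)⟩ ?_
    intro x hx hxE y hy hxy
    refine two y (hsub hy) ?_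
    have hx' := hsub hx
    have hy' := hsub hy
    rcases hxE with ⟨h1, h2⟩ | ⟨h1, h2⟩ | ⟨h1, h2⟩
    · have := paw hx' ha hb₁ hy' h1.symm h2.symm hab₁ hxy
      tauto
    · have := paw hx' ha hb₂ hy' h1.symm h2.symm hab₂ hxy
      tauto
    · have := paw hx' hb₁ hb₂ hy' h1.symm h2.symm hb hxy
      tauto
  have hdist : ∀ x ∈ X', G.edist a x ≤ (2 : ℕ) := by
    intro x hx
    have h0 : ∀ {u}, G.Adj a u → G.edist a u ≤ (1 : ℕ) := fun h => by
      exact_mod_cast edist_le_one_of_adj h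
    rcases hE hx with h | h | h
    · exact edist_succ_le (h0 hab₁) h.2
    · exact edist_succ_le (h0 hab₂) h.2
    · exact edist_succ_le (h0 hab₁) h.1
  set Y : Set V := {u | u ∈ X' ∨ ∃ x ∈ X', G.Adj x u} with hY
  obtain ⟨D, hD, hDw⟩ := hs.exists_heavy a Y (by
    rintro u (hu | ⟨x, hx, hxu⟩)
    · exact (hdist u hu).trans (by norm_num)
    · exact_mod_cast edist_succ_le (hdist x hx) hxu)
  have hDB : ∀ x ∈ X', D ⊆ starB G w x := by
    refine fun x hx => hs.subset_starB hD.connectedSet hDw fun u hu hux => hD.subset hu ?_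
    rcases hux with rfl | h
    · exact Or.inl hx
    · exact Or.inr ⟨x, hx, h⟩
  have hbX' : b₁ ∈ X' := hX'.mem_of_adj haX' hb₁ hab₁
  obtain ⟨c, hc⟩ : (nbhd G D).Nonempty := by
    by_contra hempty
    obtain ⟨d, hd⟩ := hD.nonempty
    have hcl : starB G w a ⊆ D := by
      refine (hs.isComponent_starB a).connectedSet D ⟨d, hDB a haX' hd, hd⟩ ?_
      intro x _ hx y _ hxy
      by_contra hy
      exact hempty ⟨y, hy, x, hx, hxy.symm⟩
    have hb₁a : b₁ ∈ nbhd G (starB G w a) :=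
      (hs.mem_of_mem_starCovering hord ha hb₁ hab₁.ne').resolve_left
        fun h => hs.not_adj_of_mem_starB h hab₁
    obtain ⟨-, b, hbB, hb₁b⟩ := hb₁a
    exact hD.subset (hcl hbB) (Or.inr ⟨b₁, hbX', hb₁b⟩)
  obtain ⟨hcD, d, hd, hcd⟩ := hc
  have hcY : c ∈ Y := by
    by_contra h
    exact hcD (hD.mem_of_adj hd h hcd.symm)
  rcases hcY with hcX' | ⟨x, hx, hxc⟩
  · exact hD.subset hd (Or.inr ⟨c, hcX', hcd⟩)
  · have hcX : c ∉ starCovering G w ord := fun h =>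
      hD.subset hd (Or.inr ⟨c, hX'.mem_of_adj hx h hxc, hcd⟩)
    obtain ⟨m, hm, hcm⟩ := hs.exists_mem_starCovering hord hcX
    have hmX' : m ∈ X' := by
      rcases hs.adj_of_adj_starA hord hm (hsub hx) hcm hxc.symm with rfl | h
      · exact hx
      · exact hX'.mem_of_adj hx hm (hs.adj_of_mem_nbhd h).symm
    exact hs.not_adj_starA_starB hcm (hDB m hmX' hd) hcd

theorem exists_isBipartition : ∃ X₁ X₂, IsBipartition G (starFreeBag G w ord) X₁ X₂ := by
  rw [hs.starFreeBag_eq hord]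
  obtain ⟨col, hcol⟩ := hG.1.exists_twoColouring (S := starCovering G w ord)
    fun x hx y hy z hz hxy hyz hxz =>
      hs.starCovering_triangle_free hG hord hx hy hz hxy hyz hxz
  refine ⟨{x ∈ starCovering G w ord | col x = true}, {x ∈ starCovering G w ord | col x = false},
    ?_, ?_, ?_, ?_⟩
  · ext x
    cases h : col x <;> simp [h]
  · rw [Set.disjoint_left]
    rintro x ⟨-, h1⟩ ⟨-, h2⟩
    simp [h1] at h2
  · rintro x ⟨hx, h1⟩ y ⟨hy, h2⟩ h
    exact hcol x hx y hy h (h1.trans h2.symm)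
  · rintro x ⟨hx, h1⟩ y ⟨hy, h2⟩ h
    exact hcol x hx y hy h (h1.trans h2.symm)

end NoLocalSeparator

end Covering

/-! ### Induced paths crossing a star -/

section Crossing

variable {V : Type*} [Fintype V] {G : SimpleGraph V} {w : V → ℝ}

/-- In a perfect graph, two induced paths with the same ends and with anticomplete interiors
have the same parity: their union is a hole, and here this is read off from a two-colouring. -/
theorem IsPerfect.even_iff_even (hG : IsPerfect G) {n m : ℕ} {p q : ℕ → V}
    (hp : IndPath G n p) (hq : IndPath G m q) (h0 : p 0 = q 0) (h1 : p n = q m)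
    (hpq : ∀ i, 0 < i → i < n → ∀ j, 0 < j → j < m → ¬ G.Adj (p i) (q j)) :
    Even n ↔ Even m := by
  let P : Set V := {u | ∃ i ≤ n, u = p i}
  let Q : Set V := {u | ∃ j ≤ m, u = q j}
  have hPQ : ∀ x ∈ P ∪ Q, x ∉ Q → ∃ i, 0 < i ∧ i < n ∧ x = p i := by
    rintro x (⟨i, hi, rfl⟩ | hx) hxQ
    · refine ⟨i, Nat.pos_of_ne_zero ?_, lt_of_le_of_ne hi ?_, rfl⟩
      · rintro rfl
        exact hxQ ⟨0, Nat.zero_le _, h0⟩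
      · rintro rfl
        exact hxQ ⟨m, le_rfl, h1⟩
    · exact (hxQ hx).elim
  have hQP : ∀ x ∈ P ∪ Q, x ∉ P → ∃ i, 0 < i ∧ i < m ∧ x = q i := by
    rintro x (hx | ⟨i, hi, rfl⟩) hxP
    · exact (hxP hx).elim
    · refine ⟨i, Nat.pos_of_ne_zero ?_, lt_of_le_of_ne hi ?_, rfl⟩
      · rintro rfl
        exact hxP ⟨0, Nat.zero_le _, h0.symm⟩
      · rintro rfl
        exact hxP ⟨n, le_rfl, h1.symm⟩
  have hadj : ∀ x ∈ P ∪ Q, ∀ y ∈ P ∪ Q, x ∉ P → y ∉ Q → ¬ G.Adj x y := by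
    intro x hx y hy hxP hyQ hxy
    obtain ⟨j, hj0, hjm, rfl⟩ := hQP x hx hxP
    obtain ⟨i, hi0, hin, rfl⟩ := hPQ y hy hyQ
    exact hpq i hi0 hin j hj0 hjm hxy.symm
  obtain ⟨col, hcol⟩ := hG.exists_twoColouring (S := P ∪ Q) (by
    intro x hx y hy z hz hxy hyz hxz
    by_cases hP : x ∈ P ∧ y ∈ P ∧ z ∈ P
    · obtain ⟨⟨i, hi, rfl⟩, ⟨j, hj, rfl⟩, ⟨k, hk, rfl⟩⟩ := hP
      exact hp.no_triangle hi hj hk hxy hyz hxz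
    · by_cases hQ : x ∈ Q ∧ y ∈ Q ∧ z ∈ Q
      · obtain ⟨⟨i, hi, rfl⟩, ⟨j, hj, rfl⟩, ⟨k, hk, rfl⟩⟩ := hQ
        exact hq.no_triangle hi hj hk hxy hyz hxz
      · have hxP := hadj x hx
        have hyP := hadj y hy
        have hzP := hadj z hz
        have := hxP y hy
        have := hxP z hz
        have := hyP x hx
        have := hyP z hz
        have := hzP x hx
        have := hzP y hy
        have := hxy.symm
        have := hyz.symm
        have := hxz.symm
        have hx' : x ∈ P ∨ x ∈ Q := hx
        have hy' : y ∈ P ∨ y ∈ Q := hy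
        have hz' : z ∈ P ∨ z ∈ Q := hz
        clear hxP hyP hzP hadj hPQ hQP hx hy hz
        grind)
  have h2 := hp.colour_eq hcol fun i hi => Or.inl ⟨i, hi, rfl⟩
  have h3 := hq.colour_eq hcol fun i hi => Or.inr ⟨i, hi, rfl⟩
  rw [← h2, ← h3, h0, h1]

namespace NoLocalSeparator

variable (hs : NoLocalSeparator G w)
include hs

theorem even_of_interior_starB (hG : IsPerfect G) {n : ℕ} {p : ℕ → V} (hp : IndPath G n p)
    (hn : 2 ≤ n) {z : V} (h0 : G.Adj z (p 0)) (h1 : G.Adj z (p n))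
    (hB : ∀ i, 0 < i → i < n → p i ∈ starB G w z) : Even n := by
  have hz : ∀ i ≤ n, G.Adj z (p i) → i = 0 ∨ i = n := by
    intro i hi hadj
    by_contra! hc
    exact hs.not_adj_of_mem_starB (hB i (by omega) (by omega)) hadj
  have hz2 : ∀ i ≤ n, ∀ j ≤ n, G.Adj z (p i) → G.Adj z (p j) → ¬ G.Adj (p i) (p j) := by
    intro i hi j hj hzi hzj hij
    have := hz i hi hzi
    have := hz j hj hzj
    rw [hp.adj_iff hi hj] at hij
    omega
  have hzz := G.loopless.irrefl z
  obtain ⟨col, hcol⟩ := hG.exists_twoColouring (S := {u | u = z ∨ ∃ i ≤ n, u = p i}) (by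
    rintro x (rfl | ⟨i, hi, rfl⟩) y (rfl | ⟨j, hj, rfl⟩) t (rfl | ⟨k, hk, rfl⟩) hxy hyz hxz
    · exact hzz hxy
    · exact hzz hxy
    · exact hzz hxz
    · exact hz2 j hj k hk hxy hxz hyz
    · exact hzz hyz
    · exact hz2 i hi k hk hxy.symm hyz hxz
    · exact hz2 i hi j hj hxz.symm hyz.symm hxy
    · exact hp.no_triangle hi hj hk hxy hyz hxz)
  rw [← hp.colour_eq hcol fun i hi => Or.inr ⟨i, hi, rfl⟩]
  have h2 := hcol z (Or.inl rfl) _ (Or.inr ⟨0, by omega, rfl⟩) h0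
  have h3 := hcol z (Or.inl rfl) _ (Or.inr ⟨n, le_rfl, rfl⟩) h1
  revert h2 h3
  cases col z <;> cases col (p 0) <;> cases col (p n) <;> simp

/-- An induced path between two vertices of `C_z ∖ {z}` with interior in `A_z` is even: close it
up to a hole through `B_z`. -/
theorem even_of_interior_starA (hG : IsPerfect G) {n : ℕ} {p : ℕ → V} (hp : IndPath G n p)
    (hn : 2 ≤ n) {z : V} (h0 : p 0 ∈ nbhd G (starB G w z)) (h1 : p n ∈ nbhd G (starB G w z))
    (hA : ∀ i, 0 < i → i < n → p i ∈ starA G w z) : Even n := by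
  obtain ⟨m, q, hq, hm, hq0, hqm, hqB⟩ := exists_indPath_through
    (hs.isComponent_starB z).connectedSet h0.2 h1.2 (hp.not_adj 0 n (by omega) le_rfl)
    (hp.ne 0 n (by omega) le_rfl)
  rw [hG.even_iff_even hp hq hq0.symm hqm.symm fun i hi0 hin j hj0 hjm =>
    hs.not_adj_starA_starB (hA i hi0 hin) (hqB j hj0 hjm)]
  refine hs.even_of_interior_starB hG hq hm (z := z) ?_ ?_ hqB
  · exact hq0 ▸ hs.adj_of_mem_nbhd h0
  · exact hqm ▸ hs.adj_of_mem_nbhd h1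

/-- If no edge of an induced path avoiding `z` lies in `C_z`, then any two vertices of the path
that lie in `C_z` are at even distance along the path. -/
theorem even_sub_of_mem_nbhd (hG : IsPerfect G) {n : ℕ} {p : ℕ → V} (hp : IndPath G n p) {z : V}
    (hz : ∀ i ≤ n, p i ≠ z)
    (hedge : ∀ k < n, p k ∈ nbhd G (starB G w z) → p (k + 1) ∉ nbhd G (starB G w z))
    {s t : ℕ} (hst : s ≤ t) (htn : t ≤ n) (hps : p s ∈ nbhd G (starB G w z))
    (hpt : p t ∈ nbhd G (starB G w z)) : Even (t - s) := by
  classical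
  induction hd : t - s using Nat.strong_induction_on generalizing s with
  | _ d ih =>
    rcases hst.eq_or_lt with rfl | hlt
    · simp [← hd]
    have hex : ∃ r, s < r ∧ p r ∈ nbhd G (starB G w z) := ⟨t, hlt, hpt⟩
    obtain ⟨hsr, hpr⟩ := Nat.find_spec hex
    have hmin : ∀ i, s < i → i < Nat.find hex → p i ∉ nbhd G (starB G w z) :=
      fun i hsi hi hpi => Nat.find_min hex hi ⟨hsi, hpi⟩
    have hrt : Nat.find hex ≤ t := Nat.find_min' hex ⟨hlt, hpt⟩
    generalize Nat.find hex = r at hsr hpr hmin hrt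
    have h2 : s + 2 ≤ r := by
      by_contra h
      obtain rfl : r = s + 1 := by omega
      exact hedge s (by omega) hps hpr
    have hrest : Even (t - r) := ih (t - r) (by omega) hrt hpr rfl
    have hseg := hp.segment s (r - s) (by omega)
    have hsr' : s + (r - s) = r := by omega
    have hr : Even (r - s) := by
      have hcl : ∀ i, s + 1 ≤ i → i < r - 1 → p i ∈ starB G w z → p (i + 1) ∈ starB G w z := by
        intro i hi1 hi2 hi
        have hadj := hp.adj i (by omega)
        by_contra hB
        exact hmin (i + 1) (by omega) (by omega) ⟨hB, p i, hi, hadj.symm⟩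
      have hclA : ∀ i, s + 1 ≤ i → i < r - 1 → p i ∈ starA G w z → p (i + 1) ∈ starA G w z := by
        intro i hi1 hi2 hi
        rcases hs.mem_of_adj_starA hi (hp.adj i (by omega)) with h | h | h
        · exact h
        · exact (hz _ (by omega) h).elim
        · exact (hmin _ (by omega) (by omega) h).elim
      rcases hs.mem_or_mem_starA (hz (s + 1) (by omega)) with (h | h) | h
      · refine hs.even_of_interior_starB hG hseg (by omega) (hs.adj_of_mem_nbhd hps)
          (hsr'.symm ▸ hs.adj_of_mem_nbhd hpr) fun i hi0 hi1 => ?_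
        exact IndPath.mem_of_closed h hcl _ (by omega) (by omega)
      · exact (hmin _ (by omega) (by omega) h).elim
      · refine hs.even_of_interior_starA hG hseg (by omega) hps (hsr'.symm ▸ hpr)
          fun i hi0 hi1 => ?_
        exact IndPath.mem_of_closed h hclA _ (by omega) (by omega)
    rw [← hd, show t - s = (r - s) + (t - r) by omega]
    exact hr.add hrest

end NoLocalSeparator

/-- The conditions on the ends of a path that make it cross the star `C_z` evenly: the ends are
cut off only by their star twins (among each other and among the vertices of `C_z` on the path),
and if the ends are star twins then the path is not cut off as a whole. -/
structure Anchored (G : SimpleGraph V) (w : V → ℝ) (z : V) (n : ℕ) (p : ℕ → V) : Prop where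
  left : ∀ k ≤ n, p k ∈ nbhd G (starB G w z) → p 0 ∈ starA G w (p k) →
    starB G w (p 0) = starB G w (p k)
  right : ∀ k ≤ n, p k ∈ nbhd G (starB G w z) → p n ∈ starA G w (p k) →
    starB G w (p n) = starB G w (p k)
  left_right : p n ∈ starA G w (p 0) → starB G w (p 0) = starB G w (p n)
  right_left : p 0 ∈ starA G w (p n) → starB G w (p 0) = starB G w (p n)
  escape : starB G w (p 0) = starB G w (p n) →
    ∃ i ≤ n, p i ∈ starB G w (p 0) ∪ nbhd G (starB G w (p 0))

theorem Anchored.reverse {z : V} {n : ℕ} {p : ℕ → V} (h : Anchored G w z n p) :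
    Anchored G w z n (fun i => p (n - i)) where
  left k _ hk h' := by simpa using h.right (n - k) (by omega) hk (by simpa using h')
  right k _ hk h' := by simpa using h.left (n - k) (by omega) hk (by simpa using h')
  left_right h' := by simpa using (h.right_left (by simpa using h')).symm
  right_left h' := by simpa using (h.left_right (by simpa using h')).symm
  escape h' := by
    simp only [Nat.sub_zero, Nat.sub_self] at h' ⊢
    obtain ⟨i, hi, hpi⟩ := h.escape h'.symm
    exact ⟨n - i, by omega, by rwa [h', show n - (n - i) = i by omega]⟩

namespace NoLocalSeparator

/-- The ends of a long enough anchored path are not star twins. -/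
theorem starB_ends_ne (hs : NoLocalSeparator G w) {n : ℕ} {p : ℕ → V} (hp : IndPath G n p)
    {z : V} (ha : Anchored G w z n p) (hn : 3 ≤ n) : starB G w (p 0) ≠ starB G w (p n) := by
  intro h
  have hN : ∀ i ≤ n, p i ∉ nbhd G (starB G w (p 0)) := by
    intro i hi hpi
    have h1 := hs.adj_of_mem_nbhd hpi
    rw [h] at hpi
    have h2 := hs.adj_of_mem_nbhd hpi
    rw [hp.adj_iff (by omega) (by omega)] at h1 h2
    omega
  obtain ⟨i, hi, hpi⟩ := ha.escape h
  have hpi := hpi.resolve_right (hN i hi)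
  have hB := IndPath.mem_of_closed (p := p) (t := n) hpi (fun j hj1 hj2 hj => by
    by_contra hB
    exact hN (j + 1) (by omega) ⟨hB, p j, hj, (hp.adj j hj2).symm⟩) n hi le_rfl
  exact hs.not_mem_starB_self (p n) (h ▸ hB)

variable (hs : NoLocalSeparator G w)
include hs

theorem mem_starB_of_end {n : ℕ} {p : ℕ → V} (hp : IndPath G n p) {i j : ℕ} (hij : i + 1 < j)
    (hjn : j ≤ n) (h : p n ∈ starB G w (p i)) : p j ∈ starB G w (p i) := by
  refine IndPath.mem_of_closed_down (p := p) (s := j) (t := n) h ?_ j le_rfl hjn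
  intro k hk1 hk2 hk
  exact hs.mem_starB_of_adj hk (hp.adj k hk2).symm (hp.ne i k (by omega) (by omega)).symm
    (hp.not_adj i k (by omega) (by omega))

theorem mem_starB_of_start {n : ℕ} {p : ℕ → V} (hp : IndPath G n p) {i j : ℕ} (hij : j + 1 < i)
    (hin : i ≤ n) (h : p 0 ∈ starB G w (p i)) : p j ∈ starB G w (p i) := by
  refine IndPath.mem_of_closed (p := p) (s := 0) (t := j) h ?_ j (Nat.zero_le _) le_rfl
  intro k _ hk2 hk
  exact hs.mem_starB_of_adj hk (hp.adj k (by omega)) (hp.ne (k + 1) i (by omega) (by omega))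
    fun h' => hp.not_adj (k + 1) i (by omega) (by omega) h'.symm

/-- An anchored path has no edge in `C_z` followed, not immediately, by a vertex of `C_z`. -/
theorem no_edge_before (hG : PawFriendly G) {n : ℕ} {p : ℕ → V} (hp : IndPath G n p) {z : V}
    (ha : Anchored G w z n p) {k j : ℕ} (hkj : k + 3 ≤ j) (hj : j ≤ n)
    (h0 : p k ∈ nbhd G (starB G w z)) (h1 : p (k + 1) ∈ nbhd G (starB G w z))
    (h2 : p j ∈ nbhd G (starB G w z)) : False := by
  have hne := hs.starB_ends_ne hp ha (by omega)
  have hend : p n ∈ starB G w (p 0) :=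
    hs.mem_starB_of_mem ((hs.mem_or_mem_starA (hp.ne 0 n (by omega) le_rfl).symm).resolve_right
      fun h => hne (ha.left_right h)) (hp.not_adj 0 n (by omega) le_rfl)
  have hstart : p 0 ∈ starB G w (p n) :=
    hs.mem_starB_of_mem ((hs.mem_or_mem_starA (hp.ne 0 n (by omega) le_rfl)).resolve_right
      fun h => hne (ha.right_left h)) fun h => hp.not_adj 0 n (by omega) le_rfl h.symm
  have h0b : starB G w (p 0) ≠ starB G w (p (k + 1)) := by
    intro heq
    rcases Nat.eq_zero_or_pos k with rfl | hk
    · have : p 2 ∈ starB G w (p 0) := hs.mem_starB_of_end hp (by omega) (by omega) hend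
      rw [heq] at this
      exact hs.not_adj_of_mem_starB this (hp.adj 1 (by omega))
    · have : p (k + 1) ∈ starB G w (p 0) := hs.mem_starB_of_end hp (by omega) (by omega) hend
      rw [heq] at this
      exact hs.not_mem_starB_self _ this
  have hnb : starB G w (p n) ≠ starB G w (p (k + 1)) := by
    intro heq
    have : p (k + 1) ∈ starB G w (p n) := hs.mem_starB_of_start hp (by omega) le_rfl hstart
    rw [heq] at this
    exact hs.not_mem_starB_self _ this
  have hn : p n ∈ starB G w (p (k + 1)) :=
    hs.mem_starB_of_mem ((hs.mem_or_mem_starA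
      (hp.ne (k + 1) n (by omega) le_rfl).symm).resolve_right
      fun h => hnb (ha.right (k + 1) (by omega) h1 h)) (hp.not_adj (k + 1) n (by omega) le_rfl)
  have h0' : p 0 ∈ starB G w (p (k + 1)) ∪ nbhd G (starB G w (p (k + 1))) :=
    (hs.mem_or_mem_starA (hp.ne 0 (k + 1) (by omega) (by omega))).resolve_right
      fun h => h0b (ha.left (k + 1) (by omega) h1 h)
  have hkb : p k ∈ starB G w (p (k + 1)) ∪ nbhd G (starB G w (p (k + 1))) := by
    rcases Nat.eq_zero_or_pos k with rfl | hk
    · exact h0'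
    · have h0B : p 0 ∈ starB G w (p (k + 1)) :=
        hs.mem_starB_of_mem h0' fun h => hp.not_adj 0 (k + 1) (by omega) (by omega) h.symm
      have hpre : p (k - 1) ∈ starB G w (p (k + 1)) :=
        hs.mem_starB_of_start hp (by omega) (by omega) h0B
      have hadj := hp.adj k (by omega)
      refine Or.inr ⟨fun h => hs.not_adj_of_mem_starB h hadj.symm, _, hpre, ?_⟩
      have := hp.adj (k - 1) (by omega)
      rw [show k - 1 + 1 = k by omega] at this
      exact this.symm
  refine hs.paw_false hG (hp.adj k (by omega)) (hp.not_adj k j (by omega) hj)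
    (hp.not_adj (k + 1) j (by omega) hj) h0 h1 h2 ?_
    (Or.inl (hs.mem_starB_of_end hp (by omega) hj hn)) hkb
  have hout : ∀ i, k + 2 ≤ i → i ≤ n → p i ∈ (closedNbhd G (p k))ᶜ := fun i hi1 hi2 =>
    not_mem_closedNbhd.2 ⟨(hp.ne k i (by omega) hi2).symm, hp.not_adj k i (by omega) hi2⟩
  obtain ⟨D, hD, hkD⟩ := exists_isComponent (G := G) (hout (k + 2) le_rfl (by omega))
  refine ⟨D, hD, Or.inl ?_, Or.inr ⟨fun h => hD.subset h (Or.inr (hp.adj k (by omega))), _, hkD,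
    hp.adj (k + 1) (by omega)⟩⟩
  exact IndPath.mem_of_closed (p := p) (t := n) hkD
    (fun i hi1 hi2 hi => hD.mem_of_adj hi (hout _ (by omega) (by omega)) (hp.adj i hi2)) j
    (by omega) hj

theorem no_edge_after (hG : PawFriendly G) {n : ℕ} {p : ℕ → V} (hp : IndPath G n p) {z : V}
    (ha : Anchored G w z n p) {k j : ℕ} (hjk : j + 2 ≤ k) (hk : k < n)
    (h0 : p k ∈ nbhd G (starB G w z)) (h1 : p (k + 1) ∈ nbhd G (starB G w z))
    (h2 : p j ∈ nbhd G (starB G w z)) : False := by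
  refine hs.no_edge_before hG hp.reverse ha.reverse (k := n - k - 1) (j := n - j) (by omega)
    (by omega) ?_ ?_ ?_
  · rwa [show n - (n - k - 1) = k + 1 by omega]
  · rwa [show n - (n - k - 1 + 1) = k by omega]
  · rwa [show n - (n - j) = j by omega]

end NoLocalSeparator

end Crossing

/-! ### Rerouting induced paths through the centres of stars -/

section Reroute

theorem exists_last_le {P : ℕ → Prop} {m : ℕ} (h : ∃ s ≤ m, P s) :
    ∃ s ≤ m, P s ∧ ∀ i, s < i → i ≤ m → ¬ P i := by
  classical
  obtain ⟨s, hs, hP⟩ := h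
  exact ⟨_, Nat.findGreatest_le m, Nat.findGreatest_spec hs hP,
    fun i h1 h2 => Nat.findGreatest_is_greatest h1 h2⟩

theorem exists_first_ge {P : ℕ → Prop} {m n : ℕ} (hmn : m ≤ n) (h : P n) :
    ∃ t, m ≤ t ∧ t ≤ n ∧ P t ∧ ∀ i, m ≤ i → i < t → ¬ P i := by
  classical
  have hex : ∃ t, m ≤ t ∧ P t := ⟨n, hmn, h⟩
  exact ⟨Nat.find hex, (Nat.find_spec hex).1, Nat.find_min' hex ⟨hmn, h⟩, (Nat.find_spec hex).2,
    fun i h1 h2 hP => Nat.find_min hex h2 ⟨h1, hP⟩⟩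

variable {V : Type*} {G : SimpleGraph V}

/-- Replacing the stretch of an induced path between its vertices number `f` and `l` by a single
vertex `z`. -/
theorem IndPath.replace {n : ℕ} {p : ℕ → V} (hp : IndPath G n p) {z : V} {f l : ℕ}
    (hfl : f + 2 ≤ l) (hl : l ≤ n) (hzf : G.Adj z (p f)) (hzl : G.Adj z (p l))
    (hz : ∀ i ≤ n, i < f ∨ l < i → ¬ G.Adj z (p i)) (hzp : ∀ i ≤ n, p i ≠ z) :
    IndPath G (f + 2 + (n - l))
      (fun i => if i ≤ f then p i else if i = f + 1 then z else p (i - (f + 2) + l)) where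
  adj i hi := by
    rcases lt_trichotomy i f with h | rfl | h
    · simpa [h.le, Nat.succ_le_of_lt h] using hp.adj i (by omega)
    · simpa using hzf.symm
    · by_cases h' : i = f + 1
      · subst h'
        simpa using hzl
      · simp only [show ¬ i ≤ f by omega, h', show ¬ i + 1 ≤ f by omega,
          show ¬ i + 1 = f + 1 by omega, if_false]
        rw [show i + 1 - (f + 2) + l = i - (f + 2) + l + 1 by omega]
        exact hp.adj _ (by omega)
  not_adj i j hij hj := by
    by_cases hi1 : i ≤ f
    · by_cases hj1 : j ≤ f
      · simpa [hi1, hj1] using hp.not_adj i j hij (by omega)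
      · by_cases hj2 : j = f + 1
        · subst hj2
          simpa [hi1, G.adj_comm] using hz i (by omega) (Or.inl (by omega))
        · simpa [hi1, hj1, hj2] using hp.not_adj i (j - (f + 2) + l) (by omega) (by omega)
    · by_cases hi2 : i = f + 1
      · subst hi2
        simpa [show ¬ j ≤ f by omega, show ¬ j = f + 1 by omega] using
          hz (j - (f + 2) + l) (by omega) (Or.inr (by omega))
      · simpa [hi1, hi2, show ¬ j ≤ f by omega, show ¬ j = f + 1 by omega] using
          hp.not_adj (i - (f + 2) + l) (j - (f + 2) + l) (by omega) (by omega)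
  ne i j hij hj := by
    by_cases hi1 : i ≤ f
    · by_cases hj1 : j ≤ f
      · simpa [hi1, hj1] using hp.ne i j hij (by omega)
      · by_cases hj2 : j = f + 1
        · subst hj2
          simpa [hi1] using hzp i (by omega)
        · simpa [hi1, hj1, hj2] using hp.ne i (j - (f + 2) + l) (by omega) (by omega)
    · by_cases hi2 : i = f + 1
      · subst hi2
        simpa [show ¬ j ≤ f by omega, show ¬ j = f + 1 by omega] using
          (hzp (j - (f + 2) + l) (by omega)).symm
      · simpa [hi1, hi2, show ¬ j ≤ f by omega, show ¬ j = f + 1 by omega] using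
          hp.ne (i - (f + 2) + l) (j - (f + 2) + l) (by omega) (by omega)

variable [Fintype V] {w : V → ℝ}

namespace NoLocalSeparator

variable (hs : NoLocalSeparator G w)
include hs

/-- An anchored path that enters `A_z` can be rerouted through `z`, with the same parity. -/
theorem exists_reroute (hG : PawFriendly G) {n : ℕ} {p : ℕ → V} (hp : IndPath G n p) {z : V}
    (ha : Anchored G w z n p) (h0 : p 0 ∉ starA G w z) (hn : p n ∉ starA G w z)
    {m : ℕ} (hm : m ≤ n) (hmA : p m ∈ starA G w z) :
    ∃ n' q, IndPath G n' q ∧ (Even n' ↔ Even n) ∧ q 0 = p 0 ∧ q n' = p n ∧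
      ∀ i ≤ n', q i ∉ starA G w z ∧ (q i = z ∨ ∃ j ≤ n, q i = p j) := by
  obtain ⟨s, hsm, hsA, hsmin⟩ := exists_last_le (P := fun i => p i ∉ starA G w z) (m := m)
    ⟨0, Nat.zero_le _, h0⟩
  obtain ⟨t, hmt, htn, htA, htmin⟩ := exists_first_ge (P := fun i => p i ∉ starA G w z) hm hn
  have hne_sm : s ≠ m := by
    rintro rfl
    exact hsA hmA
  have hne_tm : t ≠ m := by
    rintro rfl
    exact htA hmA
  have hseg : ∀ i, s < i → i < t → p i ∈ starA G w z := by
    intro i h1 h2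
    by_contra h
    rcases le_total i m with h3 | h3
    · exact hsmin i h1 h3 h
    · exact htmin i h3 h2 h
  have hs1 := (hs.mem_of_adj_starA (hseg (s + 1) (by omega) (by omega))
    (hp.adj s (by omega)).symm).resolve_left hsA
  have ht1 := (hs.mem_of_adj_starA (hseg (t - 1) (by omega) (by omega))
    (by simpa [show t - 1 + 1 = t by omega] using hp.adj (t - 1) (by omega))).resolve_left htA
  have hnadj := hp.not_adj s t (by omega) htn
  have hpsN : p s ∈ nbhd G (starB G w z) := by
    refine hs1.resolve_left fun h => ?_
    rcases ht1 with h' | h'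
    · exact hp.ne s t (by omega) htn (h.trans h'.symm)
    · exact hnadj (h ▸ hs.adj_of_mem_nbhd h')
  have hptN : p t ∈ nbhd G (starB G w z) := by
    refine ht1.resolve_left fun h => ?_
    exact hnadj (h ▸ (hs.adj_of_mem_nbhd hpsN).symm)
  have hzp : ∀ i ≤ n, p i ≠ z := by
    intro i hi heq
    have h1 := hs.adj_of_mem_nbhd hpsN
    have h2 := hs.adj_of_mem_nbhd hptN
    rw [← heq, hp.adj_iff (by omega) (by omega)] at h1 h2
    have := hseg i (by omega) (by omega)
    rw [heq] at this
    exact hs.not_mem_starA_self z this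
  have hedge : ∀ k < n, p k ∈ nbhd G (starB G w z) → p (k + 1) ∉ nbhd G (starB G w z) := by
    intro k hk hk0 hk1
    have hout : ∀ i, p i ∈ nbhd G (starB G w z) → ¬ (s < i ∧ i < t) := fun i hi h =>
      hs.not_mem_starA_of_mem (Or.inr hi) (hseg i h.1 h.2)
    have h1 := hout k hk0
    have h2 := hout (k + 1) hk1
    rcases lt_or_ge k t with h | h
    · exact hs.no_edge_before hG hp ha (by omega) htn hk0 hk1 hptN
    · exact hs.no_edge_after hG hp ha (by omega) hk hk0 hk1 hpsN
  obtain ⟨f, -, hfs, hpf, hfmin⟩ := exists_first_ge (P := fun i => p i ∈ nbhd G (starB G w z))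
    (Nat.zero_le s) hpsN
  obtain ⟨l, hln, hpl, hlmax⟩ := exists_last_le (P := fun i => p i ∈ nbhd G (starB G w z))
    (m := n) ⟨t, htn, hptN⟩
  have htl : t ≤ l := by
    by_contra h
    exact hlmax t (by omega) htn hptN
  have heven := hs.even_sub_of_mem_nbhd hG.1 hp hzp hedge (by omega : f ≤ l) hln hpf hpl
  have hbefore : ∀ i < f, p i ∈ starB G w z := by
    intro i hi
    have hstart : p 0 ∈ starB G w z :=
      (((hs.mem_or_mem_starA (hzp 0 (by omega))).resolve_right h0).resolve_right
        (hfmin 0 le_rfl (by omega)))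
    refine IndPath.mem_of_closed (p := p) (t := f - 1) hstart ?_ i (Nat.zero_le _) (by omega)
    intro j _ hj hjB
    by_contra hB
    exact hfmin (j + 1) (Nat.zero_le _) (by omega) ⟨hB, _, hjB, (hp.adj j (by omega)).symm⟩
  have hafter : ∀ i, l < i → i ≤ n → p i ∈ starB G w z := by
    intro i hi hin
    have hend : p n ∈ starB G w z :=
      (((hs.mem_or_mem_starA (hzp n le_rfl)).resolve_right hn).resolve_right
        (hlmax n (by omega) le_rfl))
    refine IndPath.mem_of_closed_down (p := p) (s := i) (t := n) hend ?_ i le_rfl hin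
    intro j hj1 hj2 hjB
    by_contra hB
    exact hlmax j (by omega) (by omega) ⟨hB, _, hjB, hp.adj j (by omega)⟩
  refine ⟨_, _, hp.replace (by omega) hln (hs.adj_of_mem_nbhd hpf) (hs.adj_of_mem_nbhd hpl) ?_ hzp,
    ?_, by simp, ?_, ?_⟩
  · rintro i hi (h | h)
    · exact hs.not_adj_of_mem_starB (hbefore i h)
    · exact hs.not_adj_of_mem_starB (hafter i h hi)
  · have : n = f + (l - f) + (n - l) := by omega
    have h2 : Even 2 := even_two
    conv_rhs => rw [this]
    simp only [Nat.even_add, heven, h2]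
  · rw [if_neg (by omega), if_neg (by omega)]
    congr 1
    omega
  · intro i hi
    have hmem : ∀ j ≤ n, j ≤ f ∨ l ≤ j → p j ∉ starA G w z := by
      intro j hj h
      refine hs.not_mem_starA_of_mem ?_
      by_cases h1 : j = f
      · exact Or.inr (h1 ▸ hpf)
      by_cases h2 : j = l
      · exact Or.inr (h2 ▸ hpl)
      rcases h with h | h
      · exact Or.inl (hbefore j (by omega))
      · exact Or.inl (hafter j (by omega) hj)
    split_ifs with h1 h2
    · exact ⟨hmem i (by omega) (Or.inl h1), Or.inr ⟨i, by omega, rfl⟩⟩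
    · exact ⟨hs.not_mem_starA_self z, Or.inl rfl⟩
    · exact ⟨hmem _ (by omega) (Or.inr (by omega)), Or.inr ⟨_, by omega, rfl⟩⟩

/-- Rerouting through all stars with centre in `Z`, one after the other. -/
theorem exists_avoiding (hG : PawFriendly G) {Z Q : Set V} (hZQ : Z ⊆ Q)
    (hZZ : ∀ z ∈ Z, ∀ y ∈ Z, y ∉ starA G w z) {u v : V}
    (hu : ∀ z ∈ Z, u ∉ starA G w z) (hv : ∀ z ∈ Z, v ∉ starA G w z)
    (ha : ∀ z ∈ Z, ∀ n p, IndPath G n p → (∀ i ≤ n, p i ∈ Q) → p 0 = u → p n = v →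
      Anchored G w z n p)
    {n : ℕ} {p : ℕ → V} (hp : IndPath G n p) (hpQ : ∀ i ≤ n, p i ∈ Q) (hp0 : p 0 = u)
    (hpn : p n = v) :
    ∃ n' q, IndPath G n' q ∧ (Even n' ↔ Even n) ∧ q 0 = u ∧ q n' = v ∧
      (∀ i ≤ n', q i ∈ Q) ∧ ∀ z ∈ Z, ∀ i ≤ n', q i ∉ starA G w z := by
  induction hd : {x | (∃ i ≤ n, x = p i) ∧ ∃ z ∈ Z, x ∈ starA G w z}.ncard
    using Nat.strong_induction_on generalizing n p with
  | _ d ih =>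
    by_cases hex : ∃ z ∈ Z, ∃ m ≤ n, p m ∈ starA G w z
    · obtain ⟨z, hz, m, hm, hmA⟩ := hex
      obtain ⟨n', q, hq, hpar, hq0, hqn, hqmem⟩ := hs.exists_reroute hG hp
        (ha z hz n p hp hpQ hp0 hpn) (hp0 ▸ hu z hz) (hpn ▸ hv z hz) hm hmA
      have hqQ : ∀ i ≤ n', q i ∈ Q := by
        intro i hi
        rcases (hqmem i hi).2 with h | ⟨j, hj, h⟩
        · exact h ▸ hZQ hz
        · exact h ▸ hpQ j hj
      have hlt : {x | (∃ i ≤ n', x = q i) ∧ ∃ z ∈ Z, x ∈ starA G w z}.ncard < d := by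
        rw [← hd]
        refine Set.ncard_lt_ncard ⟨?_, fun hsub => ?_⟩ (Set.toFinite _)
        · rintro _ ⟨⟨i, hi, rfl⟩, y, hy, hyA⟩
          rcases (hqmem i hi).2 with h | ⟨j, hj, h⟩
          · exact (hZZ y hy z hz (h ▸ hyA)).elim
          · exact ⟨⟨j, hj, h⟩, y, hy, hyA⟩
        · obtain ⟨⟨i, hi, hpm⟩, -⟩ := hsub ⟨⟨m, hm, rfl⟩, z, hz, hmA⟩
          exact (hqmem i hi).1 (hpm ▸ hmA)
      obtain ⟨n'', r, hr, hpar', h⟩ := ih _ hlt hq hqQ (hq0.trans hp0) (hqn.trans hpn) rfl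
      exact ⟨n'', r, hr, hpar'.trans hpar, h⟩
    · push Not at hex
      exact ⟨n, p, hp, Iff.rfl, hp0, hpn, hpQ, hex⟩

variable {ord : V → ℕ}

/-- Two vertices on the same side of a bipartition of the star covering form an even pair. -/
theorem even_of_bipartition (hG : PawFriendly G) (hord : Function.Injective ord) {X₁ X₂ : Set V}
    (hX : IsBipartition G (starCovering G w ord) X₁ X₂) {n : ℕ} {p : ℕ → V} (hp : IndPath G n p)
    (h : (p 0 ∈ X₁ ∧ p n ∈ X₁) ∨ (p 0 ∈ X₂ ∧ p n ∈ X₂)) : Even n := by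
  classical
  rcases Nat.eq_zero_or_pos n with rfl | hn
  · exact Even.zero
  have hne : p n ≠ p 0 := (hp.ne 0 n hn le_rfl).symm
  have h1 : ∀ x ∈ X₁, x ∈ starCovering G w ord := fun x hx => hX.1 ▸ Or.inl hx
  have h2 : ∀ x ∈ X₂, x ∈ starCovering G w ord := fun x hx => hX.1 ▸ Or.inr hx
  have hp0 : p 0 ∈ starCovering G w ord := by
    rcases h with h | h
    · exact h1 _ h.1
    · exact h2 _ h.1
  have hpn : p n ∈ starCovering G w ord := by
    rcases h with h | h
    · exact h1 _ h.2
    · exact h2 _ h.2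
  have hnA := @hs.not_mem_starA_of_mem_starCovering V _ G w ord hord
  have hBeq := @hs.starB_eq_of_mem_starCovering V _ G w ord
  obtain ⟨n', q, hq, hpar, hq0, hqn, -, hqA⟩ := hs.exists_avoiding hG
    (Z := starCovering G w ord) (Q := Set.univ) (Set.subset_univ _)
    (fun z hz y hy => hnA hz hy) (u := p 0) (v := p n) (fun z hz => hnA hz hp0)
    (fun z hz => hnA hz hpn)
    (fun z _ m r _ _ hr0 hrm => by
      rw [← hr0] at hp0 hne
      rw [← hrm] at hpn hne
      exact ⟨fun _ _ _ => hBeq hp0, fun _ _ _ => hBeq hpn, fun h => (hBeq hpn h).symm, hBeq hp0,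
        fun h => (hs.starB_ne_of_mem_starCovering hord hp0 hpn hne h).elim⟩)
    hp (fun _ _ => trivial) rfl rfl
  rw [← hpar]
  have hqX : ∀ i ≤ n', q i ∈ starCovering G w ord := by
    intro i hi
    by_contra hc
    obtain ⟨m, hm, hA⟩ := hs.exists_mem_starCovering hord hc
    exact hqA m hm i hi hA
  have hdisj : ∀ x, x ∈ X₁ → x ∉ X₂ := fun x hx => Set.disjoint_left.1 hX.2.1 hx
  rw [← hq.colour_eq (S := starCovering G w ord) (col := fun v => decide (v ∈ X₁)) ?_ hqX, hq0, hqn]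
  · rcases h with h | h
    · simp [h]
    · have := hdisj (p 0)
      have := hdisj (p n)
      simp [show p 0 ∉ X₁ by tauto, show p n ∉ X₁ by tauto]
  · intro x hx y hy hxy heq
    rw [← hX.1] at hx hy
    rcases hx with hx | hx <;> rcases hy with hy | hy
    · exact hX.2.2.1 x hx y hy hxy
    · have := hdisj y
      simp only [hx, decide_true] at heq
      exact this (by simpa using heq.symm) hy
    · have := hdisj x
      simp only [hy, decide_true] at heq
      exact this (by simpa using heq) hx
    · exact hX.2.2.2 x hx y hy hxy

end NoLocalSeparator

end Reroute

/-! ### The core bag and its layers -/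

section Core

theorem ncard_le_mul_of_adj {V : Type*} [Finite V] {G : SimpleGraph V} {δ : ℕ}
    (hδ : ∀ v, {u | G.Adj v u}.ncard ≤ δ) {S T : Set V} (h : ∀ u ∈ S, ∃ y ∈ T, G.Adj y u) :
    S.ncard ≤ T.ncard * δ := by
  classical
  have := Fintype.ofFinite V
  have hsub : S ⊆ ↑(T.toFinset.biUnion fun y => {u | G.Adj y u}.toFinset) := by
    intro u hu
    obtain ⟨y, hy, hyu⟩ := h u hu
    simp only [Finset.coe_biUnion, Set.mem_iUnion]
    exact ⟨y, by simpa using hy, by simpa using hyu⟩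
  refine (Set.ncard_le_ncard hsub (Set.toFinite _)).trans ?_
  rw [Set.ncard_coe_finset, Set.ncard_eq_toFinset_card']
  refine Finset.card_biUnion_le_card_mul _ _ _ fun y _ => ?_
  rw [← Set.ncard_eq_toFinset_card']
  exact hδ y

theorem HasMaxDegree.ncard_le {V : Type*} [Fintype V] {G : SimpleGraph V} {δ : ℕ}
    (h : HasMaxDegree G δ) (v : V) : {u | G.Adj v u}.ncard ≤ δ := by
  classical
  unfold HasMaxDegree at h
  rw [← h, Set.ncard_eq_toFinset_card']
  convert G.degree_le_maxDegree v using 1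
  rw [← SimpleGraph.card_neighborFinset_eq_degree]
  congr 1

variable {V : Type*} [Fintype V] {G : SimpleGraph V} {w : V → ℝ} {ord ℓ : V → ℕ} {X₁ X₂ : Set V}

/-- The data from which the core bag and its layers are built. -/
structure CoreSetup (G : SimpleGraph V) (w : V → ℝ) (ord ℓ : V → ℕ) (X₁ X₂ : Set V) : Prop where
  noSep : NoLocalSeparator G w
  pawFriendly : PawFriendly G
  ord_injective : Function.Injective ord
  bipartition : IsBipartition G (starCovering G w ord) X₁ X₂
  linearExtension : IsLinearExtension G w ord ℓ

namespace CoreSetup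

variable (h : CoreSetup G w ord ℓ X₁ X₂)
include h

theorem mem_covering_left {x : V} (hx : x ∈ X₁) : x ∈ starCovering G w ord :=
  h.bipartition.1 ▸ Or.inl hx

theorem mem_covering_right {x : V} (hx : x ∈ X₂) : x ∈ starCovering G w ord :=
  h.bipartition.1 ▸ Or.inr hx

theorem mem_or_mem {x : V} (hx : x ∈ starCovering G w ord) : x ∈ X₁ ∨ x ∈ X₂ := by
  rwa [← h.bipartition.1] at hx

theorem covering_not_mem_starA {x y : V} (hx : x ∈ starCovering G w ord)
    (hy : y ∈ starCovering G w ord) : y ∉ starA G w x :=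
  h.noSep.not_mem_starA_of_mem_starCovering h.ord_injective hx hy

theorem mem_coreBag_iff {u : V} : u ∈ coreBag G w ord X₂ ↔
    u ∈ starCovering G w ord ∨ ∃ z ∈ X₂, u ∈ nbhd G (starB G w z) := by
  unfold coreBag
  rw [h.noSep.starFreeBag_eq h.ord_injective]
  simp only [Set.mem_union, Set.mem_iUnion, h.noSep.mem_starC_iff, exists_prop]
  constructor
  · rintro (hu | ⟨z, hz, rfl | hu⟩)
    · exact Or.inl hu
    · exact Or.inl (h.mem_covering_right hz)
    · exact Or.inr ⟨z, hz, hu⟩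
  · rintro (hu | ⟨z, hz, hu⟩)
    · exact Or.inl hu
    · exact Or.inr ⟨z, hz, Or.inr hu⟩

theorem not_mem_starA_right {u z : V} (hu : u ∈ coreBag G w ord X₂) (hz : z ∈ X₂) :
    u ∉ starA G w z := by
  intro hA
  rcases h.mem_coreBag_iff.1 hu with hu | ⟨y, hy, hu⟩
  · exact h.covering_not_mem_starA (h.mem_covering_right hz) hu hA
  · exact h.noSep.not_mem_nbhd_of_mem_starA h.ord_injective (h.mem_covering_right hz)
      (h.mem_covering_right hy) (h.bipartition.2.2.2 z hz y hy) hA hu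

theorem exists_mem_coreA {u : V} (hu : u ∈ coreBag G w ord X₂)
    (huX : u ∉ starCovering G w ord) : ∃ x ∈ X₁, u ∈ coreA G w ord X₂ x := by
  obtain ⟨m, hm, hA⟩ := h.noSep.exists_mem_starCovering h.ord_injective huX
  rcases h.mem_or_mem hm with hm | hm
  · exact ⟨m, hm, hA, hu⟩
  · exact (h.not_mem_starA_right hu hm hA).elim

theorem coreA_not_mem_covering {u x : V} (hx : x ∈ starCovering G w ord)
    (hu : u ∈ coreA G w ord X₂ x) : u ∉ starCovering G w ord := fun hc =>
  h.covering_not_mem_starA hx hc hu.1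

theorem ncard_coreA_le {δ : ℕ} (hδ : ∀ v, {u | G.Adj v u}.ncard ≤ δ) {x : V}
    (hx : x ∈ starCovering G w ord) : (coreA G w ord X₂ x).ncard ≤ δ ^ 2 := by
  rw [pow_two]
  refine (ncard_le_mul_of_adj (T := {y | G.Adj x y}) hδ ?_).trans (Nat.mul_le_mul_right _ (hδ x))
  intro u hu
  rcases h.mem_coreBag_iff.1 hu.2 with hc | ⟨y, hy, hyu⟩
  · exact (h.coreA_not_mem_covering hx hu hc).elim
  · have hadj := h.noSep.adj_of_mem_nbhd hyu
    refine ⟨y, ?_, hadj⟩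
    rcases h.noSep.adj_of_adj_starA h.ord_injective hx (h.mem_covering_right hy) hu.1 hadj.symm
      with rfl | hxy
    · exact ((h.noSep.mem_starA_iff.1 hu.1).2.2 hyu).elim
    · exact h.noSep.adj_of_mem_nbhd hxy

omit h in
/-- The position of a vertex of `A_x ∩ R` grows along `ℓ`. -/
theorem ncard_lt_of_lt {x a b : V} (hb : b ∈ coreA G w ord X₂ x) (hab : ℓ a < ℓ b) :
    {u ∈ coreA G w ord X₂ x | ℓ u ≤ ℓ a}.ncard < {u ∈ coreA G w ord X₂ x | ℓ u ≤ ℓ b}.ncard := by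
  refine Set.ncard_lt_ncard ⟨?_, fun hsub => ?_⟩ (Set.toFinite _)
  · rintro u ⟨hu, hua⟩
    exact ⟨hu, hua.trans hab.le⟩
  · exact absurd (hsub ⟨hb, le_rfl⟩).2 (by omega)

variable {q : ℕ} (hq : ∀ x ∈ X₁, (coreA G w ord X₂ x).ncard ≤ q)
include hq

omit h in
theorem ncard_le_of_mem_layer {i : ℕ} {u x : V} (hu : u ∈ layer G w ord ℓ X₁ X₂ q i)
    (hx : x ∈ X₁) (hux : u ∈ coreA G w ord X₂ x) :
    {t ∈ coreA G w ord X₂ x | ℓ t ≤ ℓ u}.ncard ≤ i := by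
  by_contra hlt
  refine hu.2 ?_
  simp only [Set.mem_iUnion, exists_prop]
  refine ⟨{t ∈ coreA G w ord X₂ x | ℓ t ≤ ℓ u}.ncard, ⟨by omega, ?_⟩, x, hx, hux, rfl⟩
  exact (Set.ncard_le_ncard (fun t ht => ht.1) (Set.toFinite _)).trans (hq x hx)

omit h in
theorem exists_mem_layer {u x : V} (hx : x ∈ X₁) (hux : u ∈ coreA G w ord X₂ x) :
    ∃ k, 1 ≤ k ∧ k ≤ q ∧ u ∈ layer G w ord ℓ X₁ X₂ q k := by
  classical
  have hrank : ∀ y ∈ X₁, u ∈ coreA G w ord X₂ y →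
      1 ≤ {t ∈ coreA G w ord X₂ y | ℓ t ≤ ℓ u}.ncard ∧
      {t ∈ coreA G w ord X₂ y | ℓ t ≤ ℓ u}.ncard ≤ q := by
    intro y hy hu
    refine ⟨(Set.ncard_pos (Set.toFinite _)).2 ⟨u, hu, le_rfl⟩, ?_⟩
    exact (Set.ncard_le_ncard (fun t ht => ht.1) (Set.toFinite _)).trans (hq y hy)
  obtain ⟨k, hkq, hk, hmax⟩ := exists_last_le (m := q)
    (P := fun i => u ∈ preLayer G w ord ℓ X₁ X₂ i) ⟨_, (hrank x hx hux).2, x, hx, hux, rfl⟩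
  refine ⟨k, ?_, hkq, hk, ?_⟩
  · obtain ⟨y, hy, hu, rfl⟩ := hk
    exact (hrank y hy hu).1
  · simp only [Set.mem_iUnion, exists_prop, not_exists, not_and]
    rintro j ⟨h1, h2⟩
    exact hmax j h1 h2

/-- A vertex of the `i`-th layer is cut off by a vertex of the core bag outside the lower layers
only if the two are star twins: otherwise the latter vertex would precede the former in some
`A_x ∩ R` in which it has position at least `i`. -/
theorem starB_eq_of_mem_layer {i : ℕ} {u f : V} (hu : u ∈ layer G w ord ℓ X₁ X₂ q i)
    (hf : f ∈ coreBag G w ord X₂) (hfX : f ∉ starCovering G w ord)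
    (hfl : ∀ k, 1 ≤ k → k < i → f ∉ layer G w ord ℓ X₁ X₂ q k) (huf : u ∈ starA G w f) :
    starB G w u = starB G w f := by
  by_contra hne
  have hlt : ℓ f < ℓ u := h.linearExtension.2 f u (h.noSep.mem_starA_iff.1 huf).1.symm
    (h.noSep.starLE_iff.2 (Or.inr (Or.inr ⟨Ne.symm hne, huf⟩)))
  obtain ⟨x, hx, hfx⟩ := h.exists_mem_coreA hf hfX
  obtain ⟨k, hk1, hkq, hk⟩ := exists_mem_layer (ℓ := ℓ) hq hx hfx
  have hik : i ≤ k := by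
    by_contra hc
    exact hfl k hk1 (by omega) hk
  obtain ⟨⟨y, hy, hfy, hcard⟩, -⟩ := hk
  obtain ⟨⟨x', hx', hux', -⟩, -⟩ := id hu
  have huy : u ∈ coreA G w ord X₂ y := by
    refine ⟨(h.noSep.starA_subset_of_mem_starA hfy.1 huf).resolve_left ?_, hux'.2⟩
    rintro rfl
    exact h.coreA_not_mem_covering (h.mem_covering_left hx') hux' (h.mem_covering_left hy)
  have h1 := ncard_le_of_mem_layer hq hu hy huy
  have h2 := ncard_lt_of_lt huy hlt
  omega

end CoreSetup

/-- The vertices that an induced path between two vertices of the `i`-th layer may use. -/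
def layerAmbient (G : SimpleGraph V) (w : V → ℝ) (ord ℓ : V → ℕ) (X₁ X₂ : Set V) (q i : ℕ) :
    Set V :=
  {v | v ∉ X₁ ∧ ∀ k, 1 ≤ k → k < i → v ∉ layer G w ord ℓ X₁ X₂ q k}

theorem layer_disjoint {q i j : ℕ} (hij : i < j) (hj : j ≤ q) {u : V}
    (hi : u ∈ layer G w ord ℓ X₁ X₂ q i) : u ∉ layer G w ord ℓ X₁ X₂ q j := by
  intro h
  refine hi.2 ?_
  simp only [Set.mem_iUnion, exists_prop]
  exact ⟨j, ⟨hij, hj⟩, h.1⟩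

namespace CoreSetup

variable (h : CoreSetup G w ord ℓ X₁ X₂) {q : ℕ}
  (hq : ∀ x ∈ X₁, (coreA G w ord X₂ x).ncard ≤ q) {i : ℕ}
include h

theorem layer_subset_coreBag {u : V} (hu : u ∈ layer G w ord ℓ X₁ X₂ q i) :
    u ∈ coreBag G w ord X₂ ∧ u ∉ starCovering G w ord := by
  obtain ⟨⟨x, hx, hux, -⟩, -⟩ := hu
  exact ⟨hux.2, h.coreA_not_mem_covering (h.mem_covering_left hx) hux⟩

/-- A path that starts in `A_x` and avoids `C_x` stays in `A_x`. -/
theorem path_subset_starA {n : ℕ} {p : ℕ → V} (hp : IndPath G n p) {x y : V} (hx : x ∈ X₁)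
    (hy : y ∈ X₁) (hall : ∀ j ≤ n, p j ∈ starA G w y) (h0 : p 0 ∈ starA G w x) :
    ∀ j ≤ n, p j ∈ starA G w x := by
  intro j hj
  refine IndPath.mem_of_closed (p := p) (s := 0) (t := n) h0 ?_ j (Nat.zero_le _) hj
  intro k _ hk hkA
  rcases h.noSep.mem_of_adj_starA hkA (hp.adj k hk) with h1 | h1 | h1
  · exact h1
  · exact (h.covering_not_mem_starA (h.mem_covering_left hy) (h.mem_covering_left hx)
      (h1 ▸ hall (k + 1) (by omega))).elim
  · exact (h.noSep.not_mem_nbhd_of_mem_starA h.ord_injective (h.mem_covering_left hy)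
      (h.mem_covering_left hx) (h.bipartition.2.2.1 y hy x hx) (hall (k + 1) (by omega)) h1).elim

include hq

/-- A path between two vertices of the same layer is not contained in one set `A_x`: each end
would precede the other in the numbering. -/
theorem path_not_subset_starA {n : ℕ} {p : ℕ → V} (hp : IndPath G n p) (hn : 0 < n)
    (hu : p 0 ∈ layer G w ord ℓ X₁ X₂ q i) (hv : p n ∈ layer G w ord ℓ X₁ X₂ q i) {y : V}
    (hy : y ∈ X₁) : ¬ ∀ j ≤ n, p j ∈ starA G w y := by
  intro hall
  have key : ∀ {m : ℕ} {r : ℕ → V}, IndPath G m r → r 0 ∈ layer G w ord ℓ X₁ X₂ q i →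
      r m ∈ layer G w ord ℓ X₁ X₂ q i → (∀ j ≤ m, r j ∈ starA G w y) → ¬ ℓ (r 0) < ℓ (r m) := by
    intro m r hr hr0 hrm hrall hlt
    obtain ⟨⟨x, hx, hrx, hcard⟩, -⟩ := id hr0
    have hmx : r m ∈ coreA G w ord X₂ x :=
      ⟨h.path_subset_starA hr hx hy hrall hrx.1 m le_rfl, (h.layer_subset_coreBag hrm).1⟩
    have h1 := ncard_le_of_mem_layer hq hrm hx hmx
    have h2 := ncard_lt_of_lt hmx hlt
    omega
  have h1 := key hp hu hv hall
  have h2 := key hp.reverse (by simpa using hv) (by simpa using hu) fun j hj => hall _ (by omega)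
  simp only [Nat.sub_zero, Nat.sub_self] at h2
  exact hp.ne 0 n hn le_rfl (h.linearExtension.1 (by omega))

theorem anchored_of_layer {n : ℕ} {p : ℕ → V} (hp : IndPath G n p) (hn : 0 < n)
    (hu : p 0 ∈ layer G w ord ℓ X₁ X₂ q i) (hv : p n ∈ layer G w ord ℓ X₁ X₂ q i)
    (hQ : ∀ j ≤ n, p j ∈ layerAmbient G w ord ℓ X₁ X₂ q i) {z : V} (hz : z ∈ X₂) :
    Anchored G w z n p := by
  have hmid : ∀ k ≤ n, p k ∈ nbhd G (starB G w z) → p k ∉ starCovering G w ord := by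
    intro k hk hkz hc
    rcases h.mem_or_mem hc with hc | hc
    · exact (hQ k hk).1 hc
    · exact h.bipartition.2.2.2 z hz _ hc (h.noSep.adj_of_mem_nbhd hkz)
  have hR : ∀ k, p k ∈ nbhd G (starB G w z) → p k ∈ coreBag G w ord X₂ := fun k hk =>
    h.mem_coreBag_iff.2 (Or.inr ⟨z, hz, hk⟩)
  have hu' := h.layer_subset_coreBag hu
  have hv' := h.layer_subset_coreBag hv
  refine ⟨fun k hk hkz hA => ?_, fun k hk hkz hA => ?_, fun hA => ?_, fun hA => ?_, fun heq => ?_⟩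
  · exact h.starB_eq_of_mem_layer hq hu (hR k hkz) (hmid k hk hkz) (hQ k hk).2 hA
  · exact h.starB_eq_of_mem_layer hq hv (hR k hkz) (hmid k hk hkz) (hQ k hk).2 hA
  · exact (h.starB_eq_of_mem_layer hq hv hu'.1 hu'.2 (hQ 0 (by omega)).2 hA).symm
  · exact h.starB_eq_of_mem_layer hq hu hv'.1 hv'.2 (hQ n le_rfl).2 hA
  · by_contra! hout
    obtain ⟨⟨x, hx, hux, -⟩, -⟩ := id hu
    refine h.path_not_subset_starA hq hp hn hu hv hx fun j hj => ?_
    by_cases hj0 : p j = p 0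
    · rw [hj0]
      exact hux.1
    · have hA := (h.noSep.mem_or_mem_starA hj0).resolve_left (hout j hj)
      refine (h.noSep.starA_subset_of_mem_starA hux.1 hA).resolve_left ?_
      intro heq'
      exact (hQ j hj).1 (heq' ▸ hx)

/-- The first stretch of a path that starts in a layer, up to the point where it leaves `A_x`
through a vertex of `X₂`, is odd. -/
theorem odd_of_first_exit {n : ℕ} {p : ℕ → V} (hp : IndPath G n p)
    (hu : p 0 ∈ layer G w ord ℓ X₁ X₂ q i)
    (hQ : ∀ j ≤ n, p j ∈ layerAmbient G w ord ℓ X₁ X₂ q i) {x : V} (hx : x ∈ X₁)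
    (hA : ∀ j < n, p j ∈ starA G w x) (hn : p n ∈ X₂) : Odd n := by
  have hs := h.noSep
  have hXx := h.mem_covering_left hx
  have hXn := h.mem_covering_right hn
  have hu' := h.layer_subset_coreBag hu
  have hn0 : 0 < n := by
    rcases Nat.eq_zero_or_pos n with rfl | h0
    · exact (hu'.2 hXn).elim
    · exact h0
  obtain ⟨z, hz, huz⟩ := (h.mem_coreBag_iff.1 hu'.1).resolve_left hu'.2
  have hXz := h.mem_covering_right hz
  have hzu := hs.adj_of_mem_nbhd huz
  have hdisj : ∀ y, y ∈ X₁ → y ∉ X₂ := fun y hy => Set.disjoint_left.1 h.bipartition.2.1 hy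
  have hzx : z ∈ nbhd G (starB G w x) := by
    refine (hs.adj_of_adj_starA h.ord_injective hXx hXz (hA 0 hn0) hzu.symm).resolve_left ?_
    rintro rfl
    exact hdisj _ hx hz
  have hnx : p n ∈ nbhd G (starB G w x) := by
    have hadj := hp.adj (n - 1) (by omega)
    rw [show n - 1 + 1 = n by omega] at hadj
    refine (hs.adj_of_adj_starA h.ord_injective hXx hXn (hA (n - 1) (by omega))
      hadj).resolve_left ?_
    intro heq
    exact hdisj _ hx (heq ▸ hn)
  by_cases hzn : p n = z
  · have hadj : G.Adj (p 0) (p n) := hzn ▸ hzu.symm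
    rw [hp.adj_iff (by omega) le_rfl] at hadj
    obtain rfl : n = 1 := by omega
    exact odd_one
  have hznadj : ¬ G.Adj z (p n) := h.bipartition.2.2.2 z hz _ hn
  have hpX : ∀ j < n, p j ∉ starCovering G w ord := fun j hj hc =>
    h.covering_not_mem_starA hXx hc (hA j hj)
  have hpz : ∀ j ≤ n, p j ≠ z := by
    intro j hj heq
    rcases hj.lt_or_eq with hj | rfl
    · exact hpX j hj (heq ▸ hXz)
    · exact hzn heq
  have hnz : p n ∉ nbhd G (starB G w z) := fun hc => hznadj (hs.adj_of_mem_nbhd hc)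
  -- A vertex of `C_z` in `B_x`, which serves as the pendant vertex of paws with centre `z`.
  obtain ⟨c, hcx, hcz⟩ : ∃ c ∈ starB G w x, c ∈ nbhd G (starB G w z) := by
    by_contra! hno
    obtain ⟨b, hbx, hbz⟩ := hs.exists_mem_inter (hs.half_lt_weight_starB x)
      (hs.half_lt_weight_starB z)
    have hsub := (hs.isComponent_starB x).connectedSet (starB G w z) ⟨b, hbx, hbz⟩
      fun a _ haz a' ha'x haa' => by
        by_contra hc
        exact hno a' ha'x ⟨hc, a, haz, haa'.symm⟩
    obtain ⟨-, b', hb', hzb'⟩ := hzx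
    exact hs.not_adj_of_mem_starB (hsub hb') hzb'
  have hedge : ∀ k < n, p k ∈ nbhd G (starB G w z) → p (k + 1) ∉ nbhd G (starB G w z) := by
    intro k hk hk0 hk1
    have hk2 : k + 2 ≤ n := by
      by_contra hc
      obtain rfl : k + 1 = n := by omega
      exact hnz hk1
    have hAk := hA k hk
    have hAb := hA (k + 1) (by omega)
    -- The end of the path lies in `B_y` for every vertex `y` of `A_x` not adjacent to it.
    have hendB : ∀ j, j + 2 ≤ n → p n ∈ starB G w (p j) := fun j hj =>
      hs.mem_starB_of_mem (hs.closed_starB_subset_of_mem_starA (hA j (by omega)) (Or.inr hnx))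
        (hp.not_adj j n (by omega) le_rfl)
    have hadj := hp.adj k hk
    have hadj' := hp.adj (k + 1) (by omega)
    have hk2B : p (k + 2) ∈ starB G w (p k) := hs.mem_starB_of_end hp (by omega) hk2 (hendB k hk2)
    have h0b : p 0 ∈ starB G w (p (k + 1)) ∪ nbhd G (starB G w (p (k + 1))) := by
      refine (hs.mem_or_mem_starA (hp.ne 0 (k + 1) (by omega) (by omega))).resolve_right ?_
      intro huA
      have heq := h.starB_eq_of_mem_layer hq hu (h.mem_coreBag_iff.2 (Or.inr ⟨z, hz, hk1⟩))
        (hpX (k + 1) (by omega)) (hQ (k + 1) (by omega)).2 huA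
      have := hs.mem_starB_of_end hp (i := 0) (j := k + 2) (by omega) hk2 (hendB 0 (by omega))
      rw [heq] at this
      exact hs.not_adj_of_mem_starB this hadj'
    refine hs.paw_false h.pawFriendly hadj (hs.not_adj_starA_starB hAk hcx)
      (hs.not_adj_starA_starB hAb hcx) hk0 hk1 hcz
      ⟨_, hs.isComponent_starB (p k), Or.inl (hs.starB_subset_of_mem_starA hAk hcx),
        Or.inr ⟨fun hc => hs.not_adj_of_mem_starB hc hadj, _, hk2B, hadj'⟩⟩
      (Or.inl (hs.starB_subset_of_mem_starA hAb hcx)) ?_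
    rcases Nat.eq_zero_or_pos k with rfl | hkpos
    · exact h0b
    · have h0B : p 0 ∈ starB G w (p (k + 1)) := hs.mem_starB_of_mem h0b fun hc =>
        hp.not_adj 0 (k + 1) (by omega) (by omega) hc.symm
      have hpre := hs.mem_starB_of_start hp (i := k + 1) (j := k - 1) (by omega) (by omega) h0B
      have hadjk := hp.adj (k - 1) (by omega)
      rw [show k - 1 + 1 = k by omega] at hadjk
      exact Or.inr ⟨fun hc => hs.not_adj_of_mem_starB hc hadj.symm, _, hpre, hadjk.symm⟩
  obtain ⟨l, hln, hlz, hlmax⟩ := exists_last_le (m := n)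
    (P := fun j => p j ∈ nbhd G (starB G w z)) ⟨0, Nat.zero_le _, huz⟩
  have hln' : l < n := lt_of_le_of_ne hln (by rintro rfl; exact hnz hlz)
  have hleven : Even l := by
    simpa using hs.even_sub_of_mem_nbhd h.pawFriendly.1 hp hpz hedge (Nat.zero_le l) hln huz hlz
  have hnB : p n ∈ starB G w z := hs.mem_starB_of_mem
    (hs.mem_of_mem_starCovering h.ord_injective hXz hXn hzn) hznadj
  have hafter : ∀ j, l < j → j ≤ n → p j ∈ starB G w z := by
    intro j hj hjn
    refine IndPath.mem_of_closed_down (p := p) (s := j) (t := n) hnB ?_ j le_rfl hjn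
    intro k hk1 hk2 hkB
    by_contra hc
    exact hlmax k (by omega) (by omega) ⟨hc, _, hkB, hp.adj k (by omega)⟩
  have hpath : IndPath G (n - l + 1) (fun j => if j = 0 then z else p (l + (j - 1))) := by
    refine ⟨fun j hj => ?_, fun j k hjk hk => ?_, fun j k hjk hk => ?_⟩
    · by_cases hj0 : j = 0
      · simpa [hj0] using hs.adj_of_mem_nbhd hlz
      · have := hp.adj (l + (j - 1)) (by omega)
        rw [show l + (j - 1) + 1 = l + j by omega] at this
        simpa [hj0] using this
    · by_cases hj0 : j = 0
      · simpa [hj0, show k ≠ 0 by omega] using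
          hs.not_adj_of_mem_starB (hafter (l + (k - 1)) (by omega) (by omega))
      · simpa [hj0, show k ≠ 0 by omega] using
          hp.not_adj (l + (j - 1)) (l + (k - 1)) (by omega) (by omega)
    · by_cases hj0 : j = 0
      · simpa [hj0, show k ≠ 0 by omega] using (hpz (l + (k - 1)) (by omega)).symm
      · simpa [hj0, show k ≠ 0 by omega] using
          hp.ne (l + (j - 1)) (l + (k - 1)) (by omega) (by omega)
  have heven := hs.even_of_interior_starA h.pawFriendly.1 hpath (by omega) (z := x)
    (by simpa using hzx) (by simpa [show l + (n - l) = n by omega] using hnx) (by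
      intro j hj0 hj
      simpa [show j ≠ 0 by omega] using hA (l + (j - 1)) (by omega))
  rw [show n = l + (n - l) by omega]
  refine hleven.add_odd ?_
  rw [Nat.even_add_one, Nat.not_even_iff_odd] at heven
  exact heven

theorem exists_first_exit {n : ℕ} {p : ℕ → V} (hp : IndPath G n p) (hn : 0 < n)
    (hu : p 0 ∈ layer G w ord ℓ X₁ X₂ q i) (hv : p n ∈ layer G w ord ℓ X₁ X₂ q i)
    (hQ : ∀ j ≤ n, p j ∈ layerAmbient G w ord ℓ X₁ X₂ q i)
    (hZ : ∀ z ∈ X₂, ∀ j ≤ n, p j ∉ starA G w z) :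
    ∃ a ≤ n, p a ∈ X₂ ∧ Odd a ∧ ∀ j < a, p j ∉ starCovering G w ord := by
  obtain ⟨⟨x, hx, hux, -⟩, -⟩ := id hu
  have hXx := h.mem_covering_left hx
  have hex := h.path_not_subset_starA hq hp hn hu hv hx
  push Not at hex
  obtain ⟨t, htn, htA⟩ := hex
  obtain ⟨a, -, hat, haA, hmin⟩ := exists_first_ge (P := fun j => p j ∉ starA G w x)
    (Nat.zero_le t) htA
  have ha0 : a ≠ 0 := by
    rintro rfl
    exact haA hux.1
  have hA : ∀ j < a, p j ∈ starA G w x := fun j hj => by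
    by_contra hc
    exact hmin j (Nat.zero_le _) hj hc
  have hadj := hp.adj (a - 1) (by omega)
  rw [show a - 1 + 1 = a by omega] at hadj
  have hax : p a ∈ nbhd G (starB G w x) := by
    rcases h.noSep.mem_of_adj_starA (hA (a - 1) (by omega)) hadj with h1 | h1 | h1
    · exact (haA h1).elim
    · exact ((hQ a (by omega)).1 (h1 ▸ hx)).elim
    · exact h1
  have haX : p a ∈ X₂ := by
    by_contra hc
    have haX : p a ∉ starCovering G w ord := fun hc' =>
      (h.mem_or_mem hc').elim (hQ a (by omega)).1 hc
    obtain ⟨m, hm, hmA⟩ := h.noSep.exists_mem_starCovering h.ord_injective haX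
    rcases h.mem_or_mem hm with hm' | hm'
    · exact h.noSep.not_mem_nbhd_of_mem_starA h.ord_injective hm hXx
        (h.bipartition.2.2.1 m hm' x hx) hmA hax
    · exact hZ m hm' a (by omega) hmA
  refine ⟨a, by omega, haX, ?_, fun j hj hc => h.covering_not_mem_starA hXx hc (hA j hj)⟩
  have hseg := hp.segment 0 a (by omega)
  simp only [Nat.zero_add] at hseg
  exact h.odd_of_first_exit hq hseg hu (fun j hj => hQ j (by omega)) hx hA haX

/-- Two vertices of the `i`-th layer form an even pair once `X₁` and the lower layers are
removed. -/
theorem even_of_layer {n : ℕ} {p : ℕ → V} (hp : IndPath G n p) (hn : 0 < n)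
    (hu : p 0 ∈ layer G w ord ℓ X₁ X₂ q i) (hv : p n ∈ layer G w ord ℓ X₁ X₂ q i)
    (hQ : ∀ j ≤ n, p j ∈ layerAmbient G w ord ℓ X₁ X₂ q i) : Even n := by
  have huv := hp.ne 0 n hn le_rfl
  obtain ⟨m, r, hr, hpar, hr0, hrm, hrQ, hrZ⟩ := h.noSep.exists_avoiding h.pawFriendly
    (Z := X₂) (Q := layerAmbient G w ord ℓ X₁ X₂ q i) (u := p 0) (v := p n)
    (fun z hz => ⟨fun hc => Set.disjoint_left.1 h.bipartition.2.1 hc hz, fun k _ _ hk =>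
      (h.layer_subset_coreBag hk).2 (h.mem_covering_right hz)⟩)
    (fun z hz y hy => h.covering_not_mem_starA (h.mem_covering_right hz) (h.mem_covering_right hy))
    (fun z hz => h.not_mem_starA_right (h.layer_subset_coreBag hu).1 hz)
    (fun z hz => h.not_mem_starA_right (h.layer_subset_coreBag hv).1 hz)
    (fun z hz m r hr hrQ hr0 hrm => by
      refine h.anchored_of_layer hq hr (Nat.pos_of_ne_zero ?_) (hr0 ▸ hu) (hrm ▸ hv) hrQ hz
      rintro rfl
      exact huv (hr0.symm.trans hrm))
    hp hQ rfl rfl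
  rw [← hpar]
  have hm : 0 < m := by
    refine Nat.pos_of_ne_zero ?_
    rintro rfl
    exact huv (hr0.symm.trans hrm)
  rw [← hr0] at hu
  rw [← hrm] at hv
  obtain ⟨a, ham, haX, hodd, hamin⟩ := h.exists_first_exit hq hr hm hu hv hrQ hrZ
  obtain ⟨b, hbm, hbX, hoddb, -⟩ := h.exists_first_exit hq hr.reverse hm (by simpa using hv)
    (by simpa using hu) (fun j hj => hrQ _ (by omega)) (fun z hz j hj => hrZ z hz _ (by omega))
  have hab : a ≤ m - b := by
    by_contra hc
    exact hamin (m - b) (by omega) (h.mem_covering_right hbX)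
  have hmid := h.noSep.even_of_bipartition h.pawFriendly h.ord_injective h.bipartition
    (hr.segment a (m - b - a) (by omega)) (Or.inr ⟨haX, by
      rwa [show a + (m - b - a) = m - b by omega]⟩)
  rw [show m = a + (m - b - a) + b by omega]
  exact (hodd.add_even hmid).add_odd hoddb

end CoreSetup

end Core

/-! ### The core bag is an even set separator -/

section Separator

variable {V : Type*} [Fintype V] {G : SimpleGraph V} {w : V → ℝ} {ord ℓ : V → ℕ} {X₁ X₂ : Set V}

/-- Enlarging a balanced separator refines the components, so it stays balanced. -/
theorem BalancedSeparator.mono (hw : ∀ v, 0 ≤ w v) {c : ℝ} {Y Z : Set V} (hYZ : Y ⊆ Z)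
    (hY : BalancedSeparator G w c Y) : BalancedSeparator G w c Z := by
  intro D hD
  obtain ⟨v, hv⟩ := hD.nonempty
  have hsub : D ⊆ Yᶜ := hD.subset.trans (Set.compl_subset_compl.2 hYZ)
  obtain ⟨E, hE, hvE⟩ := exists_isComponent (G := G) (hsub hv)
  exact (weight_mono hw (hE.subset_of_connectedSet hD.connectedSet hsub ⟨v, hv, hvE⟩)).trans
    (hY E hE)

namespace CoreSetup

variable (h : CoreSetup G w ord ℓ X₁ X₂) {q : ℕ}
  (hq : ∀ x ∈ X₁, (coreA G w ord X₂ x).ncard ≤ q)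
include h

theorem exists_component_subset_starA {D : Set V}
    (hD : IsComponent G (coreBag G w ord X₂)ᶜ D) :
    ∃ x ∈ starCovering G w ord, D ⊆ starA G w x := by
  have hs := h.noSep
  have hcov : ∀ v ∈ D, v ∉ starCovering G w ord := fun v hv hc =>
    hD.subset hv (h.mem_coreBag_iff.2 (Or.inl hc))
  by_cases hex : ∃ z ∈ X₂, ∃ v ∈ D, v ∈ starA G w z
  · obtain ⟨z, hz, v, hv, hvz⟩ := hex
    refine ⟨z, h.mem_covering_right hz, hD.connectedSet _ ⟨v, hv, hvz⟩ fun a ha haz b hb hab => ?_⟩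
    rcases hs.mem_of_adj_starA haz hab with h1 | rfl | h1
    · exact h1
    · exact (hcov _ hb (h.mem_covering_right hz)).elim
    · exact (hD.subset hb (h.mem_coreBag_iff.2 (Or.inr ⟨z, hz, h1⟩))).elim
  · push Not at hex
    have hleft : ∀ v ∈ D, ∃ x ∈ X₁, v ∈ starA G w x := by
      intro v hv
      obtain ⟨m, hm, hvm⟩ := hs.exists_mem_starCovering h.ord_injective (hcov v hv)
      rcases h.mem_or_mem hm with hm | hm
      · exact ⟨m, hm, hvm⟩
      · exact (hex m hm v hv hvm).elim
    obtain ⟨v, hv⟩ := hD.nonempty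
    obtain ⟨x, hx, hvx⟩ := hleft v hv
    refine ⟨x, h.mem_covering_left hx, hD.connectedSet _ ⟨v, hv, hvx⟩ fun a ha hax b hb hab => ?_⟩
    rcases hs.mem_of_adj_starA hax hab with h1 | rfl | h1
    · exact h1
    · exact (hcov _ hb (h.mem_covering_left hx)).elim
    · obtain ⟨y, hy, hby⟩ := hleft b hb
      exact (hs.not_mem_nbhd_of_mem_starA h.ord_injective (h.mem_covering_left hy)
        (h.mem_covering_left hx) (h.bipartition.2.2.1 y hy x hx) hby h1).elim

theorem component_bounds {δ : ℕ} (hδ : ∀ v, {u | G.Adj v u}.ncard ≤ δ) {D : Set V}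
    (hD : IsComponent G (coreBag G w ord X₂)ᶜ D) :
    (nbhd G D).ncard ≤ δ ^ 2 + (δ + 1) ∧ weight w D ≤ 1 / 2 := by
  have hs := h.noSep
  obtain ⟨x, hx, hDx⟩ := h.exists_component_subset_starA hD
  constructor
  · have hsub : nbhd G D ⊆ coreA G w ord X₂ x ∪ insert x {u | G.Adj x u} := by
      rintro u ⟨huD, d, hd, hud⟩
      have huR : u ∈ coreBag G w ord X₂ := by
        by_contra hc
        exact huD (hD.mem_of_adj hd hc hud.symm)
      rcases hs.mem_of_adj_starA (hDx hd) hud.symm with h1 | h1 | h1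
      · exact Or.inl ⟨h1, huR⟩
      · exact Or.inr (Or.inl h1)
      · exact Or.inr (Or.inr (hs.adj_of_mem_nbhd h1))
    refine (Set.ncard_le_ncard hsub (Set.toFinite _)).trans ((Set.ncard_union_le _ _).trans ?_)
    exact add_le_add (h.ncard_coreA_le hδ hx)
      ((Set.ncard_insert_le _ _).trans (Nat.add_le_add_right (hδ x) 1))
  · have h1 := weight_mono hs.nonneg hDx
    have h2 := hs.half_lt_weight_starB x
    have h3 := weight_add_le hs.nonneg (D := starA G w x) (E := starB G w x)
      (Set.disjoint_left.2 fun _ hu hB => (hs.mem_starA_iff.1 hu).2.1 hB)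
    rw [hs.total] at h3
    linarith

omit h in
theorem coreTuple_zero {i : Fin (q + 2)} (hi : i.val = 0) :
    coreTuple G w ord ℓ X₁ X₂ q i = X₁ := by
  simp [coreTuple, hi]

omit h in
theorem coreTuple_one {i : Fin (q + 2)} (hi : i.val = 1) :
    coreTuple G w ord ℓ X₁ X₂ q i = X₂ := by
  simp [coreTuple, hi]

omit h in
theorem coreTuple_layer {i : Fin (q + 2)} (hi : 2 ≤ i.val) :
    coreTuple G w ord ℓ X₁ X₂ q i = layer G w ord ℓ X₁ X₂ q (i.val - 1) := by
  simp [coreTuple, show i.val ≠ 0 by omega, show i.val ≠ 1 by omega]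

theorem coreTuple_disjoint {i j : Fin (q + 2)} (hij : i < j) :
    Disjoint (coreTuple G w ord ℓ X₁ X₂ q i) (coreTuple G w ord ℓ X₁ X₂ q j) := by
  have hij' : i.val < j.val := hij
  rw [Set.disjoint_left]
  intro u hui huj
  rcases Nat.lt_or_ge j.val 2 with hj | hj
  · rw [coreTuple_zero (show i.val = 0 by omega)] at hui
    rw [coreTuple_one (show j.val = 1 by omega)] at huj
    exact Set.disjoint_left.1 h.bipartition.2.1 hui huj
  · rw [coreTuple_layer hj] at huj
    have huX := (h.layer_subset_coreBag huj).2
    rcases Nat.lt_or_ge i.val 2 with hi | hi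
    · refine huX ?_
      rcases Nat.lt_or_ge i.val 1 with hi' | hi'
      · rw [coreTuple_zero (show i.val = 0 by omega)] at hui
        exact h.mem_covering_left hui
      · rw [coreTuple_one (show i.val = 1 by omega)] at hui
        exact h.mem_covering_right hui
    · rw [coreTuple_layer hi] at hui
      exact layer_disjoint (by omega) (by omega) hui huj

include hq

theorem iUnion_coreTuple :
    (⋃ i, coreTuple G w ord ℓ X₁ X₂ q i) = coreBag G w ord X₂ := by
  ext u
  rw [Set.mem_iUnion]
  constructor
  · rintro ⟨i, hi⟩
    rcases Nat.lt_or_ge i.val 2 with hi2 | hi2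
    · refine h.mem_coreBag_iff.2 (Or.inl ?_)
      rcases Nat.lt_or_ge i.val 1 with hi' | hi'
      · rw [coreTuple_zero (show i.val = 0 by omega)] at hi
        exact h.mem_covering_left hi
      · rw [coreTuple_one (show i.val = 1 by omega)] at hi
        exact h.mem_covering_right hi
    · rw [coreTuple_layer hi2] at hi
      exact (h.layer_subset_coreBag hi).1
  · intro hu
    by_cases huX : u ∈ starCovering G w ord
    · rcases h.mem_or_mem huX with h1 | h1
      · exact ⟨⟨0, by omega⟩, by rwa [coreTuple_zero rfl]⟩
      · exact ⟨⟨1, by omega⟩, by rwa [coreTuple_one rfl]⟩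
    · obtain ⟨x, hx, hux⟩ := h.exists_mem_coreA hu huX
      obtain ⟨k, hk1, hkq, hk⟩ := exists_mem_layer (ℓ := ℓ) hq hx hux
      exact ⟨⟨k + 1, by omega⟩, by rwa [coreTuple_layer (show 2 ≤ k + 1 by omega)]⟩

theorem iteratedEvenSet_coreTuple : IteratedEvenSet G (coreTuple G w ord ℓ X₁ X₂ q) := by
  refine ⟨fun i j hij => ?_, fun i => ⟨fun u hu => ?_, fun u hu v hv huv => ?_⟩⟩
  · rcases lt_or_gt_of_ne hij with hlt | hlt
    · exact h.coreTuple_disjoint hlt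
    · exact (h.coreTuple_disjoint hlt).symm
  · simp only [Set.mem_compl_iff, Set.mem_iUnion, exists_prop, not_exists, not_and]
    exact fun j hj huj => Set.disjoint_left.1 (h.coreTuple_disjoint hj) huj hu
  · refine evenPair_of_indPath fun n p hp hS hp0 hpn => ?_
    have hn : 0 < n := Nat.pos_of_ne_zero (by
      rintro rfl
      exact huv (hp0.symm.trans hpn))
    have hX := h.noSep.even_of_bipartition h.pawFriendly h.ord_injective h.bipartition hp
    rw [← hp0] at hu
    rw [← hpn] at hv
    rcases Nat.lt_or_ge i.val 2 with hi | hi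
    · rcases Nat.lt_or_ge i.val 1 with hi' | hi'
      · rw [coreTuple_zero (show i.val = 0 by omega)] at hu hv
        exact hX (Or.inl ⟨hu, hv⟩)
      · rw [coreTuple_one (show i.val = 1 by omega)] at hu hv
        exact hX (Or.inr ⟨hu, hv⟩)
    · rw [coreTuple_layer hi] at hu hv
      refine h.even_of_layer hq hp hn hu hv fun j hj => ?_
      have hout := hS j hj
      simp only [Set.mem_compl_iff, Set.mem_iUnion, exists_prop, not_exists, not_and] at hout
      refine ⟨fun hc => ?_, fun k hk1 hk2 hc => ?_⟩
      · refine hout ⟨0, by omega⟩ (show 0 < i.val by omega) ?_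
        rwa [coreTuple_zero rfl]
      · refine hout ⟨k + 1, by omega⟩ (show k + 1 < i.val by omega) ?_
        rwa [coreTuple_layer (show 2 ≤ k + 1 by omega)]

theorem evenSetSeparator_coreTuple {δ K : ℕ} (hδ : ∀ v, {u | G.Adj v u}.ncard ≤ δ)
    (hK : δ ^ 2 + (δ + 1) ≤ K) {c : ℝ} (hc : 1 / 2 ≤ c) :
    EvenSetSeparator G w (q + 2) c K (coreTuple G w ord ℓ X₁ X₂ q) := by
  refine ⟨h.iteratedEvenSet_coreTuple hq, fun D hD => ?_⟩
  rw [h.iUnion_coreTuple hq] at hD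
  have := h.component_bounds hδ hD
  exact ⟨this.1.trans hK, this.2.trans hc⟩

end CoreSetup

theorem noLocalSeparator_of_not_exists {c : ℝ} (hc : 1 / 2 ≤ c) {d : ℕ} (hd : 3 ≤ d)
    (hw : ∀ v, 0 ≤ w v) (htot : ∑ v, w v = 1)
    (hno : ¬ ∃ Y, Bounded G d Y ∧ BalancedSeparator G w c Y) : NoLocalSeparator G w := by
  refine ⟨hw, htot, fun a Y hY => ?_⟩
  by_contra! hall
  exact hno ⟨Y, ⟨a, fun u hu => (hY u hu).trans (by exact_mod_cast hd)⟩,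
    fun D hD => (hall D hD).trans hc⟩

theorem le_sum_pow {δ m : ℕ} (hm : 3 ≤ m) :
    δ ^ 2 + (δ + 1) ≤ ∑ i ∈ Finset.range m, δ ^ i := by
  calc δ ^ 2 + (δ + 1) = ∑ i ∈ Finset.range 3, δ ^ i := by
        simp [Finset.sum_range_succ]; ring
    _ ≤ _ := Finset.sum_le_sum_of_subset (Finset.range_subset_range.2 hm)

/-- If no ball of radius three is balanced, then the star-free bag is bipartite, and the classes of
any bipartition of it and the layers form an even set separator. -/
theorem coreTuple_of_no_bounded_separator {c : ℝ} (hc : 1 / 2 ≤ c) {δ K : ℕ}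
    (hK : K = ∑ i ∈ Finset.range (δ + 4), δ ^ i) (hG : PawFriendly G)
    (hδ : ∀ v, {u | G.Adj v u}.ncard ≤ δ) (hs : NoLocalSeparator G w)
    (hord : Function.Injective ord) :
    (∃ X₁ X₂, IsBipartition G (starFreeBag G w ord) X₁ X₂) ∧
    (∃ ℓ, IsLinearExtension G w ord ℓ) ∧
    ∀ X₁ X₂, IsBipartition G (starFreeBag G w ord) X₁ X₂ →
    ∀ ℓ, IsLinearExtension G w ord ℓ →
      (⋃ i, coreTuple G w ord ℓ X₁ X₂ (δ ^ 2) i) = coreBag G w ord X₂ ∧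
      EvenSetSeparator G w (δ ^ 2 + 2) c K (coreTuple G w ord ℓ X₁ X₂ (δ ^ 2)) := by
  refine ⟨hs.exists_isBipartition hG hord, hs.exists_isLinearExtension hord, ?_⟩
  intro X₁ X₂ hX ℓ hℓ
  rw [hs.starFreeBag_eq hord] at hX
  have h : CoreSetup G w ord ℓ X₁ X₂ := ⟨hs, hG, hord, hX, hℓ⟩
  have hq : ∀ x ∈ X₁, (coreA G w ord X₂ x).ncard ≤ δ ^ 2 := fun x hx =>
    h.ncard_coreA_le hδ (h.mem_covering_left hx)
  exact ⟨h.iUnion_coreTuple hq,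
    h.evenSetSeparator_coreTuple hq hδ (hK ▸ le_sum_pow (by omega)) hc⟩

end Separator

/-! ### Programs: loops, counting phases and component labelling -/

section Machine

/-- The memory in which array `0` holds the registers `e` (in column `0`) and the other arrays
hold `M`. -/
def store (e : ℕ → ℕ) (M : ℕ → ℕ → ℕ → ℕ) : Memory :=
  fun a x y => if a = 0 then (if y = 0 then e x else 0) else M a x y

/-- Registers: the number of vertices and three loop counters. -/
def regs (n x y z : ℕ) : ℕ → ℕ
  | 0 => n
  | 1 => x
  | 2 => y
  | 3 => z
  | _ => 0

/-- Started with registers `e` and arrays `M`, the program halts within `T` steps with arrays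
satisfying `Q`, and it changes no registers but those with numbers from `c` to `3`. -/
def Exec (P : Program) (T c : ℕ) (e : ℕ → ℕ) (M : ℕ → ℕ → ℕ → ℕ)
    (Q : (ℕ → ℕ → ℕ → ℕ) → Prop) : Prop :=
  ∃ e' M' t, Runs P (store e M) (store e' M') t ∧ t ≤ T ∧
    (∀ x, x < c ∨ 3 < x → e' x = e x) ∧ Q M'

theorem Exec.mono {P : Program} {T T' c : ℕ} {e : ℕ → ℕ} {M : ℕ → ℕ → ℕ → ℕ}
    {Q Q' : (ℕ → ℕ → ℕ → ℕ) → Prop} (h : Exec P T c e M Q) (hT : T ≤ T')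
    (hQ : ∀ M', Q M' → Q' M') : Exec P T' c e M Q' := by
  obtain ⟨e', M', t, h1, h2, h3, h4⟩ := h
  exact ⟨e', M', t, h1, h2.trans hT, h3, hQ _ h4⟩

theorem Exec.seq {P P' : Program} {T T' c : ℕ} {e : ℕ → ℕ} {M : ℕ → ℕ → ℕ → ℕ}
    {Q Q' : (ℕ → ℕ → ℕ → ℕ) → Prop} (h : Exec P T c e M Q)
    (h' : ∀ e' M', (∀ x, x < c ∨ 3 < x → e' x = e x) → Q M' → Exec P' T' c e' M' Q') :
    Exec (.seq P P') (T + T') c e M Q' := by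
  obtain ⟨e₁, M₁, t₁, h1, h2, h3, h4⟩ := h
  obtain ⟨e₂, M₂, t₂, k1, k2, k3, k4⟩ := h' e₁ M₁ h3 h4
  exact ⟨e₂, M₂, _, .seq h1 k1, add_le_add h2 k2, fun x hx => (k3 x hx).trans (h3 x hx), k4⟩

/-- The register number `c`, as a term. -/
def reg (c : ℕ) : Term := .get 0 (.lit c) (.lit 0)

@[simp] theorem reg_val (c : ℕ) (e : ℕ → ℕ) (M : ℕ → ℕ → ℕ → ℕ) :
    (reg c).val (store e M) = e c := by
  simp [reg, Term.val, store]

theorem store_update_reg (c v : ℕ) (e : ℕ → ℕ) (M : ℕ → ℕ → ℕ → ℕ) :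
    (store e M).update 0 c 0 v = store (Function.update e c v) M := by
  funext a x y
  simp only [Memory.update, store, Function.update_apply]
  grind

/-- For `c`-th register from `0` to `n - 1` do `P`, where `n` is in register `0`. -/
def forLoop (c : ℕ) (P : Program) : Program :=
  .seq (.set 0 (.lit c) (.lit 0) (.lit 0))
    (.loop (.lt (reg c) (reg 0)) (.seq P (.set 0 (.lit c) (.lit 0) (.succ (reg c)))))

theorem Exec.forLoop {P : Program} {T c n : ℕ} {e : ℕ → ℕ} {M : ℕ → ℕ → ℕ → ℕ} (hc : 0 < c)
    (hc3 : c ≤ 3) (hn : e 0 = n) (Inv : ℕ → (ℕ → ℕ → ℕ → ℕ) → Prop) (h0 : Inv 0 M)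
    (hstep : ∀ i < n, ∀ e' M', (∀ x, x < c ∨ 3 < x → e' x = e x) → e' c = i → Inv i M' →
      Exec P T (c + 1) e' M' (Inv (i + 1))) :
    Exec (forLoop c P) (n * (T + 15) + 12) c e M (Inv n) := by
  have key : ∀ d i e' M', i + d = n → (∀ x, x < c ∨ 3 < x → e' x = e x) → e' c = i → Inv i M' →
      Exec (.loop (.lt (reg c) (reg 0)) (.seq P (.set 0 (.lit c) (.lit 0) (.succ (reg c)))))
        (d * (T + 15) + 8) c e' M' (Inv n) := by
    intro d
    induction d with
    | zero =>
      intro i e' M' hi he hci hI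
      refine ⟨e', M', _, .loop_done ?_, ?_, fun x _ => rfl, ?_⟩
      · simp only [Test.holds, reg_val, he 0 (Or.inl hc), hn, hci]
        omega
      · simp [Test.cost, reg, Term.cost]
      · rwa [show n = i by omega]
    | succ d ih =>
      intro i e' M' hi he hci hI
      obtain ⟨e₁, M₁, t₁, h1, h2, h3, h4⟩ := hstep i (by omega) e' M' he hci hI
      have hset := Runs.set (store e₁ M₁) 0 (.lit c) (.lit 0) (.succ (reg c))
      simp only [Term.val, reg_val] at hset
      rw [store_update_reg, h3 c (Or.inl (by omega)), hci] at hset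
      obtain ⟨e₂, M₂, t₂, k1, k2, k3, k4⟩ := ih (i + 1) (Function.update e₁ c (i + 1)) M₁
        (by omega) (fun x hx => by
          rw [Function.update_of_ne (by omega), h3 x (by omega), he x hx]) (by simp) h4
      refine ⟨e₂, M₂, _, .loop_step ?_ (.seq h1 hset) k1, ?_, fun x hx => ?_, k4⟩
      · simp only [Test.holds, reg_val, he 0 (Or.inl hc), hn, hci]
        omega
      · simp only [Test.cost, reg, Term.cost]
        rw [Nat.succ_mul]
        omega
      · rw [k3 x hx, Function.update_of_ne (by omega), h3 x (by omega)]
  have hset := Runs.set (store e M) 0 (.lit c) (.lit 0) (.lit 0)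
  simp only [Term.val] at hset
  rw [store_update_reg] at hset
  obtain ⟨e₂, M₂, t₂, k1, k2, k3, k4⟩ := key n 0 (Function.update e c 0) M (by omega)
    (fun x hx => Function.update_of_ne (by omega) _ _) (by simp) h0
  refine ⟨e₂, M₂, _, .seq hset k1, ?_, fun x hx => ?_, k4⟩
  · simp only [Term.cost]
    omega
  · rw [k3 x hx, Function.update_of_ne (by omega)]

theorem store_update (a i j v : ℕ) (ha : a ≠ 0) (e : ℕ → ℕ) (M : ℕ → ℕ → ℕ → ℕ) :
    (store e M).update a i j v = store e (Memory.update M a i j v) := by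
  funext a' x y
  simp only [Memory.update, store]
  grind

/-- If `b` then `a[i][j] := t`. -/
def setIf (b : Test) (a : ℕ) (i j t : Term) : Program := .ite b (.set a i j t) .skip

theorem Exec.setIf {b : Test} {a c : ℕ} {i j t : Term} {e : ℕ → ℕ} {M : ℕ → ℕ → ℕ → ℕ}
    {Q : (ℕ → ℕ → ℕ → ℕ) → Prop} {x y v : ℕ} (ha : a ≠ 0) (hi : i.val (store e M) = x)
    (hj : j.val (store e M) = y) (ht : t.val (store e M) = v)
    (hpos : b.holds (store e M) → Q (Memory.update M a x y v))
    (hneg : ¬ b.holds (store e M) → Q M) :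
    Exec (setIf b a i j t) (b.cost + i.cost + j.cost + t.cost + 2) c e M Q := by
  by_cases hb : b.holds (store e M)
  · have hset := Runs.set (store e M) a i j t
    rw [store_update _ _ _ _ ha, hi, hj, ht] at hset
    exact ⟨e, _, _, .ite_true hb hset, by omega, fun _ _ => rfl, hpos hb⟩
  · refine ⟨e, M, _, .ite_false hb (.skip _), ?_, fun _ _ => rfl, hneg hb⟩
    have : 1 ≤ i.cost := by cases i <;> simp [Term.cost]
    omega

/-- The arrays that a term reads have numbers less than `a`. -/
def Term.ReadsBelow (a : ℕ) : Term → Prop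
  | .lit _ => True
  | .get b i j => b < a ∧ i.ReadsBelow a ∧ j.ReadsBelow a
  | .succ t => t.ReadsBelow a
  | .pred t => t.ReadsBelow a

/-- The arrays that a test reads have numbers less than `a`. -/
def Test.ReadsBelow (a : ℕ) : Test → Prop
  | .lt s t => s.ReadsBelow a ∧ t.ReadsBelow a
  | .eq s t => s.ReadsBelow a ∧ t.ReadsBelow a
  | .not b => b.ReadsBelow a
  | .and b b' => b.ReadsBelow a ∧ b'.ReadsBelow a

theorem Term.val_congr {a : ℕ} {m m' : Memory} (hm : ∀ b < a, m b = m' b) {t : Term}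
    (ht : t.ReadsBelow a) : t.val m = t.val m' := by
  induction t with
  | lit c => rfl
  | get b i j hi hj => simp only [Term.val, hi ht.2.1, hj ht.2.2, hm b ht.1]
  | succ t ih => simp only [Term.val, ih ht]
  | pred t ih => simp only [Term.val, ih ht]

theorem Test.holds_congr {a : ℕ} {m m' : Memory} (hm : ∀ b < a, m b = m' b) {b : Test}
    (hb : b.ReadsBelow a) : b.holds m ↔ b.holds m' := by
  induction b with
  | lt s t => simp only [Test.holds, Term.val_congr hm hb.1, Term.val_congr hm hb.2]
  | eq s t => simp only [Test.holds, Term.val_congr hm hb.1, Term.val_congr hm hb.2]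
  | not b ih => simp only [Test.holds, ih hb]
  | and b b' ih ih' => simp only [Test.holds, ih hb.1, ih' hb.2]

theorem store_congr {a : ℕ} {e : ℕ → ℕ} {M M' : ℕ → ℕ → ℕ → ℕ} (h : ∀ b < a, M b = M' b) :
    ∀ b < a, store e M b = store e M' b := by
  intro b hb
  funext x y
  simp only [store, h b hb]

theorem eq_regs {e : ℕ → ℕ} (he : ∀ x, 3 < x → e x = 0) : e = regs (e 0) (e 1) (e 2) (e 3) := by
  funext x
  match x with
  | 0 | 1 | 2 | 3 => rfl
  | x + 4 => exact he _ (by omega)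

/-- The program `a[x][y] := #{z < n | b}`, for all `x, y < n`, where the loop counters `x, y, z`
are the registers `1, 2, 3`, and the entries of the array `a` are zero at the start. -/
def countPhase (a : ℕ) (b : Test) : Program :=
  forLoop 1 (forLoop 2 (forLoop 3 (setIf b a (reg 1) (reg 2) (.succ (.get a (reg 1) (reg 2))))))

open Classical in
theorem exec_countPhase {a n : ℕ} {b : Test} (ha : 0 < a) (hb : b.ReadsBelow a) {e : ℕ → ℕ}
    (hn : e 0 = n) (he : ∀ x, 3 < x → e x = 0) {M : ℕ → ℕ → ℕ → ℕ} (hM : M a = fun _ _ => 0) :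
    Exec (countPhase a b) (n * (n * (n * (b.cost + 31) + 27) + 27) + 12) 1 e M fun M' =>
      (∀ a' ≠ a, M' a' = M a') ∧ ∀ x < n, ∀ y < n,
        M' a x y = Nat.count (fun z => b.holds (store (regs n x y z) M')) n := by
  set cnt : ℕ → ℕ → ℕ → ℕ :=
    fun x y z => Nat.count (fun z => b.holds (store (regs n x y z) M)) z with hcnt
  have hmain : Exec (countPhase a b) (n * (n * (n * (b.cost + 31) + 27) + 27) + 12) 1 e M fun M' =>
      (∀ a' ≠ a, M' a' = M a') ∧ ∀ x y, M' a x y = if x < n ∧ y < n then cnt x y n else 0 := by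
    refine (Exec.forLoop (T := n * (n * (b.cost + 31) + 27) + 12) one_pos (by omega) hn
      (fun i M' => (∀ a' ≠ a, M' a' = M a') ∧
        ∀ x y, M' a x y = if x < i ∧ y < n then cnt x y n else 0)
      ⟨fun _ _ => rfl, by simp [hM]⟩ ?_).mono (by rfl) fun _ h => h
    rintro i hi e₁ M₁ he₁ rfl ⟨hf₁, hv₁⟩
    have hn₁ : e₁ 0 = n := by rw [he₁ 0 (by omega), hn]
    refine (Exec.forLoop (T := n * (b.cost + 31) + 12) two_pos (by omega) hn₁
      (fun j M' => (∀ a' ≠ a, M' a' = M a') ∧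
        ∀ x y, M' a x y = if (x < e₁ 1 ∧ y < n) ∨ (x = e₁ 1 ∧ y < j) then cnt x y n else 0)
      ⟨hf₁, fun x y => by simp [hv₁]⟩ ?_).mono (by rfl) ?_
    · rintro j hj e₂ M₂ he₂ rfl ⟨hf₂, hv₂⟩
      have hn₂ : e₂ 0 = n := by rw [he₂ 0 (by omega), hn₁]
      have h12 : e₂ 1 = e₁ 1 := he₂ 1 (by omega)
      refine (Exec.forLoop (T := b.cost + 16) three_pos le_rfl hn₂
        (fun k M' => (∀ a' ≠ a, M' a' = M a') ∧
          ∀ x y, M' a x y = if (x < e₁ 1 ∧ y < n) ∨ (x = e₁ 1 ∧ y < e₂ 2) then cnt x y n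
            else if x = e₁ 1 ∧ y = e₂ 2 then cnt x y k else 0)
        ⟨hf₂, fun x y => by simp [hv₂, hcnt]⟩ ?_).mono (by rfl) ?_
      · rintro k hk e₃ M₃ he₃ rfl ⟨hf₃, hv₃⟩
        have h13 : e₃ 1 = e₁ 1 := (he₃ 1 (by omega)).trans h12
        have h23 : e₃ 2 = e₂ 2 := he₃ 2 (by omega)
        have hreg : e₃ = regs n (e₁ 1) (e₂ 2) (e₃ 3) := by
          rw [← h13, ← h23, ← hn₂, ← he₃ 0 (by omega)]
          refine eq_regs fun x hx => ?_
          rw [he₃ x (Or.inr hx), he₂ x (Or.inr hx), he₁ x (Or.inr hx), he x hx]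
        have hholds : b.holds (store e₃ M₃) ↔
            b.holds (store (regs n (e₁ 1) (e₂ 2) (e₃ 3)) M) := by
          rw [← hreg]
          exact Test.holds_congr (store_congr fun c hc => hf₃ c (by omega)) hb
        have hget : Term.val (store e₃ M₃) (.succ (.get a (reg 1) (reg 2))) =
            cnt (e₁ 1) (e₂ 2) (e₃ 3) + 1 := by
          simp only [Term.val, reg_val]
          simp [store, ha.ne', hv₃, h13, h23]
        have hcs : cnt (e₁ 1) (e₂ 2) (e₃ 3 + 1) = if b.holds (store e₃ M₃) then
            cnt (e₁ 1) (e₂ 2) (e₃ 3) + 1 else cnt (e₁ 1) (e₂ 2) (e₃ 3) := by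
          simp only [hcnt, Nat.count_succ, hholds]
          split_ifs <;> rfl
        refine (Exec.setIf ha.ne' (reg_val _ _ _) (reg_val _ _ _) hget (fun hbh => ?_)
          (fun hbh => ?_)).mono (T := b.cost + (reg 1).cost + (reg 2).cost + _ + 2) ?_ fun _ h => h
        · rw [if_pos hbh] at hcs
          rw [h13, h23]
          refine ⟨fun a' ha' => ?_, fun x y => ?_⟩
          · rw [← hf₃ a' ha']
            funext x y
            simp [Memory.update, ha']
          · simp only [Memory.update, true_and, hv₃]
            by_cases hxy : x = e₁ 1 ∧ y = e₂ 2
            · obtain ⟨rfl, rfl⟩ := hxy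
              simp [hcs]
            · simp [hxy]
        · rw [if_neg hbh] at hcs
          refine ⟨hf₃, fun x y => ?_⟩
          rw [hv₃]
          by_cases hxy : x = e₁ 1 ∧ y = e₂ 2
          · obtain ⟨rfl, rfl⟩ := hxy
            simp [hcs]
          · simp [hxy]
        · simp [reg, Term.cost]
      · rintro M' ⟨hf, hv⟩
        refine ⟨hf, fun x y => ?_⟩
        rw [hv]
        split_ifs with h1 h2 h3 h3 <;> first | rfl | omega
    · rintro M' ⟨hf, hv⟩
      refine ⟨hf, fun x y => ?_⟩
      rw [hv]
      refine if_congr ?_ rfl rfl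
      omega
  refine hmain.mono le_rfl fun M' h => ⟨h.1, fun x hx y hy => ?_⟩
  rw [h.2, if_pos ⟨hx, hy⟩]
  simp only [hcnt]
  congr 1
  funext z
  exact propext (Test.holds_congr (store_congr fun c hc => (h.1 c (by omega)).symm) hb)

end Machine

section Labelling

/-- Reachability in the graph `A` restricted to the vertices in `S` below `t`. -/
def Linked (A : ℕ → ℕ → Prop) (S : ℕ → Prop) (t : ℕ) : ℕ → ℕ → Prop :=
  Relation.ReflTransGen fun x y => (x < t ∧ S x) ∧ (y < t ∧ S y) ∧ A x y

/-- `f` labels every vertex in `S` below `t` by the largest vertex of its component in the graph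
`A` restricted to these vertices. -/
def IsLabelling (A : ℕ → ℕ → Prop) (S : ℕ → Prop) (t : ℕ) (f : ℕ → ℕ) : Prop :=
  ∀ x < t, S x → f x < t ∧ S (f x) ∧ Linked A S t x (f x) ∧
    ∀ y < t, S y → Linked A S t x y → f y = f x ∧ y ≤ f x

variable {A : ℕ → ℕ → Prop} {S : ℕ → Prop} {t : ℕ} {f : ℕ → ℕ}

theorem Linked.mono {t' : ℕ} (h : t ≤ t') {x y : ℕ} (hxy : Linked A S t x y) :
    Linked A S t' x y :=
  Relation.ReflTransGen.mono (fun _ _ (h' : (_ < t ∧ _) ∧ (_ < t ∧ _) ∧ _) =>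
    ⟨⟨h'.1.1.trans_le h, h'.1.2⟩, ⟨h'.2.1.1.trans_le h, h'.2.1.2⟩, h'.2.2⟩) _ _ hxy

theorem Linked.symm (hA : ∀ x < t, ∀ y < t, A x y → A y x) {x y : ℕ} (h : Linked A S t x y) :
    Linked A S t y x := by
  induction h with
  | refl => exact .refl
  | tail _ hbc ih =>
    exact Relation.ReflTransGen.head ⟨hbc.2.1, hbc.1, hA _ hbc.1.1 _ hbc.2.1.1 hbc.2.2⟩ ih

theorem IsLabelling.eq_iff (hA : ∀ x < t, ∀ y < t, A x y → A y x) (hf : IsLabelling A S t f)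
    {x y : ℕ} (hx : x < t) (hSx : S x) (hy : y < t) (hSy : S y) :
    f x = f y ↔ Linked A S t x y := by
  constructor
  · intro h
    have h1 := (hf x hx hSx).2.2.1
    have h2 := (hf y hy hSy).2.2.1
    rw [← h] at h2
    exact h1.trans (h2.symm hA)
  · exact fun h => ((hf x hx hSx).2.2.2 y hy hSy h).1.symm

/-- Adding the vertex `t`: it becomes the label of the components that it is joined to. -/
theorem IsLabelling.step (hA : ∀ x < t + 1, ∀ y < t + 1, A x y → A y x)
    (hf : IsLabelling A S t f) {mark : ℕ → Prop}
    (hmark : ∀ l, mark l ↔ ∃ x < t, A t x ∧ S t ∧ S x ∧ f x = l) {g : ℕ → ℕ}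
    (hg : ∀ x, (x = t ∨ (x < t ∧ S x ∧ mark (f x)) → g x = t) ∧
      (¬ (x = t ∨ (x < t ∧ S x ∧ mark (f x))) → g x = f x)) :
    IsLabelling A S (t + 1) g := by
  have hA' : ∀ x < t, ∀ y < t, A x y → A y x := fun x hx y hy => hA x (by omega) y (by omega)
  have heq : ∀ x < t, S x → ∀ y < t, S y → (f x = f y ↔ Linked A S t x y) :=
    fun x hx hSx y hy hSy => hf.eq_iff hA' hx hSx hy hSy
  intro x hx hSx
  by_cases hN : x = t ∨ (x < t ∧ S x ∧ mark (f x))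
  · have hgx := (hg x).1 hN
    have hcl : ∀ y, Linked A S (t + 1) x y → y = t ∨ (y < t ∧ S y ∧ mark (f y)) := by
      intro y hxy
      induction hxy with
      | refl => exact hN
      | @tail b c _ hbc ih =>
        obtain ⟨⟨hb, hSb⟩, ⟨hc, hSc⟩, hbc⟩ := hbc
        rcases Nat.lt_succ_iff_lt_or_eq.1 hc with hc | rfl
        · refine Or.inr ⟨hc, hSc, ?_⟩
          rcases ih with rfl | ⟨hbt, -, hbm⟩
          · exact (hmark _).2 ⟨c, hc, hbc, hSb, hSc, rfl⟩
          · rwa [← (heq b hbt hSb c hc hSc).2 (.single ⟨⟨hbt, hSb⟩, ⟨hc, hSc⟩, hbc⟩)]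
        · exact Or.inl rfl
    rw [hgx]
    have hlink : S t ∧ Linked A S (t + 1) x t := by
      rcases hN with rfl | ⟨hxt, -, hm⟩
      · exact ⟨hSx, .refl⟩
      · obtain ⟨y, hy, hty, hSt, hSy, hfy⟩ := (hmark _).1 hm
        refine ⟨hSt, ?_⟩
        refine (((heq x hxt hSx y hy hSy).1 hfy.symm).mono (Nat.le_succ t)).tail ?_
        exact ⟨⟨by omega, hSy⟩, ⟨by omega, hSt⟩, hA _ (by omega) _ (by omega) hty⟩
    refine ⟨Nat.lt_succ_self t, hlink.1, hlink.2, fun y hy hSy hxy => ⟨?_, by omega⟩⟩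
    exact (hg y).1 (hcl y hxy)
  · have hgx := (hg x).2 hN
    have hxt : x < t := by
      by_contra hc
      exact hN (Or.inl (by omega))
    obtain ⟨h1, h2, h3, h4⟩ := hf x hxt hSx
    have hcl : ∀ y, Linked A S (t + 1) x y → y < t ∧ S y ∧ Linked A S t x y := by
      intro y hxy
      induction hxy with
      | refl => exact ⟨hxt, hSx, .refl⟩
      | @tail b c _ hbc ih =>
        obtain ⟨-, ⟨hc, hSc⟩, hAbc⟩ := hbc
        obtain ⟨hb, hSb, hxb⟩ := ih
        rcases Nat.lt_succ_iff_lt_or_eq.1 hc with hc | rfl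
        · exact ⟨hc, hSc, hxb.tail ⟨⟨hb, hSb⟩, ⟨hc, hSc⟩, hAbc⟩⟩
        · refine (hN (Or.inr ⟨hxt, hSx, (hmark _).2 ⟨b, hb, ?_, hSc, hSb, ?_⟩⟩)).elim
          · exact hA _ (by omega) _ (by omega) hAbc
          · exact ((heq x hxt hSx b hb hSb).2 hxb).symm
    rw [hgx]
    refine ⟨by omega, h2, h3.mono (Nat.le_succ t), fun y hy hSy hxy => ?_⟩
    obtain ⟨hyt, -, hxy'⟩ := hcl y hxy
    obtain ⟨h5, h6⟩ := h4 y hyt hSy hxy'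
    refine ⟨?_, h6⟩
    rw [(hg y).2, h5]
    rintro (rfl | ⟨-, -, hm⟩)
    · omega
    · exact hN (Or.inr ⟨hxt, hSx, h5 ▸ hm⟩)

/-- The entry `a[x][y]`, where `x` and `y` are held by two registers. -/
def entry (a c d : ℕ) : Term := .get a (reg c) (reg d)

@[simp] theorem entry_val {a : ℕ} (ha : a ≠ 0) (c d : ℕ) (e : ℕ → ℕ) (M : ℕ → ℕ → ℕ → ℕ) :
    (entry a c d).val (store e M) = M a (e c) (e d) := by
  simp only [entry, Term.val, reg_val]
  simp [store, ha]

/-- For every row `x`, the program labels the components of the graph with adjacency matrix `A`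
restricted to the vertices `y` with `S[x][y] = 0`. The vertices are added one by one. Adding the
vertex `u` marks the labels of the components joined to `u` (in the array `a + 1`, by `u + 1`),
and then changes these labels to `u` (in the array `a`). -/
def labelPhase (a A S : ℕ) : Program :=
  forLoop 1 (forLoop 2 (.seq
    (forLoop 3 (setIf
      (.and (.and (.lt (reg 3) (reg 2)) (.lt (.lit 0) (entry A 2 3)))
        (.and (.eq (entry S 1 2) (.lit 0)) (.eq (entry S 1 3) (.lit 0))))
      (a + 1) (reg 1) (entry a 1 3) (.succ (reg 2))))
    (forLoop 3 (setIf
      (.not (.and (.not (.eq (reg 3) (reg 2)))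
        (.not (.and (.and (.lt (reg 3) (reg 2)) (.eq (entry S 1 3) (.lit 0)))
          (.eq (.get (a + 1) (reg 1) (entry a 1 3)) (.succ (reg 2)))))))
      a (reg 1) (reg 3) (reg 2)))))

theorem exec_labelPhase {a A S n : ℕ} (hA : 0 < A) (hAa : A < a) (hS : 0 < S) (hSa : S < a)
    {e : ℕ → ℕ} (hn : e 0 = n) {M : ℕ → ℕ → ℕ → ℕ} (hM : M (a + 1) = fun _ _ => 0) :
    Exec (labelPhase a A S) (n * (n * (n * 200 + 100) + 100) + 100) 1 e M fun M' =>
      (∀ a', a' ≠ a → a' ≠ a + 1 → M' a' = M a') ∧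
      ∀ x < n, (∀ y < n, ∀ z < n, 0 < M A y z → 0 < M A z y) →
        IsLabelling (fun y z => 0 < M A y z) (fun y => M S x y = 0) n (M' a x) := by
  refine (Exec.forLoop (T := n * (n * 200 + 100) + 80) one_pos (by omega) hn
    (fun i M' => (∀ a', a' ≠ a → a' ≠ a + 1 → M' a' = M a') ∧ (∀ x < i,
        (∀ y < n, ∀ z < n, 0 < M A y z → 0 < M A z y) →
        IsLabelling (fun y z => 0 < M A y z) (fun y => M S x y = 0) n (M' a x)) ∧
        ∀ x, i ≤ x → ∀ y, M' (a + 1) x y = 0)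
    ⟨fun _ _ _ => rfl, by simp, by simp [hM]⟩ ?_).mono (by ring_nf; omega) fun _ h => ⟨h.1, h.2.1⟩
  rintro v hv e₁ M₁ he₁ rfl ⟨hf₁, hl₁, hm₁⟩
  have hn₁ : e₁ 0 = n := by rw [he₁ 0 (by omega), hn]
  refine (Exec.forLoop (T := n * 150 + 24) two_pos (by omega) hn₁
    (fun u M' => (∀ a', a' ≠ a → a' ≠ a + 1 → M' a' = M a') ∧
        (∀ x, x ≠ e₁ 1 → M' a x = M₁ a x ∧ M' (a + 1) x = M₁ (a + 1) x) ∧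
        ((∀ y < n, ∀ z < n, 0 < M A y z → 0 < M A z y) →
          IsLabelling (fun y z => 0 < M A y z) (fun y => M S (e₁ 1) y = 0) u (M' a (e₁ 1))) ∧
        ∀ y, M' (a + 1) (e₁ 1) y ≤ u)
    ⟨hf₁, fun _ _ => ⟨rfl, rfl⟩, fun _ x hx => by omega, fun y => (hm₁ _ le_rfl y).le⟩ ?_).mono
    (by ring_nf; omega) ?_
  swap
  · rintro M' ⟨h1, h2, h3, -⟩
    refine ⟨h1, fun x hx => ?_, fun x hx y => ?_⟩
    · rcases Nat.lt_succ_iff_lt_or_eq.1 hx with hx | rfl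
      · rw [(h2 x (by omega)).1]
        exact hl₁ x hx
      · exact h3
    · rw [(h2 x (by omega)).2]
      exact hm₁ x (by omega) y
  rintro u hu e₂ M₂ he₂ rfl ⟨hf₂, hr₂, hl₂, hm₂⟩
  have hn₂ : e₂ 0 = n := by rw [he₂ 0 (by omega), hn₁]
  have h12 : e₂ 1 = e₁ 1 := he₂ 1 (by omega)
  generalize hvv : e₁ 1 = v at *
  generalize huu : e₂ 2 = u at *
  have hAne : A ≠ a ∧ A ≠ a + 1 ∧ A ≠ 0 := by omega
  have hSne : S ≠ a ∧ S ≠ a + 1 ∧ S ≠ 0 := by omega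
  -- The marks after the first inner loop.
  refine (Exec.seq (T := n * 75 + 12) (T' := n * 75 + 12)
    (Q := fun M' => (∀ a', a' ≠ a + 1 → M' a' = M₂ a') ∧
      (∀ x, x ≠ v → M' (a + 1) x = M₂ (a + 1) x) ∧ (∀ y, M' (a + 1) v y ≤ u + 1) ∧
      ∀ l, M' (a + 1) v l = u + 1 ↔ ∃ z < n, z < u ∧ 0 < M A u z ∧ M S v u = 0 ∧
        M S v z = 0 ∧ M₂ a v z = l) ?_ ?_).mono (by omega) fun _ h => h
  · refine (Exec.forLoop (T := 60) three_pos le_rfl hn₂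
      (fun w M' => (∀ a', a' ≠ a + 1 → M' a' = M₂ a') ∧
        (∀ x, x ≠ v → M' (a + 1) x = M₂ (a + 1) x) ∧ (∀ y, M' (a + 1) v y ≤ u + 1) ∧
        ∀ l, M' (a + 1) v l = u + 1 ↔ ∃ z < w, z < u ∧ 0 < M A u z ∧ M S v u = 0 ∧
          M S v z = 0 ∧ M₂ a v z = l)
      ⟨fun _ _ => rfl, fun _ _ => rfl, fun y => (hm₂ y).trans (by omega), fun l => ?_⟩ ?_).mono
      (by omega) fun _ h => h
    · have := hm₂ l
      constructor
      · intro h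
        omega
      · rintro ⟨z, hz, -⟩
        omega
    rintro w hw e₃ M₃ he₃ rfl ⟨hf₃, hr₃, hb₃, hm₃⟩
    have h13 : e₃ 1 = v := (he₃ 1 (by omega)).trans h12
    have h23 : e₃ 2 = u := (he₃ 2 (by omega)).trans huu
    have hholds := @Iff.rfl (Test.holds (store e₃ M₃)
      (.and (.and (.lt (reg 3) (reg 2)) (.lt (.lit 0) (entry A 2 3)))
        (.and (.eq (entry S 1 2) (.lit 0)) (.eq (entry S 1 3) (.lit 0)))))
    conv_rhs at hholds =>
      simp only [Test.holds, reg_val, entry_val hAne.2.2, entry_val hSne.2.2, Term.val, h13, h23,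
        hf₃ A hAne.2.1, hf₃ S hSne.2.1, hf₂ A hAne.1 hAne.2.1, hf₂ S hSne.1 hSne.2.1]
    refine (Exec.setIf (x := v) (y := M₂ a v (e₃ 3)) (v := u + 1) (by omega) (by simp [h13])
      (by rw [entry_val (by omega), h13, hf₃ a (by omega)]) (by simp [Term.val, h23])
      (fun hcond => ?_) (fun hcond => ?_)).mono (T := _ + (reg 1).cost + _ + _ + 2)
      (by simp [Test.cost, entry, reg, Term.cost]) fun _ h => h <;> rw [hholds] at hcond
    · refine ⟨fun a' ha' => ?_, fun x hx => ?_, fun y => ?_, fun l => ?_⟩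
      · rw [← hf₃ a' ha']
        funext x y
        simp [Memory.update, ha']
      · rw [← hr₃ x hx]
        funext y
        simp [Memory.update, hx]
      · have := hb₃ y
        simp only [Memory.update, true_and]
        split_ifs <;> omega
      · simp only [Memory.update, true_and]
        constructor
        · intro h
          split_ifs at h with hl
          · exact ⟨e₃ 3, by omega, hcond.1.1, hcond.1.2, hcond.2.1, hcond.2.2, hl.symm⟩
          · obtain ⟨z, hz, h'⟩ := (hm₃ l).1 h
            exact ⟨z, by omega, h'⟩
        · rintro ⟨z, hz, h'⟩
          split_ifs with hl
          · rfl
          · refine (hm₃ l).2 ⟨z, ?_, h'⟩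
            rcases Nat.lt_succ_iff_lt_or_eq.1 hz with hz | rfl
            · exact hz
            · exact (hl h'.2.2.2.2.symm).elim
    · refine ⟨hf₃, hr₃, hb₃, fun l => (hm₃ l).trans ⟨?_, ?_⟩⟩
      · rintro ⟨z, hz, h'⟩
        exact ⟨z, by omega, h'⟩
      · rintro ⟨z, hz, h'⟩
        refine ⟨z, ?_, h'⟩
        rcases Nat.lt_succ_iff_lt_or_eq.1 hz with hz | rfl
        · exact hz
        · exact (hcond ⟨⟨h'.1, h'.2.1⟩, h'.2.2.1, h'.2.2.2.1⟩).elim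
  rintro e₃ M₃ he₃ ⟨hf₃, hr₃, hb₃, hm₃⟩
  have hn₃ : e₃ 0 = n := by rw [he₃ 0 (by omega), hn₂]
  have hwS : ∀ w, w < u → w < n := fun w hw => by omega
  -- The labels after the second inner loop.
  refine (Exec.forLoop (T := 60) three_pos le_rfl hn₃
    (fun w M' => (∀ a', a' ≠ a → M' a' = M₃ a') ∧ (∀ x, x ≠ v → M' a x = M₃ a x) ∧
      ∀ y, ((y < w ∧ (y = u ∨ (y < u ∧ M S v y = 0 ∧ M₃ (a + 1) v (M₃ a v y) = u + 1))) →
          M' a v y = u) ∧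
        (¬ (y < w ∧ (y = u ∨ (y < u ∧ M S v y = 0 ∧ M₃ (a + 1) v (M₃ a v y) = u + 1))) →
          M' a v y = M₃ a v y))
    ⟨fun _ _ => rfl, fun _ _ => rfl, fun y => ⟨by omega, fun _ => rfl⟩⟩ ?_).mono (by omega) ?_
  · rintro w hw e₄ M₄ he₄ rfl ⟨hf₄, hr₄, hv₄⟩
    have h14 : e₄ 1 = v := (he₄ 1 (by omega)).trans ((he₃ 1 (by omega)).trans h12)
    have h24 : e₄ 2 = u := (he₄ 2 (by omega)).trans ((he₃ 2 (by omega)).trans huu)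
    have hcur : M₄ a v (e₄ 3) = M₃ a v (e₄ 3) := (hv₄ _).2 (by omega)
    have hget : Term.val (store e₄ M₄) (.get (a + 1) (reg 1) (entry a 1 3)) =
        M₃ (a + 1) v (M₃ a v (e₄ 3)) := by
      simp only [Term.val, reg_val, entry_val (show a ≠ 0 by omega), h14, hcur]
      simp [store, hf₄ (a + 1) (by omega)]
    have hSv : (entry S 1 3).val (store e₄ M₄) = M S v (e₄ 3) := by
      rw [entry_val hSne.2.2, h14, hf₄ S hSne.1, hf₃ S hSne.2.1, hf₂ S hSne.1 hSne.2.1]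
    have hholds := @Iff.rfl (Test.holds (store e₄ M₄)
      (.not (.and (.not (.eq (reg 3) (reg 2)))
        (.not (.and (.and (.lt (reg 3) (reg 2)) (.eq (entry S 1 3) (.lit 0)))
          (.eq (.get (a + 1) (reg 1) (entry a 1 3)) (.succ (reg 2))))))))
    conv_rhs at hholds =>
      simp only [Test.holds, hget, hSv]
      simp only [Term.val, reg_val, h24]
    refine (Exec.setIf (x := v) (y := e₄ 3) (v := u) (by omega) (by simp [h14])
      (by simp) (by simp [h24])
      (fun hcond => ?_) (fun hcond => ?_)).mono (T := _ + (reg 1).cost + _ + _ + 2)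
      (by simp [Test.cost, entry, reg, Term.cost]) fun _ h => h <;> rw [hholds] at hcond
    · refine ⟨fun a' ha' => ?_, fun x hx => ?_, fun y => ?_⟩
      · rw [← hf₄ a' ha']
        funext x y
        simp [Memory.update, ha']
      · rw [← hr₄ x hx]
        funext y
        simp [Memory.update, hx]
      · simp only [Memory.update, true_and]
        by_cases hy : y = e₄ 3
        · subst hy
          rw [if_pos rfl]
          exact ⟨fun _ => rfl, fun h => (h ⟨by omega, by tauto⟩).elim⟩
        · rw [if_neg hy, show (y < e₄ 3 + 1) ↔ y < e₄ 3 by omega]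
          exact hv₄ y
    · refine ⟨hf₄, hr₄, fun y => ?_⟩
      by_cases hy : y = e₄ 3
      · subst hy
        exact ⟨fun h => (hcond (by tauto)).elim, fun _ => hcur⟩
      · rw [show (y < e₄ 3 + 1) ↔ y < e₄ 3 by omega]
        exact hv₄ y
  · rintro M' ⟨hf', hr', hv'⟩
    have hM₃a : M₃ a = M₂ a := hf₃ a (by omega)
    refine ⟨fun a' h1 h2 => ?_, fun x hx => ⟨?_, ?_⟩, ?_, fun y => ?_⟩
    · rw [hf' a' h1, hf₃ a' h2, hf₂ a' h1 h2]
    · rw [hr' x hx, hM₃a, (hr₂ x hx).1]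
    · rw [hf' (a + 1) (by omega), hr₃ x hx, (hr₂ x hx).2]
    · intro hsymm
      refine IsLabelling.step (fun x hx y hy => hsymm x (by omega) y (by omega)) (hl₂ hsymm)
        (mark := fun l => M₃ (a + 1) v l = u + 1) (fun l => ?_) fun x => ?_
      · rw [hm₃ l]
        constructor
        · rintro ⟨z, -, h1, h2, h3, h4, h5⟩
          exact ⟨z, h1, h2, h3, h4, h5⟩
        · rintro ⟨z, h1, h2, h3, h4, h5⟩
          exact ⟨z, by omega, h1, h2, h3, h4, h5⟩
      · have := hv' x
        rw [hM₃a] at this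
        refine ⟨fun h => this.1 ⟨by omega, h⟩, fun h => this.2 fun h' => h h'.2⟩
    · rw [hf' (a + 1) (by omega)]
      exact hb₃ y

end Labelling

section Phases

/-- One phase of a program without data-dependent control flow. Phase number `r` fills the array
`2 * r` (and possibly uses the array `2 * r + 1`); it reads only earlier arrays. -/
inductive Phase where
  | count (b : Test)
  | label (A S : ℕ)

/-- The program of a phase. -/
def Phase.program (r : ℕ) : Phase → Program
  | .count b => countPhase (2 * r) b
  | .label A S => labelPhase (2 * r) A S

/-- Phase number `r` reads only arrays that were filled before. -/
def Phase.WellFormed (r : ℕ) : Phase → Prop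
  | .count b => b.ReadsBelow (2 * r)
  | .label A S => (0 < A ∧ A < 2 * r) ∧ 0 < S ∧ S < 2 * r

/-- The defining equations of the array that phase number `r` fills. -/
def Phase.Holds (n : ℕ) (M : ℕ → ℕ → ℕ → ℕ) (r : ℕ) : Phase → Prop
  | .count b => ∀ x < n, ∀ y < n,
      M (2 * r) x y = {z : Fin n | b.holds (store (regs n x y z) M)}.ncard
  | .label A S => ∀ x < n, (∀ y < n, ∀ z < n, 0 < M A y z → 0 < M A z y) →
      IsLabelling (fun y z => 0 < M A y z) (fun y => M S x y = 0) n (M (2 * r) x)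

/-- A factor `C` such that the phase takes at most `C n ^ 3` steps. -/
def Phase.factor : Phase → ℕ
  | .count b => b.cost + 97
  | .label _ _ => 500

/-- The program that executes a list of phases, with numbers from `r` on. -/
def phasesProgram : ℕ → List Phase → Program
  | _, [] => .skip
  | r, p :: ps => .seq (p.program r) (phasesProgram (r + 1) ps)

theorem count_eq_ncard (n : ℕ) (p : ℕ → Prop) [DecidablePred p] :
    Nat.count p n = {z : Fin n | p z}.ncard := by
  rw [Nat.count_eq_card_filter_range, ← Set.ncard_coe_finset]
  refine (Set.ncard_congr (fun (z : Fin n) _ => (z : ℕ)) ?_ ?_ ?_).symm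
  · intro z hz
    simpa using hz
  · intro z z' _ _ h
    exact Fin.ext h
  · intro z hz
    simp only [Finset.coe_filter, Finset.mem_range, Set.mem_ofPred_eq] at hz
    exact ⟨⟨z, hz.1⟩, hz.2, rfl⟩

theorem Phase.exec {p : Phase} {r n : ℕ} (hp : p.WellFormed r) (hr : 0 < r) (hn0 : 0 < n)
    {e : ℕ → ℕ} (hn : e 0 = n) (he : ∀ x, 3 < x → e x = 0) {M : ℕ → ℕ → ℕ → ℕ}
    (hM : ∀ a, 2 * r ≤ a → M a = fun _ _ => 0) :
    Exec (p.program r) (p.factor * n ^ 3) 1 e M fun M' =>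
      (∀ a, a ≠ 2 * r → a ≠ 2 * r + 1 → M' a = M a) ∧ p.Holds n M' r := by
  have h1 : n ≤ n ^ 3 := Nat.le_self_pow (by norm_num) n
  have h2 : n ^ 2 ≤ n ^ 3 := Nat.pow_le_pow_right hn0 (by norm_num)
  have h3 : 1 ≤ n ^ 3 := Nat.one_le_pow _ _ hn0
  cases p with
  | count b =>
    refine (exec_countPhase (by omega) hp hn he (hM _ le_rfl)).mono ?_ fun M' h =>
      ⟨fun a ha _ => h.1 a ha, fun x hx y hy => ?_⟩
    · simp only [Phase.factor]
      ring_nf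
      nlinarith [h1, h2, h3]
    · rw [h.2 x hx y hy, count_eq_ncard]
  | label A S =>
    obtain ⟨⟨hA, hA'⟩, hS, hS'⟩ := hp
    refine (exec_labelPhase hA hA' hS hS' hn (hM _ (by omega))).mono ?_ fun M' h =>
      ⟨h.1, fun x hx => ?_⟩
    · simp only [Phase.factor]
      ring_nf
      nlinarith [h1, h2, h3]
    · rw [h.1 A (by omega) (by omega), h.1 S (by omega) (by omega)]
      exact h.2 x hx

theorem Phase.Holds.congr {p : Phase} {r n : ℕ} (hp : p.WellFormed r) {M M' : ℕ → ℕ → ℕ → ℕ}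
    (h : ∀ a < 2 * r + 2, M' a = M a) (hM : p.Holds n M r) : p.Holds n M' r := by
  cases p with
  | count b =>
    intro x hx y hy
    rw [h _ (by omega), hM x hx y hy]
    congr 1
    ext z
    exact Test.holds_congr (store_congr fun a ha => (h a (by omega)).symm) hp
  | label A S =>
    obtain ⟨⟨hA, hA'⟩, hS, hS'⟩ := hp
    intro x hx
    rw [h A (by omega), h S (by omega), h (2 * r) (by omega)]
    exact hM x hx

/-- After the execution of a list of phases, the defining equations of all phases hold. -/
theorem exec_phases {n : ℕ} (hn0 : 0 < n) (ps : List Phase) {r : ℕ} (hr : 0 < r)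
    (hps : ∀ i (hi : i < ps.length), ps[i].WellFormed (r + i))
    {e : ℕ → ℕ} (hn : e 0 = n) (he : ∀ x, 3 < x → e x = 0) {M : ℕ → ℕ → ℕ → ℕ}
    (hM : ∀ a, 2 * r ≤ a → M a = fun _ _ => 0) :
    Exec (phasesProgram r ps) (((ps.map Phase.factor).sum + 1) * n ^ 3) 1 e M fun M' =>
      (∀ a < 2 * r, M' a = M a) ∧
      ∀ i (hi : i < ps.length), ps[i].Holds n M' (r + i) := by
  induction ps generalizing r e M with
  | nil =>
    exact ⟨e, M, _, .skip _, by simpa using Nat.one_le_pow _ _ hn0, fun _ _ => rfl,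
      fun _ _ => rfl, fun i hi => by simp at hi⟩
  | cons p ps ih =>
    have hp : p.WellFormed r := hps 0 (by simp)
    refine (Exec.seq (Phase.exec hp hr hn0 hn he hM)
      (T' := ((ps.map Phase.factor).sum + 1) * n ^ 3) (Q' := fun M' => (∀ a < 2 * r, M' a = M a) ∧
      ∀ i (hi : i < (p :: ps).length), (p :: ps)[i].Holds n M' (r + i)) ?_).mono ?_ fun _ h => h
    · rintro e₁ M₁ he₁ ⟨hf₁, hh₁⟩
      refine (ih (r := r + 1) (by omega) (fun i hi => ?_) ((he₁ 0 (by omega)).trans hn)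
        (fun x hx => (he₁ x (by omega)).trans (he x hx)) (fun a ha => ?_)).mono le_rfl ?_
      · have := hps (i + 1) (by simpa using hi)
        rwa [show r + (i + 1) = r + 1 + i by omega] at this
      · rw [hf₁ a (by omega) (by omega)]
        exact hM a (by omega)
      · rintro M' ⟨hf, hh⟩
        refine ⟨fun a ha => ?_, fun i hi => ?_⟩
        · rw [hf a (by omega), hf₁ a (by omega) (by omega)]
        · cases i with
          | zero => exact Phase.Holds.congr hp (fun a ha => hf a (by omega)) hh₁
          | succ i =>
            have := hh i (by simpa using hi)
            rwa [show r + 1 + i = r + (i + 1) by omega] at this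
    · simp only [List.map_cons, List.sum_cons]
      ring_nf
      rfl

/-- Copy the diagonal of the array `a` to column `0` of the output array `3`. -/
def outputProgram (a : ℕ) : Program :=
  forLoop 1 (.set 3 (reg 1) (.lit 0) (entry a 1 1))

theorem exec_outputProgram {n a : ℕ} (ha : a ≠ 0) (ha3 : a ≠ 3) {e : ℕ → ℕ} (hn : e 0 = n)
    {M : ℕ → ℕ → ℕ → ℕ} :
    Exec (outputProgram a) (n * 27 + 12) 1 e M fun M' => ∀ x < n, M' 3 x 0 = M a x x := by
  refine (Exec.forLoop (T := 12) one_pos (by omega) hn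
    (fun i M' => M' a = M a ∧ ∀ x < i, M' 3 x 0 = M a x x) ⟨rfl, by simp⟩ ?_).mono le_rfl
    fun _ h => h.2
  rintro i hi e₁ M₁ he₁ rfl ⟨hf, hv⟩
  have hset := Runs.set (store e₁ M₁) 3 (reg 1) (.lit 0) (entry a 1 1)
  rw [store_update _ _ _ _ (by norm_num)] at hset
  refine ⟨e₁, _, _, hset, by simp [reg, entry, Term.cost], fun _ _ => rfl, ?_, fun x hx => ?_⟩
  · rw [← hf]
    funext x y
    simp [Memory.update, ha3]
  · simp only [Memory.update, reg_val, entry_val ha, Term.val, hf, true_and, and_true]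
    split_ifs with h
    · rw [h]
    · exact hv x (by omega)

end Phases

/-! ### Components, balls, bipartitions and layers in terms of labels and counts -/

section Reading

variable {n : ℕ}

/-- Reachability in the relation `R` restricted to the set `T`. -/
def LinkedIn {V : Type*} (R : V → V → Prop) (T : Set V) : V → V → Prop :=
  Relation.ReflTransGen fun x y => x ∈ T ∧ y ∈ T ∧ R x y

theorem LinkedIn.mem {V : Type*} {R : V → V → Prop} {T : Set V} {x y : V}
    (h : LinkedIn R T x y) (hx : x ∈ T) : y ∈ T := by
  cases h with
  | refl => exact hx
  | tail _ hbc => exact hbc.2.1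

theorem LinkedIn.symm {V : Type*} {R : V → V → Prop} (hR : ∀ x y, R x y → R y x) {T : Set V}
    {x y : V} (h : LinkedIn R T x y) : LinkedIn R T y x := by
  induction h with
  | refl => exact .refl
  | tail _ hbc ih => exact Relation.ReflTransGen.head ⟨hbc.2.1, hbc.1, hR _ _ hbc.2.2⟩ ih

theorem linked_iff_linkedIn {A : ℕ → ℕ → Prop} {S : ℕ → Prop} {R : Fin n → Fin n → Prop}
    {T : Set (Fin n)} (hA : ∀ x y : Fin n, A x y ↔ R x y) (hS : ∀ x : Fin n, S x ↔ x ∈ T)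
    {x y : Fin n} : Linked A S n x y ↔ LinkedIn R T x y := by
  constructor
  · intro h
    have key : ∀ m : ℕ, Linked A S n x m → ∀ hm : m < n, LinkedIn R T x ⟨m, hm⟩ := by
      intro m hxm
      induction hxm with
      | refl => exact fun _ => .refl
      | @tail b c _ hbc ih =>
        intro hm
        obtain ⟨⟨hb, hSb⟩, ⟨hc, hSc⟩, hbc⟩ := hbc
        exact (ih hb).tail ⟨(hS ⟨b, hb⟩).1 hSb, (hS ⟨c, hc⟩).1 hSc,
          (hA ⟨b, hb⟩ ⟨c, hc⟩).1 hbc⟩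
    exact key y h y.2
  · intro h
    induction h with
    | refl => exact .refl
    | @tail b c _ hbc ih =>
      exact ih.tail ⟨⟨b.2, (hS b).2 hbc.1⟩, ⟨c.2, (hS c).2 hbc.2.1⟩, (hA b c).2 hbc.2.2⟩

/-- The label of a vertex is the largest vertex of its component. -/
theorem IsLabelling.exists_label {A : ℕ → ℕ → Prop} {S : ℕ → Prop} {f : ℕ → ℕ}
    {R : Fin n → Fin n → Prop} {T : Set (Fin n)} (hf : IsLabelling A S n f)
    (hA : ∀ x y : Fin n, A x y ↔ R x y) (hS : ∀ x : Fin n, S x ↔ x ∈ T) {x : Fin n} (hx : x ∈ T) :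
    ∃ t : Fin n, f x = t ∧ LinkedIn R T x t ∧ ∀ y, LinkedIn R T x y → f y = t ∧ y ≤ t := by
  obtain ⟨h1, h2, h3, h4⟩ := hf x x.2 ((hS x).2 hx)
  refine ⟨⟨f x, h1⟩, rfl, (linked_iff_linkedIn hA hS).1 h3, fun y hy => ?_⟩
  exact h4 y y.2 ((hS y).2 (hy.mem hx)) ((linked_iff_linkedIn hA hS).2 hy)

theorem IsComponent.mem_iff_linkedIn {V : Type*} {G : SimpleGraph V} {T D : Set V}
    (hD : IsComponent G T D) {x y : V} (hx : x ∈ D) : y ∈ D ↔ LinkedIn G.Adj T x y := by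
  constructor
  · intro hy
    refine hD.connectedSet {u | LinkedIn G.Adj T x u} ⟨x, hx, .refl⟩ ?_ hy
    exact fun a ha hxa b hb hab => hxa.tail ⟨hD.subset ha, hD.subset hb, hab⟩
  · intro h
    induction h with
    | refl => exact hx
    | tail _ hbc ih => exact hD.mem_of_adj ih hbc.2.1 hbc.2.2

theorem IsComponent.mem_iff_label {G : SimpleGraph (Fin n)} {T D : Set (Fin n)}
    (hD : IsComponent G T D) {A : ℕ → ℕ → Prop} {S : ℕ → Prop} {f : ℕ → ℕ}
    (hf : IsLabelling A S n f) (hA : ∀ x y : Fin n, A x y ↔ G.Adj x y)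
    (hS : ∀ x : Fin n, S x ↔ x ∈ T) {x y : Fin n} (hx : x ∈ D) :
    y ∈ D ↔ y ∈ T ∧ f y = f x := by
  obtain ⟨t, h1, h2, h3⟩ := hf.exists_label hA hS (hD.subset hx)
  constructor
  · intro hy
    refine ⟨hD.subset hy, ?_⟩
    rw [h1]
    exact (h3 y ((hD.mem_iff_linkedIn hx).1 hy)).1
  · rintro ⟨hy, hxy⟩
    obtain ⟨t', k1, k2, -⟩ := hf.exists_label hA hS hy
    obtain rfl : t' = t := Fin.ext (by rw [← k1, ← h1, hxy])
    exact (hD.mem_iff_linkedIn hx).2 (h2.trans (k2.symm fun _ _ h => h.symm))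

theorem half_lt_weight_uniformWeight {X : Finset (Fin n)} {D : Set (Fin n)} :
    1 / 2 < weight (uniformWeight X) D ↔
      {u | u ∈ X ∧ u ∉ D}.ncard < {u | u ∈ X ∧ u ∈ D}.ncard := by
  classical
  have h1 : {u | u ∈ X ∧ u ∈ D} = ↑(X.filter (· ∈ D)) := by
    ext; simp
  have h2 : {u | u ∈ X ∧ u ∉ D} = ↑(X.filter (· ∉ D)) := by
    ext; simp
  have hw : weight (uniformWeight X) D = (X.filter (· ∈ D)).card * (1 / (X.card : ℝ)) := by
    rw [weight, ← nsmul_eq_mul, ← Finset.sum_const, ← Finset.sum_subset (Finset.subset_univ _)]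
    · refine Finset.sum_congr rfl fun v hv => ?_
      rw [Finset.mem_filter] at hv
      rw [Set.indicator_of_mem hv.2, uniformWeight, if_pos hv.1]
    · intro v _ hv
      rw [Finset.mem_filter, not_and] at hv
      by_cases hvD : v ∈ D
      · rw [Set.indicator_of_mem hvD, uniformWeight, if_neg fun h => hv h hvD]
      · rw [Set.indicator_of_notMem hvD]
  rw [h1, h2, Set.ncard_coe_finset, Set.ncard_coe_finset, hw]
  have hcard := Finset.card_filter_add_card_filter_not (s := X) (· ∈ D)
  rcases Nat.eq_zero_or_pos X.card with h0 | h0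
  · have : (X.filter (· ∈ D)).card = 0 := by omega
    simp only [this]
    norm_num
  · have h0' : (0 : ℝ) < X.card := by exact_mod_cast h0
    rw [mul_one_div, div_lt_div_iff₀ two_pos h0', one_mul, ← hcard]
    push_cast
    rw [← Nat.cast_lt (α := ℝ)]
    constructor <;> intro h <;> linarith

theorem uniformWeight_nonneg (X : Finset (Fin n)) (v : Fin n) : 0 ≤ uniformWeight X v := by
  unfold uniformWeight
  split_ifs <;> positivity

theorem sum_uniformWeight {X : Finset (Fin n)} (hX : X.Nonempty) :
    ∑ v, uniformWeight X v = 1 := by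
  have : (X.card : ℝ) ≠ 0 := by exact_mod_cast hX.card_pos.ne'
  simp [uniformWeight, Finset.sum_ite_mem, this]

/-- Whether a vertex lies in a component of more than half of the weight can be read off from
component labels by counting. -/
theorem heavy_iff {G : SimpleGraph (Fin n)} {T : Set (Fin n)} {X : Finset (Fin n)}
    {A : ℕ → ℕ → Prop} {S : ℕ → Prop} {f : ℕ → ℕ} (hf : IsLabelling A S n f)
    (hA : ∀ x y : Fin n, A x y ↔ G.Adj x y) (hS : ∀ x : Fin n, S x ↔ x ∈ T) {z : Fin n} :
    (z ∈ T ∧ {u | u ∈ X ∧ ¬ (u ∈ T ∧ f u = f z)}.ncard < {u | u ∈ X ∧ u ∈ T ∧ f u = f z}.ncard) ↔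
      ∃ D, IsComponent G T D ∧ z ∈ D ∧ 1 / 2 < weight (uniformWeight X) D := by
  constructor
  · rintro ⟨hz, hlt⟩
    obtain ⟨D, hD, hzD⟩ := exists_isComponent (G := G) hz
    refine ⟨D, hD, hzD, half_lt_weight_uniformWeight.2 ?_⟩
    simpa only [hD.mem_iff_label hf hA hS hzD] using hlt
  · rintro ⟨D, hD, hzD, hw⟩
    refine ⟨hD.subset hzD, ?_⟩
    simpa only [hD.mem_iff_label hf hA hS hzD] using half_lt_weight_uniformWeight.1 hw

theorem edist_le_succ {V : Type*} {G : SimpleGraph V} {a u : V} {k : ℕ}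
    (h : G.edist a u ≤ (k + 1 : ℕ)) : u = a ∨ ∃ v, G.edist a v ≤ k ∧ G.Adj v u := by
  by_cases hua : u = a
  · exact Or.inl hua
  · right
    have hne : G.edist a u ≠ ⊤ := ne_top_of_le_ne_top (ENat.natCast_ne_top _) h
    obtain ⟨p, hp⟩ := SimpleGraph.exists_walk_of_edist_ne_top hne
    obtain ⟨v, hvu, q, hq⟩ : ∃ v, ∃ _ : G.Adj v u, ∃ q : G.Walk a v, p.length = q.length + 1 := by
      cases hr : p.reverse with
      | nil => exact absurd rfl hua
      | @cons _ v _ hadj q =>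
        refine ⟨v, hadj.symm, q.reverse, ?_⟩
        rw [← p.length_reverse, hr]
        simp
    refine ⟨v, (SimpleGraph.edist_le q).trans ?_, hvu⟩
    rw [← hp, hq] at h
    exact_mod_cast Nat.le_of_succ_le_succ (by exact_mod_cast h)

/-- The vertices of a small balanced separator, taken one by one, form an even set separator. -/
theorem evenSetSeparator_of_rank {G : SimpleGraph (Fin n)} {w : Fin n → ℝ} {c : ℝ} {K : ℕ}
    {Z : Set (Fin n)} (hZ : Z.ncard ≤ K) (hsep : BalancedSeparator G w c Z) {out : Fin n → ℕ}
    (hout : ∀ v ∈ Z, out v = {u | u ≤ v ∧ u ∈ Z}.ncard) (hout' : ∀ v ∉ Z, out v = 0) :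
    EvenSetSeparator G w K c K (fun i => {v | out v = i + 1}) := by
  have hmem : ∀ v k, out v = k + 1 → v ∈ Z := by
    intro v k hv
    by_contra hvZ
    rw [hout' v hvZ] at hv
    omega
  have hmono : ∀ u ∈ Z, ∀ v ∈ Z, u < v → out u < out v := by
    intro u hu v hv huv
    rw [hout u hu, hout v hv]
    refine Set.ncard_lt_ncard ⟨fun a ha => ⟨ha.1.trans huv.le, ha.2⟩, fun hsub => ?_⟩
    exact absurd (hsub ⟨le_rfl, hv⟩).1 (not_le.2 huv)
  have hunion : (⋃ i : Fin K, {v | out v = i + 1}) = Z := by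
    ext v
    simp only [Set.mem_iUnion, Set.mem_ofPred_eq]
    constructor
    · rintro ⟨i, hi⟩
      exact hmem v i hi
    · intro hv
      have h1 : 0 < out v := by
        rw [hout v hv, Set.ncard_pos]
        exact ⟨v, le_rfl, hv⟩
      have h2 : out v ≤ K := by
        rw [hout v hv]
        exact (Set.ncard_le_ncard fun u hu => hu.2).trans hZ
      exact ⟨⟨out v - 1, by omega⟩, by simp only []; omega⟩
  refine ⟨⟨fun i j hij => ?_, fun i => ⟨fun v hv => ?_, fun x hx y hy hxy => ?_⟩⟩, fun D hD => ?_⟩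
  · rw [Set.disjoint_left]
    intro v hvi hvj
    simp only [Set.mem_ofPred_eq] at hvi hvj
    exact hij (Fin.ext (by omega))
  · simp only [Set.mem_compl_iff, Set.mem_iUnion, exists_prop, not_exists, not_and]
    intro j hj hvj
    simp only [Set.mem_ofPred_eq] at hv hvj
    rw [Fin.lt_def] at hj
    omega
  · exfalso
    simp only [Set.mem_ofPred_eq] at hx hy
    rcases lt_or_gt_of_ne hxy with h | h
    · have := hmono x (hmem _ _ hx) y (hmem _ _ hy) h
      omega
    · have := hmono y (hmem _ _ hy) x (hmem _ _ hx) h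
      omega
  · rw [hunion] at hD
    refine ⟨(Set.ncard_le_ncard fun v hv => ?_).trans hZ, hsep D hD⟩
    obtain ⟨hvD, u, hu, hvu⟩ := hv
    by_contra hvZ
    exact hvD (hD.mem_of_adj hu hvZ hvu.symm)

/-- An even set separator may be followed by empty sets. -/
theorem EvenSetSeparator.pad {V : Type*} [Fintype V] {G : SimpleGraph V} {w : V → ℝ} {c : ℝ}
    {k K d : ℕ} (hkK : k ≤ K) {Y : Fin k → Set V} (hY : EvenSetSeparator G w k c d Y)
    {Z : Fin K → Set V} (hZ : ∀ i : Fin k, Z (Fin.castLE hkK i) = Y i)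
    (hZ' : ∀ i : Fin K, k ≤ i → Z i = ∅) : EvenSetSeparator G w K c d Z := by
  have hcases : ∀ i : Fin K, (∃ j : Fin k, i = Fin.castLE hkK j) ∨ Z i = ∅ := by
    intro i
    by_cases hi : (i : ℕ) < k
    · exact Or.inl ⟨⟨i, hi⟩, rfl⟩
    · exact Or.inr (hZ' i (by omega))
  obtain ⟨⟨hdisj, heven⟩, hsep⟩ := hY
  have hunion : (⋃ i, Z i) = ⋃ i, Y i := by
    ext v
    simp only [Set.mem_iUnion]
    constructor
    · rintro ⟨i, hi⟩
      rcases hcases i with ⟨j, rfl⟩ | h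
      · exact ⟨j, hZ j ▸ hi⟩
      · rw [h] at hi
        exact hi.elim
    · rintro ⟨j, hj⟩
      exact ⟨_, (hZ j).symm ▸ hj⟩
  refine ⟨⟨fun i j hij => ?_, fun i => ?_⟩, fun D hD => hsep D (hunion ▸ hD)⟩
  · rcases hcases i with ⟨i, rfl⟩ | h
    · rcases hcases j with ⟨j, rfl⟩ | h'
      · rw [hZ, hZ]
        exact hdisj i j fun h => hij (h ▸ rfl)
      · rw [h']
        exact Set.disjoint_empty _
    · rw [h]
      exact Set.empty_disjoint _
  · rcases hcases i with ⟨i, rfl⟩ | h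
    · have : (⋃ j, ⋃ _ : j < Fin.castLE hkK i, Z j) = ⋃ j, ⋃ _ : j < i, Y j := by
        ext v
        simp only [Set.mem_iUnion, exists_prop]
        constructor
        · rintro ⟨j, hj, hv⟩
          rcases hcases j with ⟨j, rfl⟩ | h
          · exact ⟨j, hj, hZ j ▸ hv⟩
          · rw [h] at hv
            exact hv.elim
        · rintro ⟨j, hj, hv⟩
          exact ⟨_, hj, (hZ j).symm ▸ hv⟩
      rw [this, hZ]
      exact heven i
    · rw [h]
      exact ⟨Set.empty_subset _, fun x hx => hx.elim⟩

/-- Two vertices in the same component of a graph with a proper 2-colouring have the same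
colour exactly if they can be joined by steps of length two. -/
theorem linkedIn_square_iff {V : Type*} {G : SimpleGraph V} {T : Set V} {col : V → Bool}
    (hcol : ∀ x ∈ T, ∀ y ∈ T, G.Adj x y → col x ≠ col y) {x y : V} :
    LinkedIn (fun a b => ∃ u ∈ T, G.Adj a u ∧ G.Adj u b) T x y ↔
      LinkedIn G.Adj T x y ∧ col y = col x := by
  constructor
  · intro h
    induction h with
    | refl => exact ⟨.refl, rfl⟩
    | tail _ hbc ih =>
      obtain ⟨hb, hc, u, hu, hbu, huc⟩ := hbc
      refine ⟨(ih.1.tail ⟨hb, hu, hbu⟩).tail ⟨hu, hc, huc⟩, ?_⟩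
      rw [← ih.2]
      have h1 := hcol _ hb _ hu hbu
      have h2 := hcol _ hu _ hc huc
      revert h1 h2
      generalize col _ = p
      generalize col _ = q
      generalize col _ = r
      revert p q r
      decide
  · rintro ⟨h, hc⟩
    have key : (col y = col x → LinkedIn (fun a b => ∃ u ∈ T, G.Adj a u ∧ G.Adj u b) T x y) ∧
        (col y ≠ col x → ∃ v ∈ T, G.Adj v y ∧
          LinkedIn (fun a b => ∃ u ∈ T, G.Adj a u ∧ G.Adj u b) T x v) := by
      clear hc
      induction h with
      | refl => exact ⟨fun _ => .refl, fun h => (h rfl).elim⟩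
      | @tail b c _ hbc ih =>
        obtain ⟨hb, hc, hbc⟩ := hbc
        have hne := hcol b hb c hc hbc
        constructor
        · intro hcx
          obtain ⟨v, hv, hvb, hxv⟩ := ih.2 fun h => hne (h.trans hcx.symm)
          exact hxv.tail ⟨hv, hc, b, hb, hvb, hbc⟩
        · intro hcx
          refine ⟨b, hb, hbc, ih.1 ?_⟩
          revert hne hcx
          generalize col b = p
          generalize col c = q
          generalize col x = r
          revert p q r
          decide
    exact key.1 hc

/-- A bipartition is obtained by comparing the labels of the components of a bipartite graph with
the labels of the components of its square. -/
theorem isBipartition_of_labels {G : SimpleGraph (Fin n)} {T : Set (Fin n)} {col : Fin n → Bool}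
    (hcol : ∀ x ∈ T, ∀ y ∈ T, G.Adj x y → col x ≠ col y) {A A' : ℕ → ℕ → Prop}
    {S : ℕ → ℕ → Prop} {f g : ℕ → ℕ → ℕ} (hf : ∀ x : Fin n, IsLabelling A (S x) n (f x))
    (hg : ∀ x : Fin n, IsLabelling A' (S x) n (g x)) (hA : ∀ x y : Fin n, A x y ↔ G.Adj x y)
    (hA' : ∀ x y : Fin n, A' x y ↔ ∃ u ∈ T, G.Adj x u ∧ G.Adj u y)
    (hS : ∀ x y : Fin n, S x y ↔ y ∈ T) :
    IsBipartition G T {x | x ∈ T ∧ f x x = g x x} {x | x ∈ T ∧ f x x ≠ g x x} := by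
  have key : ∀ x ∈ T, ∃ t : Fin n, f x x = t ∧ LinkedIn G.Adj T x t ∧
      (∀ y, LinkedIn G.Adj T x y → y ≤ t) ∧ (f x x = g x x ↔ col t = col x) := by
    intro x hx
    obtain ⟨t, h1, h2, h3⟩ := (hf x).exists_label hA (hS x) hx
    obtain ⟨s, k1, k2, k3⟩ := (hg x).exists_label hA' (hS x) hx
    refine ⟨t, h1, h2, fun y hy => (h3 y hy).2, ?_⟩
    rw [h1, k1]
    rw [linkedIn_square_iff hcol] at k2
    constructor
    · intro h
      rw [Fin.ext h]
      exact k2.2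
    · intro h
      have h4 := (k3 t ((linkedIn_square_iff hcol).2 ⟨h2, h⟩)).2
      have h5 := (h3 s k2.1).2
      rw [le_antisymm h4 h5]
  have htop : ∀ x ∈ T, ∀ y ∈ T, G.Adj x y → ∃ t, (f x x = g x x ↔ col t = col x) ∧
      (f y y = g y y ↔ col t = col y) := by
    intro x hx y hy hxy
    obtain ⟨t, -, h2, h3, h4⟩ := key x hx
    obtain ⟨s, -, k2, k3, k4⟩ := key y hy
    obtain rfl : t = s := by
      refine le_antisymm (k3 t ?_) (h3 s ?_)
      · exact Relation.ReflTransGen.head ⟨hy, hx, hxy.symm⟩ h2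
      · exact Relation.ReflTransGen.head ⟨hx, hy, hxy⟩ k2
    exact ⟨t, h4, k4⟩
  refine ⟨?_, ?_, ?_, ?_⟩
  · ext x
    simp only [Set.mem_union, Set.mem_ofPred_eq]
    tauto
  · rw [Set.disjoint_left]
    exact fun x h1 h2 => h2.2 h1.2
  · rintro x ⟨hx, h1⟩ y ⟨hy, h2⟩ hxy
    obtain ⟨t, h3, h4⟩ := htop x hx y hy hxy
    exact hcol x hx y hy hxy ((h3.1 h1).symm.trans (h4.1 h2))
  · rintro x ⟨hx, h1⟩ y ⟨hy, h2⟩ hxy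
    obtain ⟨t, h3, h4⟩ := htop x hx y hy hxy
    have h5 := hcol x hx y hy hxy
    rw [ne_eq, h3] at h1
    rw [ne_eq, h4] at h2
    revert h1 h2 h5
    generalize col t = p
    generalize col x = q
    generalize col y = r
    revert p q r
    decide

theorem ncard_val_lt {m : ℕ} (hm : m ≤ n) : {z : Fin n | (z : ℕ) < m}.ncard = m := by
  classical
  rw [← count_eq_ncard n (· < m), Nat.count_eq_card_filter_range]
  have : (Finset.range n).filter (· < m) = Finset.range m := by
    ext z
    simp only [Finset.mem_filter, Finset.mem_range]
    omega
  rw [this, Finset.card_range]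

/-- Counting the numbers below some element of a set computes the maximum of the set. -/
theorem ncard_lt_eq_iff {P : ℕ → Prop} (hP : ∀ k, P k → k ≤ n) {k : ℕ} (hk : 0 < k) :
    {z : Fin n | ∃ j, P j ∧ (z : ℕ) < j}.ncard = k ↔ P k ∧ ∀ j, P j → j ≤ k := by
  have hmax : ∀ m, P m → (∀ j, P j → j ≤ m) → {z : Fin n | ∃ j, P j ∧ (z : ℕ) < j}.ncard = m := by
    intro m hm hmax
    have heq : {z : Fin n | ∃ j, P j ∧ (z : ℕ) < j} = {z : Fin n | (z : ℕ) < m} := by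
      ext z
      exact ⟨fun ⟨j, hj, hz⟩ => hz.trans_le (hmax j hj), fun hz => ⟨m, hm, hz⟩⟩
    rw [heq, ncard_val_lt (hP m hm)]
  refine ⟨fun h => ?_, fun h => hmax k h.1 h.2⟩
  have hex : ∃ j, P j := by
    by_contra! hno
    simp only [hno, false_and, exists_false, Set.ofPred_false, Set.ncard_empty] at h
    omega
  have hfin : {j | P j}.Finite := (Set.finite_Iic n).subset hP
  obtain ⟨m, hm, hmm⟩ := Set.exists_max_image _ id hfin hex
  have := hmax m hm hmm
  rw [h] at this
  subst this
  exact ⟨hm, hmm⟩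

end Reading

/-! ### The algorithm -/

section Algorithm

/-- The test `b or b'`. -/
def Test.or (b b' : Test) : Test := .not (.and (.not b) (.not b'))

@[simp] theorem Test.holds_or {m : Memory} {b b' : Test} :
    (b.or b').holds m ↔ b.holds m ∨ b'.holds m := by
  simp only [Test.or, Test.holds]
  tauto

@[simp] theorem Test.readsBelow_or {a : ℕ} {b b' : Test} :
    (b.or b').ReadsBelow a ↔ b.ReadsBelow a ∧ b'.ReadsBelow a := Iff.rfl

/-- The test `0 < t`. -/
def Term.isPos (t : Term) : Test := .lt (.lit 0) t

@[simp] theorem Term.holds_isPos {m : Memory} {t : Term} : t.isPos.holds m ↔ 0 < t.val m := Iff.rfl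

@[simp] theorem Term.readsBelow_isPos {a : ℕ} {t : Term} :
    t.isPos.ReadsBelow a ↔ t.ReadsBelow a := by
  simp [Term.isPos, Test.ReadsBelow, Term.ReadsBelow]

/-- The test `t = 0`. -/
def Term.isZero (t : Term) : Test := .eq t (.lit 0)

@[simp] theorem Term.holds_isZero {m : Memory} {t : Term} : t.isZero.holds m ↔ t.val m = 0 :=
  Iff.rfl

@[simp] theorem Term.readsBelow_isZero {a : ℕ} {t : Term} :
    t.isZero.ReadsBelow a ↔ t.ReadsBelow a := by
  simp [Term.isZero, Test.ReadsBelow, Term.ReadsBelow]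

@[simp] theorem readsBelow_entry {a b c d : ℕ} :
    (entry b c d).ReadsBelow a ↔ b < a ∧ 0 < a := by
  simp [entry, reg, Term.ReadsBelow]

/-- The vertex in register `c` is in the first class of the bipartition of the star covering. -/
def testLeft (c : ℕ) : Test :=
  .and (entry 42 c c).isZero (.eq (entry 46 c c) (entry 48 c c))

/-- The vertex in register `c` is in the second class of the bipartition of the star covering. -/
def testRight (c : ℕ) : Test :=
  .and (entry 42 c c).isZero (.not (.eq (entry 46 c c) (entry 48 c c)))

/-- The vertex in register `3` is in the input set. -/
def testInput : Test := (Term.get 2 (reg 3) (.lit 0)).isPos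

/-- The phases of the algorithm, which fill the arrays `4, 6, 8, …`. A counting phase fills the
entry in row `x` and column `y` with the number of the vertices `z` that pass the test, where
`x, y, z` are in the registers `1, 2, 3`. -/
def separatorPhases : List Phase := [
  -- `4`, `6`, `8`: the balls of radius one, two and three.
  .count (.and (.eq (reg 3) (reg 1)) (.or (.eq (reg 2) (reg 1)) (entry 1 1 2).isPos)),
  .count (.and (entry 4 1 3).isPos (entry 4 3 2).isPos),
  .count (.and (entry 6 1 3).isPos (entry 4 3 2).isPos),
  -- `10`, `12`, `14`, `16`: the components outside the ball of radius three around `x`, the number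
  -- of input vertices inside and outside the component of `y`, and whether there is a heavy one.
  .label 1 8,
  .count (.and testInput (.and (entry 8 1 3).isZero (.eq (entry 10 1 3) (entry 10 1 2)))),
  .count (.and testInput (.not (.and (entry 8 1 3).isZero (.eq (entry 10 1 3) (entry 10 1 2))))),
  .count (.and (entry 8 1 3).isZero (.lt (entry 14 1 3) (entry 12 1 3))),
  -- `18`, `20`, `22`, `24`: whether an earlier ball than the one around `x` is balanced, the first
  -- balanced ball, the rank of its vertices, and whether it exists.
  .count (.and (.lt (reg 3) (reg 1)) (entry 16 3 3).isZero),
  .count (.and (entry 16 3 3).isZero (.and (entry 18 3 3).isZero (entry 8 3 1).isPos)),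
  .count (.and (.not (.lt (reg 1) (reg 3))) (entry 20 3 3).isPos),
  .count (entry 16 3 3).isZero,
  -- `26`, `28`, `30`: as `10`, `12`, `14`, for the closed neighbourhood of `x`.
  .label 1 4,
  .count (.and testInput (.and (entry 4 1 3).isZero (.eq (entry 26 1 3) (entry 26 1 2)))),
  .count (.and testInput (.not (.and (entry 4 1 3).isZero (.eq (entry 26 1 3) (entry 26 1 2))))),
  -- `32`, `34`, `36`: the sets `B_x`, `N(B_x)` and `A_x`.
  .count (.and (.eq (reg 3) (reg 1)) (.and (entry 4 1 2).isZero
    (.lt (entry 30 1 2) (entry 28 1 2)))),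
  .count (.and (entry 32 1 3).isPos (.and (entry 1 2 3).isPos (entry 1 1 2).isPos)),
  .count (.and (.eq (reg 3) (reg 1)) (.and (.not (.eq (reg 2) (reg 1)))
    (.and (entry 32 1 2).isZero (entry 34 1 2).isZero))),
  -- `38`, `40`: the size of the symmetric difference of `B_x` and `B_y`, and the size of `B_x`.
  .count (.not (.eq (entry 32 1 3) (entry 32 2 3))),
  .count (entry 32 1 3).isPos,
  -- `42`: the number of vertices strictly below `y` in the order of the stars.
  .count (.and (.not (.eq (reg 3) (reg 2))) (.or
    (.and (entry 38 3 2).isZero (.lt (reg 3) (reg 2)))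
    (.and (entry 38 3 2).isPos (entry 36 3 2).isPos))),
  -- `44`, `46`, `48`: the square of the star covering, and the components of the star covering and
  -- of its square.
  .count (.and (entry 42 3 3).isZero (.and (entry 1 1 3).isPos (entry 1 3 2).isPos)),
  .label 1 42,
  .label 44 42,
  -- `50`, `52`: the core bag and the sets `D_x`.
  .count (.or (.and (.eq (reg 2) (reg 3)) (entry 42 2 2).isZero)
    (.and (testRight 3) (entry 34 3 2).isPos)),
  .count (.and (.eq (reg 3) (reg 1)) (.and (entry 36 1 2).isPos (entry 50 1 2).isPos)),
  -- `54`, `56`, `58`: the position of `y` in `D_x`, the numbers below some position of `y`, and the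
  -- maximal position of `x`.
  .count (.and (entry 52 1 3).isPos (.or (.lt (entry 40 3 3) (entry 40 2 2))
    (.and (.eq (entry 40 3 3) (entry 40 2 2)) (.not (.lt (reg 2) (reg 3)))))),
  .count (.and (testLeft 3) (.and (entry 52 3 2).isPos (.lt (reg 1) (entry 54 3 2)))),
  .count (entry 56 3 1).isPos,
  -- `60`: the number of the set of the output that contains `x`.
  .count (.or (.and (entry 24 1 1).isPos (.and (entry 20 1 1).isPos (.lt (reg 3) (entry 22 1 1))))
    (.and (entry 24 1 1).isZero (.or (.and (testLeft 1) (.lt (reg 3) (.lit 1)))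
      (.or (.and (testRight 1) (.lt (reg 3) (.lit 2)))
        (.and (entry 58 1 1).isPos (.lt (reg 3) (.succ (.succ (entry 58 1 1)))))))))]

theorem separatorPhases_wellFormed (i : ℕ) (hi : i < separatorPhases.length) :
    separatorPhases[i].WellFormed (2 + i) := by
  have hlen : separatorPhases.length = 29 := rfl
  rw [hlen] at hi
  interval_cases i <;>
    simp [separatorPhases, Phase.WellFormed, Test.ReadsBelow, Term.ReadsBelow, testLeft, testRight,
      testInput, reg]

variable {n : ℕ}

/-- The equations that hold for the arrays after all phases, with the vertices of `G` in place of
the registers. The numbers of the arrays are those in `separatorPhases`. Where a row does not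
matter, as for the arrays `42` and `50`, all rows have the same zeros. -/
structure SeparatorArrays (G : SimpleGraph (Fin n)) (X : Finset (Fin n))
    (M : ℕ → ℕ → ℕ → ℕ) : Prop where
  adj (x y : Fin n) : 0 < M 1 x y ↔ G.Adj x y
  input (x : Fin n) : 0 < M 2 x 0 ↔ x ∈ X
  ball₁ (x y : Fin n) : 0 < M 4 x y ↔ y = x ∨ G.Adj x y
  ball₂ (x y : Fin n) : 0 < M 6 x y ↔ ∃ z : Fin n, 0 < M 4 x z ∧ 0 < M 4 z y
  ball₃ (x y : Fin n) : 0 < M 8 x y ↔ ∃ z : Fin n, 0 < M 6 x z ∧ 0 < M 4 z y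
  label_ball₃ (x : Fin n) : IsLabelling (fun y z => 0 < M 1 y z) (fun y => M 8 x y = 0) n (M 10 x)
  inside_ball₃ (x y : Fin n) :
    M 12 x y = {z : Fin n | z ∈ X ∧ M 8 x z = 0 ∧ M 10 x z = M 10 x y}.ncard
  outside_ball₃ (x y : Fin n) :
    M 14 x y = {z : Fin n | z ∈ X ∧ ¬ (M 8 x z = 0 ∧ M 10 x z = M 10 x y)}.ncard
  heavy (x : Fin n) : 0 < M 16 x x ↔ ∃ z : Fin n, M 8 x z = 0 ∧ M 14 x z < M 12 x z
  earlier (x : Fin n) : 0 < M 18 x x ↔ ∃ z : Fin n, z < x ∧ M 16 z z = 0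
  separating (x : Fin n) : 0 < M 20 x x ↔
    ∃ z : Fin n, M 16 z z = 0 ∧ M 18 z z = 0 ∧ 0 < M 8 z x
  rank (x : Fin n) : M 22 x x = {z : Fin n | z ≤ x ∧ 0 < M 20 z z}.ncard
  balanced (x : Fin n) : 0 < M 24 x x ↔ ∃ z : Fin n, M 16 z z = 0
  label_ball₁ (x : Fin n) : IsLabelling (fun y z => 0 < M 1 y z) (fun y => M 4 x y = 0) n (M 26 x)
  inside_ball₁ (x y : Fin n) :
    M 28 x y = {z : Fin n | z ∈ X ∧ M 4 x z = 0 ∧ M 26 x z = M 26 x y}.ncard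
  outside_ball₁ (x y : Fin n) :
    M 30 x y = {z : Fin n | z ∈ X ∧ ¬ (M 4 x z = 0 ∧ M 26 x z = M 26 x y)}.ncard
  setB_le (x y : Fin n) : M 32 x y ≤ 1
  setB (x y : Fin n) : 0 < M 32 x y ↔ M 4 x y = 0 ∧ M 30 x y < M 28 x y
  nbhdB (x y : Fin n) : 0 < M 34 x y ↔ ∃ z : Fin n, 0 < M 32 x z ∧ G.Adj y z ∧ G.Adj x y
  setA (x y : Fin n) : 0 < M 36 x y ↔ y ≠ x ∧ M 32 x y = 0 ∧ M 34 x y = 0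
  diffB (x y : Fin n) : 0 < M 38 x y ↔ ∃ z : Fin n, M 32 x z ≠ M 32 y z
  sizeB (x : Fin n) : M 40 x x = {z : Fin n | 0 < M 32 x z}.ncard
  below (x y : Fin n) : 0 < M 42 x y ↔
    ∃ z : Fin n, z ≠ y ∧ (M 38 z y = 0 ∧ z < y ∨ 0 < M 38 z y ∧ 0 < M 36 z y)
  square (x y : Fin n) : 0 < M 44 x y ↔ ∃ z : Fin n, M 42 z z = 0 ∧ G.Adj x z ∧ G.Adj z y
  label_covering (x : Fin n) :
    IsLabelling (fun y z => 0 < M 1 y z) (fun y => M 42 x y = 0) n (M 46 x)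
  label_square (x : Fin n) :
    IsLabelling (fun y z => 0 < M 44 y z) (fun y => M 42 x y = 0) n (M 48 x)
  bag (x y : Fin n) : 0 < M 50 x y ↔ ∃ z : Fin n, y = z ∧ M 42 y y = 0 ∨
    (M 42 z z = 0 ∧ M 46 z z ≠ M 48 z z) ∧ 0 < M 34 z y
  bagA (x y : Fin n) : 0 < M 52 x y ↔ 0 < M 36 x y ∧ 0 < M 50 x y
  position (x y : Fin n) : M 54 x y = {z : Fin n | 0 < M 52 x z ∧
    (M 40 z z < M 40 y y ∨ M 40 z z = M 40 y y ∧ z ≤ y)}.ncard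
  belowPosition (x y : Fin n) : 0 < M 56 x y ↔
    ∃ z : Fin n, (M 42 z z = 0 ∧ M 46 z z = M 48 z z) ∧ 0 < M 52 z y ∧ x < M 54 z y
  maxPosition (x : Fin n) : M 58 x x = {z : Fin n | 0 < M 56 z x}.ncard
  output (x : Fin n) : M 60 x x = {z : Fin n |
    0 < M 24 x x ∧ 0 < M 20 x x ∧ z < M 22 x x ∨
    M 24 x x = 0 ∧ ((M 42 x x = 0 ∧ M 46 x x = M 48 x x) ∧ (z : ℕ) < 1 ∨
      (M 42 x x = 0 ∧ M 46 x x ≠ M 48 x x) ∧ (z : ℕ) < 2 ∨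
      0 < M 58 x x ∧ z ≤ M 58 x x + 1)}.ncard

theorem ncard_pos_iff_exists {p : Fin n → Prop} : 0 < {z | p z}.ncard ↔ ∃ z, p z := by
  rw [Set.ncard_pos]
  rfl

theorem separatorArrays_of_holds {G : SimpleGraph (Fin n)} {X : Finset (Fin n)}
    {M : ℕ → ℕ → ℕ → ℕ} (h1 : ∀ x y : Fin n, 0 < M 1 x y ↔ G.Adj x y)
    (h2 : ∀ x : Fin n, 0 < M 2 x 0 ↔ x ∈ X)
    (h : ∀ i (hi : i < separatorPhases.length), separatorPhases[i].Holds n M (2 + i)) :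
    SeparatorArrays G X M := by
  have hlen : separatorPhases.length = 29 := rfl
  have count : ∀ (i : ℕ) (b : Test) (hi : i < 29), separatorPhases[i] = .count b →
      ∀ x y : Fin n, M (2 * (2 + i)) x y =
        {z : Fin n | b.holds (store (regs n x y z) M)}.ncard := by
    intro i b hi hb x y
    have := h i hi
    rw [hb] at this
    exact this x x.2 y y.2
  have label : ∀ (i A S : ℕ) (hi : i < 29), separatorPhases[i] = .label A S →
      (∀ y z : Fin n, 0 < M A y z → 0 < M A z y) → ∀ x : Fin n,
      IsLabelling (fun y z => 0 < M A y z) (fun y => M S x y = 0) n (M (2 * (2 + i)) x) := by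
    intro i A S hi hb hsymm x
    have := h i hi
    rw [hb] at this
    exact this x x.2 fun y hy z hz => hsymm ⟨y, hy⟩ ⟨z, hz⟩
  have hsymm : ∀ y z : Fin n, 0 < M 1 y z → 0 < M 1 z y := by
    intro y z hyz
    rw [h1] at hyz ⊢
    exact hyz.symm
  have hsquare : ∀ x y : Fin n, 0 < M 44 x y ↔
      ∃ z : Fin n, M 42 z z = 0 ∧ G.Adj x z ∧ G.Adj z y := by
    intro x y
    rw [count 20 _ (by norm_num) rfl, ncard_pos_iff_exists]
    simp [Test.holds, regs, h1]
  have hB : ∀ x y : Fin n, M 32 x y =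
      {z : Fin n | z = x ∧ M 4 x y = 0 ∧ M 30 x y < M 28 x y}.ncard := by
    intro x y
    rw [count 14 _ (by norm_num) rfl]
    simp [Test.holds, regs, Fin.ext_iff]
  exact {
    adj := h1
    input := h2
    ball₁ := fun x y => by
      rw [count 0 _ (by norm_num) rfl, ncard_pos_iff_exists]
      simp [Test.holds, regs, h1, Fin.val_inj]
    ball₂ := fun x y => by
      rw [count 1 _ (by norm_num) rfl, ncard_pos_iff_exists]
      simp [Test.holds, regs]
    ball₃ := fun x y => by
      rw [count 2 _ (by norm_num) rfl, ncard_pos_iff_exists]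
      simp [Test.holds, regs]
    label_ball₃ := label 3 _ _ (by norm_num) rfl hsymm
    inside_ball₃ := fun x y => by
      rw [count 4 _ (by norm_num) rfl]
      simp [Test.holds, regs, testInput, Term.val, store, h2]
    outside_ball₃ := fun x y => by
      rw [count 5 _ (by norm_num) rfl]
      simp [Test.holds, regs, testInput, Term.val, store, h2]
    heavy := fun x => by
      rw [count 6 _ (by norm_num) rfl, ncard_pos_iff_exists]
      simp [Test.holds, regs]
    earlier := fun x => by
      rw [count 7 _ (by norm_num) rfl, ncard_pos_iff_exists]
      simp [Test.holds, regs]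
    separating := fun x => by
      rw [count 8 _ (by norm_num) rfl, ncard_pos_iff_exists]
      simp [Test.holds, regs]
    rank := fun x => by
      rw [count 9 _ (by norm_num) rfl]
      simp [Test.holds, regs]
    balanced := fun x => by
      rw [count 10 _ (by norm_num) rfl, ncard_pos_iff_exists]
      simp [regs]
    label_ball₁ := label 11 _ _ (by norm_num) rfl hsymm
    inside_ball₁ := fun x y => by
      rw [count 12 _ (by norm_num) rfl]
      simp [Test.holds, regs, testInput, Term.val, store, h2]
    outside_ball₁ := fun x y => by
      rw [count 13 _ (by norm_num) rfl]
      simp [Test.holds, regs, testInput, Term.val, store, h2]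
    setB_le := fun x y => by
      rw [hB]
      exact (Set.ncard_le_ncard fun z hz => hz.1).trans (Set.ncard_singleton x).le
    setB := fun x y => by
      rw [hB, ncard_pos_iff_exists]
      simp
    nbhdB := fun x y => by
      rw [count 15 _ (by norm_num) rfl, ncard_pos_iff_exists]
      simp [Test.holds, regs, h1]
    setA := fun x y => by
      rw [count 16 _ (by norm_num) rfl, ncard_pos_iff_exists]
      simp [Test.holds, regs, Fin.val_inj]
    diffB := fun x y => by
      rw [count 17 _ (by norm_num) rfl, ncard_pos_iff_exists]
      simp [Test.holds, regs]
    sizeB := fun x => by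
      rw [count 18 _ (by norm_num) rfl]
      simp [regs]
    below := fun x y => by
      rw [count 19 _ (by norm_num) rfl, ncard_pos_iff_exists]
      simp [Test.holds, regs, Fin.val_inj]
    square := hsquare
    label_covering := label 21 _ _ (by norm_num) rfl hsymm
    label_square := label 22 _ _ (by norm_num) rfl fun y z hyz => by
      rw [hsquare] at hyz ⊢
      obtain ⟨u, hu, h3, h4⟩ := hyz
      exact ⟨u, hu, h4.symm, h3.symm⟩
    bag := fun x y => by
      rw [count 23 _ (by norm_num) rfl, ncard_pos_iff_exists]
      simp [Test.holds, regs, testRight, Fin.val_inj]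
    bagA := fun x y => by
      rw [count 24 _ (by norm_num) rfl, ncard_pos_iff_exists]
      simp [Test.holds, regs, Fin.val_inj]
    position := fun x y => by
      rw [count 25 _ (by norm_num) rfl]
      simp [Test.holds, regs]
    belowPosition := fun x y => by
      rw [count 26 _ (by norm_num) rfl, ncard_pos_iff_exists]
      simp [Test.holds, regs, testLeft]
    maxPosition := fun x => by
      rw [count 27 _ (by norm_num) rfl]
      simp [regs]
    output := fun x => by
      rw [count 28 _ (by norm_num) rfl]
      simp [Test.holds, regs, testLeft, testRight, Term.val] }

/-- The algorithm: fill the arrays, and write the diagonal of the array `60` to the output. -/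
def separatorProgram : Program := .seq (phasesProgram 2 separatorPhases) (outputProgram 60)

open Classical in
theorem exists_runs_separatorProgram (hn : 0 < n) (G : SimpleGraph (Fin n))
    (X : Finset (Fin n)) : ∃ out t M, Runs separatorProgram (inputMemory G X) out t ∧
      t ≤ ((separatorPhases.map Phase.factor).sum + 40) * n ^ 3 ∧ SeparatorArrays G X M ∧
      ∀ v : Fin n, out 3 v 0 = M 60 v v := by
  set M₀ : ℕ → ℕ → ℕ → ℕ := fun a i j =>
    if a = 1 ∧ ∃ (hi : i < n) (hj : j < n), G.Adj ⟨i, hi⟩ ⟨j, hj⟩ then 1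
    else if a = 2 ∧ j = 0 ∧ ∃ hi : i < n, (⟨i, hi⟩ : Fin n) ∈ X then 1
    else 0 with hM₀
  have hinput : inputMemory G X = store (regs n 0 0 0) M₀ := by
    funext a i j
    simp only [inputMemory, store, hM₀]
    by_cases ha : a = 0
    · subst ha
      match i with
      | 0 => simp [regs]
      | 1 | 2 | 3 => simp [regs]
      | i + 4 => simp [regs]
    · simp [ha]
  have hreg : ∀ x, 3 < x → regs n 0 0 0 x = 0 := by
    intro x hx
    match x, hx with
    | x + 4, _ => rfl
  have hexec := Exec.seq (exec_phases hn separatorPhases two_pos separatorPhases_wellFormed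
    (e := regs n 0 0 0) rfl hreg (M := M₀) (fun a ha => by
      funext i j
      simp only [hM₀]
      rw [if_neg (by omega), if_neg (by omega)]))
    (P' := outputProgram 60) (T' := n * 27 + 12)
    (Q' := fun M' => ∃ M, SeparatorArrays G X M ∧ ∀ v : Fin n, M' 3 v 0 = M 60 v v) (by
      rintro e' M' he' ⟨hlow, hholds⟩
      refine (exec_outputProgram (by norm_num) (by norm_num) (he' 0 (Or.inl one_pos))).mono le_rfl
        fun M'' hM'' => ⟨M', separatorArrays_of_holds ?_ ?_ hholds, fun v => hM'' v v.2⟩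
      · intro x y
        rw [hlow 1 (by norm_num)]
        by_cases hxy : G.Adj x y <;> simp [hM₀, hxy]
      · intro x
        rw [hlow 2 (by norm_num)]
        by_cases hx : x ∈ X <;> simp [hM₀, hx])
  obtain ⟨e', M', t, h1, h2, -, M, h3, h4⟩ := hexec
  refine ⟨_, t, M, hinput ▸ h1, h2.trans ?_, h3, fun v => ?_⟩
  · have h1 : n ≤ n ^ 3 := Nat.le_self_pow (by norm_num) n
    have h3 : 1 ≤ n ^ 3 := Nat.one_le_pow _ _ hn
    nlinarith [h1, h3]
  · simpa [store] using h4 v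

end Algorithm

/-! ### Correctness of the algorithm -/

section Correctness

variable {n : ℕ} {G : SimpleGraph (Fin n)} {X : Finset (Fin n)} {M : ℕ → ℕ → ℕ → ℕ}

theorem ncard_le_succ_of_adj {V : Type*} [Finite V] {G : SimpleGraph V} {δ m : ℕ}
    (hδ : ∀ v, {u | G.Adj v u}.ncard ≤ δ) {S T : Set V} {a : V} (hT : T.ncard ≤ m)
    (h : ∀ u ∈ S, u = a ∨ ∃ y ∈ T, G.Adj y u) : S.ncard ≤ m * δ + 1 := by
  have hsub : S ⊆ {u | u ∈ S ∧ ∃ y ∈ T, G.Adj y u} ∪ {a} := by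
    intro u hu
    rcases h u hu with rfl | h'
    · exact Or.inr rfl
    · exact Or.inl ⟨hu, h'⟩
  refine (Set.ncard_le_ncard hsub).trans ((Set.ncard_union_le _ _).trans ?_)
  rw [Set.ncard_singleton]
  gcongr
  exact (ncard_le_mul_of_adj hδ fun u hu => hu.2).trans (Nat.mul_le_mul_right _ hT)

namespace SeparatorArrays

variable (h : SeparatorArrays G X M)
include h

theorem mem_ball₃ {x y : Fin n} (hxy : G.edist x y ≤ 3) : 0 < M 8 x y := by
  have h0 : ∀ v : Fin n, 0 < M 4 v v := fun v => (h.ball₁ v v).2 (Or.inl rfl)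
  have h1 : ∀ v, G.edist x v ≤ (1 : ℕ) → 0 < M 4 x v := by
    intro v hv
    rw [h.ball₁]
    rcases edist_le_succ (k := 0) hv with rfl | ⟨u, hu, huv⟩
    · exact Or.inl rfl
    · have : G.edist x u = 0 := le_antisymm (by simpa using hu) (zero_le)
      rw [SimpleGraph.edist_eq_zero_iff] at this
      exact Or.inr (this ▸ huv)
  have h2 : ∀ v, G.edist x v ≤ (2 : ℕ) → 0 < M 6 x v := by
    intro v hv
    rw [h.ball₂]
    rcases edist_le_succ (k := 1) hv with rfl | ⟨u, hu, huv⟩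
    · exact ⟨_, h0 _, h0 _⟩
    · exact ⟨u, h1 u hu, (h.ball₁ _ _).2 (Or.inr huv)⟩
  rw [h.ball₃]
  rcases edist_le_succ (k := 2) (by exact_mod_cast hxy) with rfl | ⟨u, hu, huv⟩
  · exact ⟨_, (h.ball₂ _ _).2 ⟨_, h0 _, h0 _⟩, h0 _⟩
  · exact ⟨u, h2 u hu, (h.ball₁ _ _).2 (Or.inr huv)⟩

theorem ncard_ball₃_le {δ : ℕ} (hδ : ∀ v, {u | G.Adj v u}.ncard ≤ δ) (x : Fin n) :
    {y : Fin n | 0 < M 8 x y}.ncard ≤ ∑ i ∈ Finset.range 4, δ ^ i := by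
  have h0 : ∀ v : Fin n, 0 < M 4 v v := fun v => (h.ball₁ v v).2 (Or.inl rfl)
  have h12 : ∀ v : Fin n, 0 < M 4 x v → 0 < M 6 x v := fun v hv => (h.ball₂ _ _).2 ⟨v, hv, h0 v⟩
  have h1 : {y : Fin n | 0 < M 4 x y}.ncard ≤ 1 * δ + 1 := by
    refine ncard_le_succ_of_adj (a := x) hδ (Set.ncard_singleton x).le fun u hu => ?_
    simpa using (h.ball₁ x u).1 hu
  have hstep₁ : ∀ u : Fin n, 0 < M 4 x u → u = x ∨ ∃ y ∈ {y : Fin n | 0 < M 4 x y}, G.Adj y u := by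
    intro u hu
    exact ((h.ball₁ x u).1 hu).imp id fun hxu => ⟨x, h0 x, hxu⟩
  have hstep₂ : ∀ u : Fin n, 0 < M 6 x u → u = x ∨ ∃ y ∈ {y : Fin n | 0 < M 4 x y}, G.Adj y u := by
    intro u hu
    obtain ⟨z, hxz, hzu⟩ := (h.ball₂ x u).1 hu
    rcases (h.ball₁ z u).1 hzu with rfl | hzu
    · exact hstep₁ _ hxz
    · exact Or.inr ⟨z, hxz, hzu⟩
  have h2 : {y : Fin n | 0 < M 6 x y}.ncard ≤ (1 * δ + 1) * δ + 1 :=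
    ncard_le_succ_of_adj (a := x) hδ h1 hstep₂
  have h3 : {y : Fin n | 0 < M 8 x y}.ncard ≤ ((1 * δ + 1) * δ + 1) * δ + 1 := by
    refine ncard_le_succ_of_adj (a := x) hδ h2 fun u hu => ?_
    obtain ⟨z, hxz, hzu⟩ := (h.ball₃ x u).1 hu
    rcases (h.ball₁ z u).1 hzu with rfl | hzu
    · exact (hstep₂ _ hxz).imp id fun ⟨y, hy, hyu⟩ => ⟨y, h12 y hy, hyu⟩
    · exact Or.inr ⟨z, hxz, hzu⟩
  refine h3.trans (le_of_eq ?_)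
  simp [Finset.sum_range_succ]
  ring

theorem heavy_iff_exists {x : Fin n} : 0 < M 16 x x ↔
    ∃ D, IsComponent G {y : Fin n | 0 < M 8 x y}ᶜ D ∧ 1 / 2 < weight (uniformWeight X) D := by
  have hT : {y : Fin n | 0 < M 8 x y}ᶜ = {y : Fin n | M 8 x y = 0} := by
    ext y
    simp
  have key := fun z => heavy_iff (T := {y : Fin n | M 8 x y = 0}) (X := X) (z := z)
    (h.label_ball₃ x) h.adj fun _ => Iff.rfl
  rw [h.heavy, hT]
  simp only [h.inside_ball₃, h.outside_ball₃]
  constructor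
  · rintro ⟨z, hz⟩
    obtain ⟨D, h1, -, h2⟩ := (key z).1 hz
    exact ⟨D, h1, h2⟩
  · rintro ⟨D, h1, h2⟩
    obtain ⟨z, hz⟩ := h1.nonempty
    exact ⟨z, (key z).2 ⟨D, h1, hz, h2⟩⟩

theorem setB_iff_exists {x y : Fin n} : 0 < M 32 x y ↔
    ∃ D, IsComponent G (closedNbhd G x)ᶜ D ∧ y ∈ D ∧ 1 / 2 < weight (uniformWeight X) D := by
  have hS : ∀ z : Fin n, M 4 x z = 0 ↔ z ∈ (closedNbhd G x)ᶜ := by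
    intro z
    have := h.ball₁ x z
    rw [Set.mem_compl_iff, closedNbhd, Set.mem_ofPred_eq, ← this]
    omega
  rw [h.setB, ← heavy_iff (h.label_ball₁ x) h.adj hS, h.inside_ball₁, h.outside_ball₁, hS]
  simp only [hS]

/-- If some ball of radius three is balanced, then the output consists of the vertices of the
first such ball, in sets with one vertex. -/
theorem evenSetSeparator_of_balanced {δ K : ℕ} (hδ : ∀ v, {u | G.Adj v u}.ncard ≤ δ)
    (hK : ∑ i ∈ Finset.range 4, δ ^ i ≤ K) {c : ℝ} (hc : 1 / 2 ≤ c)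
    (hex : ∃ z : Fin n, M 16 z z = 0) :
    EvenSetSeparator G (uniformWeight X) K c K (fun i => {v : Fin n | M 60 v v = i + 1}) := by
  obtain ⟨z, hz, hmin⟩ : ∃ z : Fin n, M 16 z z = 0 ∧ ∀ y : Fin n, y < z → M 16 y y ≠ 0 := by
    obtain ⟨z, hz, hmin⟩ := WellFounded.has_min (wellFounded_lt (α := Fin n))
      {z : Fin n | M 16 z z = 0} hex
    exact ⟨z, hz, fun y hy hy0 => hmin y hy0 hy⟩
  have hmem : ∀ v : Fin n, 0 < M 20 v v ↔ 0 < M 8 z v := by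
    intro v
    have hearlier : ∀ y : Fin n, M 18 y y = 0 ↔ ∀ u : Fin n, u < y → M 16 u u ≠ 0 := by
      intro y
      have := h.earlier y
      constructor
      · intro h0 u hu hu0
        have := this.2 ⟨u, hu, hu0⟩
        omega
      · intro hy
        by_contra h0
        obtain ⟨u, hu, hu0⟩ := this.1 (Nat.pos_of_ne_zero h0)
        exact hy u hu hu0
    rw [h.separating]
    constructor
    · rintro ⟨y, hy, hye, hv⟩
      rw [hearlier] at hye
      rcases lt_trichotomy y z with h' | rfl | h'
      · exact (hmin y h' hy).elim
      · exact hv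
      · exact (hye z h' hz).elim
    · exact fun hv => ⟨z, hz, (hearlier z).2 hmin, hv⟩
  have hpos : ∀ v : Fin n, 0 < M 24 v v := fun v => (h.balanced v).2 ⟨z, hz⟩
  have hout : ∀ v : Fin n, M 60 v v = {u : Fin n | 0 < M 8 z v ∧ (u : ℕ) < M 22 v v}.ncard := by
    intro v
    rw [h.output]
    simp only [hpos v, (hpos v).ne', hmem, true_and, false_and, or_false]
  refine evenSetSeparator_of_rank (Z := {v : Fin n | 0 < M 8 z v})
    ((h.ncard_ball₃_le hδ z).trans hK) ?_ (fun v hv => ?_) (fun v hv => ?_)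
  · intro D hD
    by_contra! hlt
    have := h.heavy_iff_exists.2 ⟨D, hD, hc.trans_lt hlt⟩
    omega
  · have hrank : M 22 v v = {u : Fin n | u ≤ v ∧ u ∈ {v : Fin n | 0 < M 8 z v}}.ncard := by
      rw [h.rank]
      simp only [hmem, Set.mem_ofPred_eq]
    rw [hout, ← hrank]
    simp only [Set.mem_ofPred_eq] at hv
    simp only [hv, true_and]
    refine ncard_val_lt ?_
    rw [h.rank]
    simpa using Set.ncard_le_card {u : Fin n | u ≤ v ∧ 0 < M 20 u u}
  · rw [hout]
    simp only [Set.mem_ofPred_eq] at hv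
    simp [hv]

theorem noLocalSeparator (hn : 0 < n) (hall : ∀ z : Fin n, 0 < M 16 z z) :
    NoLocalSeparator G (uniformWeight X) := by
  refine ⟨uniformWeight_nonneg X, sum_uniformWeight ?_, fun a Y hY => ?_⟩
  · obtain ⟨D, -, hD⟩ := h.heavy_iff_exists.1 (hall ⟨0, hn⟩)
    rw [half_lt_weight_uniformWeight] at hD
    have : 0 < {u | u ∈ X ∧ u ∈ D}.ncard := by omega
    obtain ⟨u, hu, -⟩ := ncard_pos_iff_exists.1 this
    exact ⟨u, hu⟩
  · by_contra! hbal
    obtain ⟨D, hD, hlt⟩ := h.heavy_iff_exists.1 (hall a)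
    have := BalancedSeparator.mono (uniformWeight_nonneg X)
      (Z := {y : Fin n | 0 < M 8 a y}) (fun u hu => h.mem_ball₃ (hY u hu)) hbal D hD
    linarith

end SeparatorArrays

/-- The first class of the bipartition of the star covering that the algorithm finds. -/
def leftClass (n : ℕ) (M : ℕ → ℕ → ℕ → ℕ) : Set (Fin n) :=
  {x | M 42 x x = 0 ∧ M 46 x x = M 48 x x}

/-- The second class of the bipartition of the star covering that the algorithm finds. -/
def rightClass (n : ℕ) (M : ℕ → ℕ → ℕ → ℕ) : Set (Fin n) :=
  {x | M 42 x x = 0 ∧ M 46 x x ≠ M 48 x x}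

/-- The numbering by the size of the heavy components, with ties broken by the names of the
vertices. -/
noncomputable def sizeNumbering (G : SimpleGraph (Fin n)) (w : Fin n → ℝ) (v : Fin n) : ℕ :=
  (starB G w v).ncard * n + v

theorem sizeNumbering_le_iff {w : Fin n → ℝ} {u v : Fin n} :
    sizeNumbering G w u ≤ sizeNumbering G w v ↔
      (starB G w u).ncard < (starB G w v).ncard ∨
        (starB G w u).ncard = (starB G w v).ncard ∧ u ≤ v := by
  have hu := u.2
  have hv := v.2
  rw [Fin.le_def]
  unfold sizeNumbering
  rcases lt_trichotomy (starB G w u).ncard (starB G w v).ncard with hlt | heq | hlt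
  · have := Nat.mul_le_mul_right n (Nat.succ_le_of_lt hlt)
    rw [Nat.succ_mul] at this
    constructor
    · exact fun _ => Or.inl hlt
    · intro _
      omega
  · rw [heq]
    omega
  · have := Nat.mul_le_mul_right n (Nat.succ_le_of_lt hlt)
    rw [Nat.succ_mul] at this
    constructor
    · intro _
      omega
    · rintro (h | h) <;> omega

namespace SeparatorArrays

variable (h : SeparatorArrays G X M) (hs : NoLocalSeparator G (uniformWeight X))
include h hs

theorem setB_iff {x y : Fin n} : 0 < M 32 x y ↔ y ∈ starB G (uniformWeight X) x := by
  rw [h.setB_iff_exists]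
  constructor
  · rintro ⟨D, hD, hy, hlt⟩
    rwa [← hs.eq_starB hD hlt]
  · exact fun hy => ⟨_, hs.isComponent_starB x, hy, hs.half_lt_weight_starB x⟩

theorem nbhdB_iff {x y : Fin n} : 0 < M 34 x y ↔ y ∈ nbhd G (starB G (uniformWeight X) x) := by
  rw [h.nbhdB, hs.mem_nbhd_iff]
  simp only [h.setB_iff hs]
  tauto

theorem setA_iff {x y : Fin n} : 0 < M 36 x y ↔ y ∈ starA G (uniformWeight X) x := by
  rw [h.setA, hs.mem_starA_iff, ← h.setB_iff hs, ← h.nbhdB_iff hs]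
  simp only [not_lt, Nat.le_zero]

theorem diffB_iff {x y : Fin n} :
    M 38 x y = 0 ↔ starB G (uniformWeight X) x = starB G (uniformWeight X) y := by
  have hd := h.diffB x y
  rw [← not_iff_not, ← ne_eq (M 38 _ _), ← Nat.pos_iff_ne_zero, hd, Set.ext_iff, not_forall]
  refine exists_congr fun z => not_congr ?_
  rw [← h.setB_iff hs, ← h.setB_iff hs]
  have h1 := h.setB_le x z
  have h2 := h.setB_le y z
  omega

theorem sizeB_eq {x : Fin n} : M 40 x x = (starB G (uniformWeight X) x).ncard := by
  rw [h.sizeB]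
  simp only [h.setB_iff hs]
  rfl

theorem below_iff {x y : Fin n} : M 42 x y = 0 ↔ y ∈ starCovering G (uniformWeight X) Fin.val := by
  rw [← not_iff_not, ← ne_eq (M 42 _ _), ← Nat.pos_iff_ne_zero, h.below]
  simp only [starCovering, Set.mem_ofPred_eq, hs.starLE_iff,
    Nat.pos_iff_ne_zero (n := M 38 _ _), ne_eq,
    h.diffB_iff hs, h.setA_iff hs, not_forall, exists_prop]
  refine exists_congr fun z => ?_
  rw [Fin.lt_def]
  tauto

theorem mem_leftClass {x : Fin n} :
    x ∈ leftClass n M ↔ x ∈ starCovering G (uniformWeight X) Fin.val ∧ M 46 x x = M 48 x x := by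
  rw [leftClass, Set.mem_ofPred_eq, h.below_iff hs]

theorem mem_rightClass {x : Fin n} :
    x ∈ rightClass n M ↔ x ∈ starCovering G (uniformWeight X) Fin.val ∧ M 46 x x ≠ M 48 x x := by
  rw [rightClass, Set.mem_ofPred_eq, h.below_iff hs]

theorem coreSetup (hG : PawFriendly G) :
    CoreSetup G (uniformWeight X) Fin.val (sizeNumbering G (uniformWeight X))
      (leftClass n M) (rightClass n M) := by
  refine ⟨hs, hG, Fin.val_injective, ?_,
    hs.isLinearExtension_of_lex Fin.val_injective fun v => v.2⟩
  obtain ⟨col, hcol⟩ := hG.1.exists_twoColouring (S := starCovering G (uniformWeight X) Fin.val)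
    fun x hx y hy z hz hxy hyz hxz =>
      hs.starCovering_triangle_free hG Fin.val_injective hx hy hz hxy hyz hxz
  have := isBipartition_of_labels hcol (S := fun x y => M 42 x y = 0) h.label_covering
    h.label_square h.adj (fun x y => ?_) fun x y => h.below_iff hs
  · convert this using 1
    · ext x
      exact h.mem_leftClass hs
    · ext x
      exact h.mem_rightClass hs
  · rw [h.square]
    simp only [h.below_iff hs]

variable (hG : PawFriendly G)
include hG

theorem bag_iff {x y : Fin n} :
    0 < M 50 x y ↔ y ∈ coreBag G (uniformWeight X) Fin.val (rightClass n M) := by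
  rw [h.bag, (h.coreSetup hs hG).mem_coreBag_iff]
  simp only [h.below_iff hs, h.mem_rightClass hs, h.nbhdB_iff hs]
  constructor
  · rintro ⟨z, ⟨-, hy⟩ | hz⟩
    · exact Or.inl hy
    · exact Or.inr ⟨z, hz⟩
  · rintro (hy | ⟨z, hz⟩)
    · exact ⟨y, Or.inl ⟨rfl, hy⟩⟩
    · exact ⟨z, Or.inr hz⟩

theorem bagA_iff {x y : Fin n} :
    0 < M 52 x y ↔ y ∈ coreA G (uniformWeight X) Fin.val (rightClass n M) x := by
  rw [h.bagA, h.setA_iff hs, h.bag_iff hs hG]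
  rfl

theorem position_eq {x y : Fin n} : M 54 x y =
    {u ∈ coreA G (uniformWeight X) Fin.val (rightClass n M) x |
      sizeNumbering G (uniformWeight X) u ≤ sizeNumbering G (uniformWeight X) y}.ncard := by
  rw [h.position]
  simp only [h.bagA_iff hs hG, h.sizeB_eq hs, sizeNumbering_le_iff]

theorem maxPosition_eq {v : Fin n} : M 58 v v = {z : Fin n | ∃ j,
    v ∈ preLayer G (uniformWeight X) Fin.val (sizeNumbering G (uniformWeight X))
      (leftClass n M) (rightClass n M) j ∧
      (z : ℕ) < j}.ncard := by
  rw [h.maxPosition]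
  congr 1
  ext z
  simp only [Set.mem_ofPred_eq, h.belowPosition, preLayer, h.bagA_iff hs hG, h.position_eq hs hG,
    h.mem_leftClass hs, h.below_iff hs]
  constructor
  · rintro ⟨x, hx, hv, hz⟩
    exact ⟨_, ⟨x, hx, hv, rfl⟩, hz⟩
  · rintro ⟨_, ⟨x, hx, hv, rfl⟩, hz⟩
    exact ⟨x, hx, hv, hz⟩

theorem mem_preLayer_le {δ : ℕ} (hδ : ∀ v, {u | G.Adj v u}.ncard ≤ δ) {v : Fin n} {j : ℕ}
    (hv : v ∈ preLayer G (uniformWeight X) Fin.val (sizeNumbering G (uniformWeight X))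
      (leftClass n M) (rightClass n M) j) :
    j ≤ δ ^ 2 ∧ j + 2 ≤ n ∧ v ∉ starCovering G (uniformWeight X) Fin.val := by
  have hc := h.coreSetup hs hG
  obtain ⟨x, hx, hvx, rfl⟩ := hv
  have hxc := ((h.mem_leftClass hs).1 hx).1
  have hvc := hc.coreA_not_mem_covering hxc hvx
  have hle : {u ∈ coreA G (uniformWeight X) Fin.val (rightClass n M) x |
      sizeNumbering G (uniformWeight X) u ≤ sizeNumbering G (uniformWeight X) v}.ncard ≤
      (coreA G (uniformWeight X) Fin.val (rightClass n M) x).ncard :=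
    Set.ncard_le_ncard fun u hu => hu.1
  refine ⟨hle.trans (hc.ncard_coreA_le hδ hxc), ?_, hvc⟩
  -- The set `D_x` misses `x` and a vertex of the second class that `v` is adjacent to.
  obtain ⟨z, hz, -⟩ := (hc.mem_coreBag_iff.1 hvx.2).resolve_left hvc
  have hzc := ((h.mem_rightClass hs).1 hz).1
  have hxz : x ≠ z := by
    rintro rfl
    exact ((h.mem_rightClass hs).1 hz).2 ((h.mem_leftClass hs).1 hx).2
  have hsub : coreA G (uniformWeight X) Fin.val (rightClass n M) x ⊆ ({x, z} : Set (Fin n))ᶜ := by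
    rintro u hu (rfl | rfl)
    · exact hc.coreA_not_mem_covering hxc hu hxc
    · exact hc.coreA_not_mem_covering hxc hu hzc
  have h2 := Set.ncard_le_ncard hsub
  have h3 := Set.ncard_add_ncard_compl ({x, z} : Set (Fin n))
  rw [Set.ncard_pair hxz, Nat.card_fin] at h3
  omega

theorem maxPosition_eq_iff {δ : ℕ} (hδ : ∀ v, {u | G.Adj v u}.ncard ≤ δ) {v : Fin n} {k : ℕ}
    (hk : 0 < k) : M 58 v v = k ↔ k ≤ δ ^ 2 ∧
      v ∈ layer G (uniformWeight X) Fin.val (sizeNumbering G (uniformWeight X))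
      (leftClass n M) (rightClass n M) (δ ^ 2) k := by
  have hle := fun j => h.mem_preLayer_le hs hG hδ (v := v) (j := j)
  rw [h.maxPosition_eq hs hG, ncard_lt_eq_iff (fun j hj => by have := (hle j hj).2.1; omega) hk]
  simp only [layer, Set.mem_sdiff, Set.mem_iUnion, Set.mem_Ioc, exists_prop, not_exists, not_and]
  constructor
  · rintro ⟨h1, h2⟩
    refine ⟨(hle k h1).1, h1, fun j hj hvj => ?_⟩
    have := h2 j hvj
    omega
  · rintro ⟨-, h1, h2⟩
    refine ⟨h1, fun j hj => ?_⟩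
    by_contra! hkj
    exact h2 j ⟨hkj, (hle j hj).1⟩ hj

theorem output_eq {δ : ℕ} (hδ : ∀ v, {u | G.Adj v u}.ncard ≤ δ) (hall : ∀ z : Fin n, 0 < M 16 z z)
    {v : Fin n} : (v ∈ leftClass n M → M 60 v v = 1) ∧ (v ∈ rightClass n M → M 60 v v = 2) ∧
      (v ∉ leftClass n M → v ∉ rightClass n M →
        M 60 v v = if 0 < M 58 v v then M 58 v v + 2 else 0) := by
  have hn : 0 < n := v.pos
  have h0 : M 24 v v = 0 := by
    by_contra hne
    obtain ⟨z, hz⟩ := (h.balanced v).1 (Nat.pos_of_ne_zero hne)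
    exact (hall z).ne' hz
  have hmax : 0 < M 58 v v → v ∉ starCovering G (uniformWeight X) Fin.val ∧ M 58 v v + 2 ≤ n := by
    intro hpos
    have := ((h.maxPosition_eq_iff hs hG hδ hpos).1 rfl).2.1
    have := h.mem_preLayer_le hs hG hδ this
    exact ⟨this.2.2, this.2.1⟩
  have hout : M 60 v v = {z : Fin n | v ∈ leftClass n M ∧ (z : ℕ) < 1 ∨
      v ∈ rightClass n M ∧ (z : ℕ) < 2 ∨ 0 < M 58 v v ∧ (z : ℕ) < M 58 v v + 2}.ncard := by
    rw [h.output]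
    simp only [h0, lt_irrefl, false_and, true_and, false_or]
    simp only [← Nat.lt_succ_iff]
    rfl
  have hdisj : v ∈ leftClass n M → v ∉ rightClass n M := fun h1 h2 => h2.2 h1.2
  have hpos : v ∈ leftClass n M ∨ v ∈ rightClass n M → ¬ 0 < M 58 v v := by
    rintro (hv | hv) hp
    · exact (hmax hp).1 ((h.mem_leftClass hs).1 hv).1
    · exact (hmax hp).1 ((h.mem_rightClass hs).1 hv).1
  refine ⟨fun hv => ?_, fun hv => ?_, fun hv hv' => ?_⟩
  · rw [hout]
    simp only [hv, hdisj hv, hpos (Or.inl hv), true_and, false_and, or_false]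
    exact ncard_val_lt hn
  · have hvl : v ∉ leftClass n M := fun h1 => hdisj h1 hv
    rw [hout]
    simp only [hv, hvl, hpos (Or.inr hv), true_and, false_and, or_false, false_or]
    refine ncard_val_lt ?_
    -- A graph with one vertex has only one label.
    have h1 := (h.label_covering v v v.2 hv.1).1
    have h2 := (h.label_square v v v.2 hv.1).1
    have := hv.2
    omega
  · rw [hout]
    simp only [hv, hv', false_and, false_or]
    split_ifs with hp
    · simp only [hp, true_and]
      exact ncard_val_lt (hmax hp).2
    · simp [hp]

/-- If no ball of radius three is balanced, then the output consists of the sets of the core bag. -/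
theorem evenSetSeparator_of_not_balanced {δ K : ℕ} (hδ : ∀ v, {u | G.Adj v u}.ncard ≤ δ)
    (hδ0 : 0 < δ) (hK : δ ^ 2 + (δ + 1) ≤ K) {c : ℝ} (hc : 1 / 2 ≤ c)
    (hall : ∀ z : Fin n, 0 < M 16 z z) :
    EvenSetSeparator G (uniformWeight X) K c K (fun i => {v : Fin n | M 60 v v = i + 1}) := by
  have hcs := h.coreSetup hs hG
  have hsep := hcs.evenSetSeparator_coreTuple (fun x hx => hcs.ncard_coreA_le hδ
    ((h.mem_leftClass hs).1 hx).1) hδ hK hc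
  have hcases : ∀ (v : Fin n) (i : ℕ), M 60 v v = i + 1 ↔ (i = 0 ∧ v ∈ leftClass n M) ∨
      (i = 1 ∧ v ∈ rightClass n M) ∨ (2 ≤ i ∧ i < δ ^ 2 + 2 ∧ v ∈ layer G (uniformWeight X) Fin.val
        (sizeNumbering G (uniformWeight X))
      (leftClass n M) (rightClass n M) (δ ^ 2) (i - 1)) := by
    intro v i
    obtain ⟨h1, h2, h3⟩ := h.output_eq hs hG hδ hall (v := v)
    have hlayer : ∀ k, v ∈ layer G (uniformWeight X) Fin.val (sizeNumbering G (uniformWeight X))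
      (leftClass n M) (rightClass n M)
        (δ ^ 2) k → v ∉ leftClass n M ∧ v ∉ rightClass n M := by
      intro k hk
      have := (h.mem_preLayer_le hs hG hδ hk.1).2.2
      exact ⟨fun hv => this ((h.mem_leftClass hs).1 hv).1,
        fun hv => this ((h.mem_rightClass hs).1 hv).1⟩
    by_cases hl : v ∈ leftClass n M
    · have hr : v ∉ rightClass n M := fun h' => h'.2 hl.2
      have hk : ∀ k, v ∉ layer G (uniformWeight X) Fin.val (sizeNumbering G (uniformWeight X))
          (leftClass n M) (rightClass n M) (δ ^ 2) k := fun k hk => (hlayer k hk).1 hl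
      rw [h1 hl]
      simp only [hl, hr, hk, and_true, and_false, or_false]
      omega
    by_cases hr : v ∈ rightClass n M
    · have hk : ∀ k, v ∉ layer G (uniformWeight X) Fin.val (sizeNumbering G (uniformWeight X))
          (leftClass n M) (rightClass n M) (δ ^ 2) k := fun k hk => (hlayer k hk).2 hr
      rw [h2 hr]
      simp only [hl, hr, hk, and_true, and_false, or_false, false_or]
      omega
    rw [h3 hl hr]
    simp only [hl, hr, and_false, false_or]
    constructor
    · intro hi
      split_ifs at hi with hp
      have := (h.maxPosition_eq_iff hs hG hδ hp).1 rfl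
      rw [show M 58 v v = i - 1 by omega] at this
      exact ⟨by omega, by omega, this.2⟩
    · rintro ⟨hi, hi', hv⟩
      have := (h.maxPosition_eq_iff hs hG hδ (v := v) (k := i - 1) (by omega)).2 ⟨by omega, hv⟩
      rw [if_pos (by omega)]
      omega
  refine hsep.pad (by omega) (fun i => ?_) (fun i hi => ?_)
  · ext v
    rw [Set.mem_ofPred_eq, Fin.val_castLE, hcases]
    rcases Nat.lt_or_ge i.val 2 with hi | hi
    · rcases Nat.lt_or_ge i.val 1 with hi' | hi'
      · rw [CoreSetup.coreTuple_zero (show i.val = 0 by omega)]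
        refine ⟨?_, fun hv => Or.inl ⟨by omega, hv⟩⟩
        rintro (⟨-, hv⟩ | ⟨h', -⟩ | ⟨h', -⟩)
        exacts [hv, by omega, by omega]
      · rw [CoreSetup.coreTuple_one (show i.val = 1 by omega)]
        refine ⟨?_, fun hv => Or.inr (Or.inl ⟨by omega, hv⟩)⟩
        rintro (⟨h', -⟩ | ⟨-, hv⟩ | ⟨h', -⟩)
        exacts [by omega, hv, by omega]
    · rw [CoreSetup.coreTuple_layer hi]
      refine ⟨?_, fun hv => Or.inr (Or.inr ⟨hi, i.2, hv⟩)⟩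
      rintro (⟨h', -⟩ | ⟨h', -⟩ | ⟨-, -, hv⟩)
      exacts [by omega, by omega, hv]
  · ext v
    rw [Set.mem_ofPred_eq, hcases]
    simp only [Set.mem_empty_iff_false, iff_false]
    omega

end SeparatorArrays

/-- For any `c ≥ 1 / 2` the algorithm balances with the constant `1 / 2`, so it does not have to
compare weights with a real number. -/
theorem tame_pawFriendly {c : ℝ} (hc : 1 / 2 ≤ c) {δ : ℕ} (hδ : 0 < δ) {K : ℕ}
    (hK : K = ∑ i ∈ Finset.range (δ + 4), δ ^ i) :
    Tame (fun _ G => PawFriendly G ∧ HasMaxDegree G δ) K c K 3 := by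
  refine ⟨separatorProgram, (separatorPhases.map Phase.factor).sum + 40, fun n G hG X => ?_⟩
  obtain ⟨hG, hmax⟩ := hG
  have hn : 0 < n := by
    rcases Nat.eq_zero_or_pos n with rfl | hn
    · unfold HasMaxDegree at hmax
      rw [SimpleGraph.maxDegree_of_subsingleton] at hmax
      omega
    · exact hn
  obtain ⟨out, t, M, hrun, ht, h, hout⟩ := exists_runs_separatorProgram hn G X
  refine ⟨out, t, hrun, ht, ?_⟩
  have hsets : outputSets n K out = fun i : Fin K => {v : Fin n | M 60 v v = i + 1} := by
    funext i
    simp only [outputSets, hout]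
  rw [hsets]
  by_cases hex : ∃ z : Fin n, M 16 z z = 0
  · refine h.evenSetSeparator_of_balanced hmax.ncard_le ?_ hc hex
    rw [hK]
    exact Finset.sum_le_sum_of_subset (Finset.range_subset_range.2 (by omega))
  · have hall : ∀ z : Fin n, 0 < M 16 z z := fun z =>
      Nat.pos_of_ne_zero fun h0 => hex ⟨z, h0⟩
    exact h.evenSetSeparator_of_not_balanced (h.noLocalSeparator hn hall) hG hmax.ncard_le hδ
      (hK ▸ le_sum_pow (by omega)) hc hall

end Correctness

end TameGraphs

theorem theorem1p3 (c : ℝ) (hc : c ∈ Set.Ico (1 / 2 : ℝ) 1) (δ : ℕ) (hδ : 0 < δ) (K : ℕ)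
    (hK : K = ∑ i ∈ Finset.range (δ + 4), δ ^ i) :
    TameGraphs.Tame (fun _ G => TameGraphs.PawFriendly G ∧ TameGraphs.HasMaxDegree G δ) K c K 3 ∧
    ∀ (V : Type) [Fintype V] (G : SimpleGraph V),
      TameGraphs.PawFriendly G → TameGraphs.HasMaxDegree G δ →
      ∀ w : V → ℝ, (∀ v, 0 ≤ w v) → ∑ v, w v = 1 →
      (¬ ∃ Y, TameGraphs.Bounded G (δ + 3) Y ∧ TameGraphs.BalancedSeparator G w c Y) →
      ∀ ord : V → ℕ, Function.Injective ord →
        (∃ X₁ X₂, TameGraphs.IsBipartition G (TameGraphs.starFreeBag G w ord) X₁ X₂) ∧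
        (∃ ℓ, TameGraphs.IsLinearExtension G w ord ℓ) ∧
        ∀ X₁ X₂, TameGraphs.IsBipartition G (TameGraphs.starFreeBag G w ord) X₁ X₂ →
        ∀ ℓ, TameGraphs.IsLinearExtension G w ord ℓ →
          (⋃ i, TameGraphs.coreTuple G w ord ℓ X₁ X₂ (δ ^ 2) i) =
            TameGraphs.coreBag G w ord X₂ ∧
          TameGraphs.EvenSetSeparator G w (δ ^ 2 + 2) c K
            (TameGraphs.coreTuple G w ord ℓ X₁ X₂ (δ ^ 2)) := by
  refine ⟨TameGraphs.tame_pawFriendly hc.1 hδ hK, ?_⟩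
  intro V _ G hG hmax w hw htot hno ord hord
  exact TameGraphs.coreTuple_of_no_bounded_separator hc.1 hK hG hmax.ncard_le
    (TameGraphs.noLocalSeparator_of_not_exists hc.1 (by omega) hw htot hno) hord
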